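/- Let $m,k\ge 0$, $n=m+k$, and let $e_1,\dots,e_n$ be the standard basis of $\mathbb C^n$. Let $\mathrm{Gr}(m,n)$ be the Grassmannian of $m$-dimensional subspaces of $\mathbb C^n$, a projective variety over $\mathbb C$ via the Plücker embedding. A Young diagram $\lambda$ contained in the rectangle with $m$ rows and $k$ columns is identified with the partition $k\ge\lambda_1\ge\dots\ge\lambda_m\ge 0$ of its row lengths. The corresponding Schubert variety and opposite Schubert variety are $$X_\lambda=\{\Sigma\in \mathrm{Gr}(m,n):\dim(\Sigma\cap\langle e_1,\dots,e_{\lambda_i+m-i+1}\rangle)\ge m-i+1\text{ for } i=1,\dots,m\},$$ $$X^\lambda=\{\Sigma\in \mathrm{Gr}(m,n):\dim(\Sigma\cap\langle e_n,e_{n-1},\dots,e_{\lambda_i+m-i+1}\rangle)\ge i\text{ for } i=1,\dots,m\}.$$ For Young diagrams $\lambda\subseteq\nu$ contained in this rectangle, the skew diagram $\theta=\nu/\lambda$ consists of the boxes of $\nu$ that are not in $\lambda$, and the corresponding Richardson variety is $X_\theta=X_\nu\cap X^\lambda\subseteq \mathrm{Gr}(m,n)$. Let $P(\theta)$ be the poset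 of boxes of $\theta$ whose order is generated by the covering relations $x<y$ if $x$ is immediately to the left of $y$ or immediately above $y$. The connected components of a poset are the classes of the equivalence relation generated by its order, with the induced order. Two posets $P,Q$ are semi-isomorphic, written $P\sim Q$, if there is a bijection $f$ between their sets of connected components such that for each connected component $P_i$ of $P$, either $P_i\cong f(P_i)$ or $P_i^{\mathrm{op}}\cong f(P_i)$. **Proposition.** Let $X=\mathrm{Gr}(m,n)$ and $X'=\mathrm{Gr}(m',n')$ be two (possibly different) Grassmannians, and let $X_\theta\subseteq X$ and $X'_{\theta'}\subseteq X'$ be the Richardson varieties of skew diagrams $\theta$ and $\theta'$ contained in the $m\times(n-m)$ and $m'\times(n'-m')$ rectangles, respectively. If $P(\theta)\sim P(\theta')$, then $X_\theta\cong X'_{\theta'}$ as varieties over $\mathbb C$. -/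

import Mathlib

/-! ### Posets and semi-isomorphism -/

namespace PosetComponents

/-- Two elements of a poset lie in the same connected component if they are joined by a fence
`x = z₀, z₁, …, z_l = y` in which consecutive elements are comparable, that is, if they are
identified by the equivalence relation generated by `≤`. -/
def setoid (P : Type*) [PartialOrder P] : Setoid P :=
  Relation.EqvGen.setoid (fun x y : P => x ≤ y)

/-- The set of connected components of a poset. -/
def Component (P : Type*) [PartialOrder P] : Type _ :=
  Quotient (setoid P)

/-- The connected component of a given element. -/
def componentOf {P : Type*} [PartialOrder P] (x : P) : Component P :=
  Quotient.mk (setoid P) x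

/-- The elements of a connected component, with the order induced from `P`. -/
abbrev Elements {P : Type*} [PartialOrder P] (c : Component P) : Type _ :=
  {x : P // componentOf x = c}

/-- Two posets are semi-isomorphic if there is a bijection between their sets of connected
components such that corresponding components are isomorphic or opposite. -/
def SemiIsomorphic (P Q : Type*) [PartialOrder P] [PartialOrder Q] : Prop :=
  ∃ f : Component P ≃ Component Q, ∀ c : Component P,
    Nonempty (Elements c ≃o Elements (f c)) ∨ Nonempty ((Elements c)ᵒᵈ ≃o Elements (f c))

end PosetComponents

/-! ### Skew diagrams -/

/-- A skew diagram `outer / inner` in the rectangle with `m` rows and `k` columns: two Young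
diagrams `inner ⊆ outer` contained in the rectangle. (Young diagrams are those of Mathlib: the box
`(i, j)` is in row `i` from the top and column `j` from the left, both counted from `0`, and
`YoungDiagram.rowLen i` is the number of boxes in row `i`.) -/
structure SkewDiagram (m k : ℕ) where
  inner : YoungDiagram
  outer : YoungDiagram
  inner_le_outer : inner ≤ outer
  outer_le_rectangle : outer.cells ⊆ Finset.range m ×ˢ Finset.range k

namespace SkewDiagram

variable {m k : ℕ}

/-- The boxes of a skew diagram; they are the elements of the poset `P(θ)`. -/
def Box (θ : SkewDiagram m k) : Type :=
  {b : ℕ × ℕ // b ∈ θ.outer ∧ b ∉ θ.inner}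

/-- `x` is immediately to the left of `y` or immediately above `y`. -/
def Box.Covers {θ : SkewDiagram m k} (x y : θ.Box) : Prop :=
  (x.1.1 = y.1.1 ∧ x.1.2 + 1 = y.1.2) ∨ (x.1.1 + 1 = y.1.1 ∧ x.1.2 = y.1.2)

theorem Box.le_of_reflTransGen {θ : SkewDiagram m k} {x y : θ.Box}
    (h : Relation.ReflTransGen Box.Covers x y) : x.1.1 ≤ y.1.1 ∧ x.1.2 ≤ y.1.2 := by
  induction h with
  | refl => exact ⟨le_rfl, le_rfl⟩
  | tail _ hc ih =>
    rcases hc with ⟨h1, h2⟩ | ⟨h1, h2⟩ <;> omega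

/-- The poset `P(θ)`: the order on the boxes of `θ` generated by the covering relations `x < y`
if `x` is immediately to the left of `y` or immediately above `y`. -/
instance (θ : SkewDiagram m k) : PartialOrder θ.Box where
  le x y := Relation.ReflTransGen Box.Covers x y
  le_refl _ := Relation.ReflTransGen.refl
  le_trans _ _ _ h1 h2 := h1.trans h2
  le_antisymm x y h1 h2 := by
    have a := Box.le_of_reflTransGen h1
    have b := Box.le_of_reflTransGen h2
    exact Subtype.ext (Prod.ext (by omega) (by omega))

end SkewDiagram

/-! ### Subvarieties of projective space

Closed (more generally, arbitrary) subsets of a projective space over `ℂ` with the Zariski topology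
and their regular functions in the classical sense. -/

namespace ProjectiveVariety

open scoped LinearAlgebra.Projectivization Topology

/-- The projective space with homogeneous coordinates indexed by `ι`. -/
abbrev Space (ι : Type) : Type := ℙ ℂ (ι → ℂ)

/-- The locus where `F` does not vanish. For homogeneous `F`, this does not depend on the
representative of `p`. -/
def nonvanishing {ι : Type} (F : MvPolynomial ι ℂ) : Set (Space ι) :=
  {p | MvPolynomial.eval p.rep F ≠ 0}

/-- The Zariski topology on projective space: its basic open sets are the nonvanishing loci of
homogeneous polynomials. -/
abbrev zariski (ι : Type) : TopologicalSpace (Space ι) :=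
  TopologicalSpace.generateFrom
    {U | ∃ (d : ℕ) (F : MvPolynomial ι ℂ), F.IsHomogeneous d ∧ U = nonvanishing F}

/-- The Zariski topology on a subset of projective space. -/
abbrev zariskiOn {ι : Type} (Y : Set (Space ι)) : TopologicalSpace Y :=
  (zariski ι).induced Subtype.val

/-- The function `f` is regular on the open subset `U` of `Y` (values outside `U` play no role):
around every point of `U` it is a quotient of two homogeneous polynomials of the same degree
whose denominator vanishes nowhere. -/
def IsRegularOn {ι : Type} {Y : Set (Space ι)} (f : Y → ℂ) (U : Set Y) : Prop :=
  ∀ p ∈ U, ∃ V : Set Y, IsOpen[zariskiOn Y] V ∧ p ∈ V ∧ V ⊆ U ∧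
    ∃ (d : ℕ) (F G : MvPolynomial ι ℂ), F.IsHomogeneous d ∧ G.IsHomogeneous d ∧
      ∀ q ∈ V, MvPolynomial.eval q.1.rep G ≠ 0 ∧
        f q = MvPolynomial.eval q.1.rep F / MvPolynomial.eval q.1.rep G

/-- A morphism of varieties: a continuous map that pulls back regular functions on open sets to
regular functions. -/
def IsMorphism {ι κ : Type} {Y : Set (Space ι)} {Z : Set (Space κ)} (φ : Y → Z) : Prop :=
  Continuous[zariskiOn Y, zariskiOn Z] φ ∧
    ∀ U : Set Z, IsOpen[zariskiOn Z] U → ∀ f : Z → ℂ, IsRegularOn f U →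
      IsRegularOn (f ∘ φ) (φ ⁻¹' U)

/-- `Y` and `Z` are isomorphic as varieties: there are mutually inverse morphisms. -/
def Isomorphic {ι κ : Type} (Y : Set (Space ι)) (Z : Set (Space κ)) : Prop :=
  ∃ φ : Y ≃ Z, IsMorphism φ ∧ IsMorphism φ.symm

end ProjectiveVariety

/-! ### Grassmannians, Schubert varieties, Richardson varieties -/

namespace Grass

open scoped LinearAlgebra.Projectivization

/-- The Grassmannian of `m`-dimensional subspaces of `ℂⁿ`, as a set. (`Module.Grassmannian` uses the
other convention: there the quotient has the prescribed rank.) -/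
def Gr (m n : ℕ) : Set (Submodule ℂ (Fin n → ℂ)) :=
  {W | Module.finrank ℂ W = m}

/-- The coordinate subspace spanned by the standard basis vectors `e_j` with `j ∈ S`. -/
def coordSpan {n : ℕ} (S : Set (Fin n)) : Submodule ℂ (Fin n → ℂ) :=
  Submodule.span ℂ ((fun j : Fin n => (Pi.single j 1 : Fin n → ℂ)) '' S)

/-- The Schubert variety `X_ν` in `Gr(m, m + k)`: the subspaces `W` with
`dim (W ∩ ⟨e_1, …, e_{ν_i + m - i + 1}⟩) ≥ m - i + 1` for `i = 1, …, m`. In the code `i` and the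
indices of the basis vectors start at `0`. -/
def schubert (m k : ℕ) (ν : YoungDiagram) : Set (Submodule ℂ (Fin (m + k) → ℂ)) :=
  {W | W ∈ Gr m (m + k) ∧ ∀ i < m,
    m - i ≤ Module.finrank ℂ
      (W ⊓ coordSpan {j : Fin (m + k) | (j : ℕ) < ν.rowLen i + (m - i)} : Submodule ℂ _)}

/-- The opposite Schubert variety `X^ν` in `Gr(m, m + k)`: the subspaces `W` with
`dim (W ∩ ⟨e_n, e_{n-1}, …, e_{ν_i + m - i + 1}⟩) ≥ i` for `i = 1, …, m`, where `n = m + k`.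
In the code `i` and the indices of the basis vectors start at `0`. -/
def oppSchubert (m k : ℕ) (ν : YoungDiagram) : Set (Submodule ℂ (Fin (m + k) → ℂ)) :=
  {W | W ∈ Gr m (m + k) ∧ ∀ i < m,
    i + 1 ≤ Module.finrank ℂ
      (W ⊓ coordSpan {j : Fin (m + k) | ν.rowLen i + (m - i) ≤ (j : ℕ) + 1} : Submodule ℂ _)}

/-- The Richardson variety `X_θ = X_ν ∩ X^lam` of a skew diagram `θ = ν / lam`, as a set of
subspaces. -/
def richardson {m k : ℕ} (θ : SkewDiagram m k) : Set (Submodule ℂ (Fin (m + k) → ℂ)) :=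
  schubert m k θ.outer ∩ oppSchubert m k θ.inner

/-- The Plücker coordinates of `m` vectors in `ℂⁿ`: the maximal minors of the `m × n` matrix with
these rows, indexed by the increasing sequences of `m` columns. -/
def pluckerVec {m n : ℕ} (v : Fin m → Fin n → ℂ) : (Fin m ↪o Fin n) → ℂ :=
  fun J => (Matrix.of fun i j : Fin m => v i (J j)).det

theorem pluckerVec_ne_zero {m n : ℕ} {v : Fin m → Fin n → ℂ} (hv : LinearIndependent ℂ v) :
    pluckerVec v ≠ 0 := by
  classical
  intro h0
  have hrank : (Matrix.of v).rank = m := by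
    have : LinearIndependent ℂ (Matrix.of v).row := hv
    simpa using this.rank_matrix
  obtain ⟨κ, a, ha, hspan, hli⟩ := exists_linearIndependent' ℂ (Matrix.of v).col
  have : Finite κ := Finite.of_injective a ha
  have : Fintype κ := Fintype.ofFinite κ
  have hcard : Fintype.card κ = m := by
    rw [← finrank_span_eq_card hli, hspan, ← Matrix.rank_eq_finrank_span_cols, hrank]
  let s : Finset (Fin n) := Finset.univ.image a
  have hs : s.card = m := by
    rw [Finset.card_image_of_injective _ ha, Finset.card_univ, hcard]
  let J : Fin m ↪o Fin n := s.orderEmbOfFin hs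
  have hJ : ∀ j, ∃ x, a x = J j := by
    intro j
    have : J j ∈ s := Finset.orderEmbOfFin_mem s hs j
    simpa [s] using this
  choose g hg using hJ
  have hginj : Function.Injective g := by
    intro x y hxy
    apply J.injective
    rw [← hg, ← hg, hxy]
  have hli2 := hli.comp g hginj
  have hcols : LinearIndependent ℂ (Matrix.of fun i j : Fin m => v i (J j)).col := by
    have he : (Matrix.of fun i j : Fin m => v i (J j)).col = ((Matrix.of v).col ∘ a) ∘ g := by
      funext j i
      change v i (J j) = v i (a (g j))
      rw [hg]
    rw [he]
    exact hli2
  have hunit := Matrix.linearIndependent_cols_iff_isUnit.1 hcols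
  rw [Matrix.isUnit_iff_isUnit_det] at hunit
  exact hunit.ne_zero (congrFun h0 J)

/-- The vectors of a basis of a subspace are linearly independent in the ambient space. -/
theorem linearIndependent_coe_basis {m n : ℕ} {W : Submodule ℂ (Fin n → ℂ)}
    (b : Module.Basis (Fin m) ℂ W) : LinearIndependent ℂ (fun i => (b i : Fin n → ℂ)) :=
  b.linearIndependent.map' W.subtype W.ker_subtype

/-- The point of projective space given by the Plücker coordinates of a basis of `W`. It depends
only on `W`, since a change of basis multiplies all maximal minors by one nonzero scalar. -/
noncomputable def pluckerPoint {m n : ℕ} {W : Submodule ℂ (Fin n → ℂ)} (b : Module.Basis (Fin m) ℂ W) :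
    ProjectiveVariety.Space (Fin m ↪o Fin n) :=
  Projectivization.mk ℂ (pluckerVec fun i => (b i : Fin n → ℂ))
    (pluckerVec_ne_zero (linearIndependent_coe_basis b))

/-- The image under the Plücker embedding of a set of `m`-dimensional subspaces of `ℂⁿ`. Subsets of
the Grassmannian are regarded as varieties through this embedding. -/
def pluckerImage (m : ℕ) {n : ℕ} (S : Set (Submodule ℂ (Fin n → ℂ))) :
    Set (ProjectiveVariety.Space (Fin m ↪o Fin n)) :=
  {p | ∃ W ∈ S, ∃ b : Module.Basis (Fin m) ℂ W, p = pluckerPoint b}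

/-- The Richardson variety `X_θ`, embedded in projective space by Plücker coordinates. -/
def richardsonVariety {m k : ℕ} (θ : SkewDiagram m k) :
    Set (ProjectiveVariety.Space (Fin m ↪o Fin (m + k))) :=
  pluckerImage m (richardson θ)

end Grass

/-! ### Cones and linear isomorphisms of coordinates -/

/-! In Plücker coordinates a Richardson variety is cut out of the Grassmannian by the vanishing of
coordinates. Record the boundary paths of `inner` and `outer` by their sets of vertical steps `L`
and `V`, and let `rk J t` count the elements of `J` below `t`. A subspace lies in the variety iff
each of its nonvanishing maximal minors has a column set `J` with `rk V ≤ rk J ≤ rk L`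
(`span_mem_richardson_iff`). So the variety is the projectivization of `cone L V`, which does not
mention the ambient Grassmannian. A bijection of the index sets that matches two such cones is a
relabelling of homogeneous coordinates, hence an isomorphism (`isomorphic_of_coneEquiv`).

At a position where `rk L = rk V`, a cut, all admissible `J` have the same rank. After normalizing
at one nonvanishing minor, an entry joining columns on different sides of a cut would produce a
nonvanishing minor outside the admissible range. Hence the matrix is block diagonal, and the cone is
the Segre product of the cones of its blocks (`coneEquiv_blocks`). The diagonal of boxes at position
`t` has `rk L t - rk V t` boxes, so cuts are empty diagonals and blocks correspond to connected
components (`componentEquiv`).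

A component is a connected convex set of boxes in the plane, and such sets are rigid: an order
isomorphism is a translation, possibly composed with the transposition (`exists_affine`). For
opposite components a point reflection is added. On the step sets of a block these four maps are the
identity, complement followed by reversal, reversal alone and complement alone. Reversal is
reversing the basis, and complement is the duality between subspaces and their annihilators; both
carry cones of minors to cones of minors (`coneEquiv_reflect`, `coneEquiv_complement`). Matching the
components one by one and taking products gives the theorem. -/

/-- Two sets of functions correspond to each other under a bijection of their index types. -/
def ConeEquiv {T T' : Type*} (C : Set (T → ℂ)) (C' : Set (T' → ℂ)) : Prop :=
  ∃ e : T ≃ T', ∀ q, q ∈ C' ↔ q ∘ e ∈ C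

namespace ConeEquiv

variable {T T' T'' : Type*} {C : Set (T → ℂ)} {C' : Set (T' → ℂ)} {C'' : Set (T'' → ℂ)}

theorem refl (C : Set (T → ℂ)) : ConeEquiv C C := ⟨Equiv.refl T, fun _ => Iff.rfl⟩

theorem symm (h : ConeEquiv C C') : ConeEquiv C' C := by
  obtain ⟨e, he⟩ := h
  refine ⟨e.symm, fun q => ?_⟩
  rw [he]
  simp [Function.comp_assoc]

theorem trans (h : ConeEquiv C C') (h' : ConeEquiv C' C'') : ConeEquiv C C'' := by
  obtain ⟨e, he⟩ := h
  obtain ⟨e', he'⟩ := h'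
  refine ⟨e.trans e', fun q => ?_⟩
  rw [he', he]
  rfl

/-- It suffices to check one inclusion for a bijection and one for its inverse. -/
theorem of_maps (e : T ≃ T') (h : ∀ q ∈ C, q ∘ e.symm ∈ C') (h' : ∀ q ∈ C', q ∘ e ∈ C) :
    ConeEquiv C C' := by
  refine ⟨e, fun q => ⟨h' q, fun hq => ?_⟩⟩
  have := h _ hq
  simpa [Function.comp_assoc] using this

end ConeEquiv

/-! ### Isomorphisms given by relabelling homogeneous coordinates -/

namespace ProjectiveVariety

open scoped LinearAlgebra.Projectivization Topology

variable {ι κ : Type} {Y : Set (Space ι)} {Z : Set (Space κ)}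

/-- Homogeneity pulls the scalar out as `a ^ d`. It cancels in a quotient of two forms of equal
degree, so the choice of representatives is harmless. -/
theorem eval_smul_linear {F : MvPolynomial κ ℂ} {d : ℕ} (hF : F.IsHomogeneous d)
    (l : κ → MvPolynomial ι ℂ) (a : ℂ) (v : ι → ℂ) (w : κ → ℂ)
    (hw : w = a • fun k => MvPolynomial.eval v (l k)) :
    MvPolynomial.eval w F = a ^ d * MvPolynomial.eval v (MvPolynomial.bind₁ l F) := by
  subst hw
  have h1 : MvPolynomial.eval v (MvPolynomial.bind₁ l F)
      = MvPolynomial.eval (fun k => MvPolynomial.eval v (l k)) F := by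
    rw [← MvPolynomial.coe_aeval_eq_eval, ← MvPolynomial.coe_aeval_eq_eval]
    exact MvPolynomial.aeval_bind₁ _ _ _
  rw [h1, MvPolynomial.eval_eq, MvPolynomial.eval_eq, Finset.mul_sum]
  refine Finset.sum_congr rfl fun i hi => ?_
  have hd : ∑ j ∈ i.support, i j = d := by
    have := hF (MvPolynomial.mem_support_iff.1 hi)
    rw [Finsupp.weight_apply, Finsupp.sum] at this
    simpa using this
  simp only [Pi.smul_apply, smul_eq_mul, mul_pow]
  rw [Finset.prod_mul_distrib, Finset.prod_pow_eq_pow_sum, hd]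
  ring

theorem isHomogeneous_bind₁_linear {F : MvPolynomial κ ℂ} {d : ℕ} (hF : F.IsHomogeneous d)
    (l : κ → MvPolynomial ι ℂ) (hl : ∀ k, (l k).IsHomogeneous 1) :
    (MvPolynomial.bind₁ l F).IsHomogeneous d := by
  have := hF.aeval l hl
  simpa using this

/-- A map that is given in homogeneous coordinates by linear forms is a morphism. -/
theorem isMorphism_of_linear (l : κ → MvPolynomial ι ℂ) (hl : ∀ k, (l k).IsHomogeneous 1)
    (φ : Y → Z)
    (hφ : ∀ y, ∃ a : ℂ, a ≠ 0 ∧ (φ y).1.rep = a • fun k => MvPolynomial.eval y.1.rep (l k)) :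
    IsMorphism φ := by
  have hcont : Continuous[zariskiOn Y, zariskiOn Z] φ := by
    rw [continuous_induced_rng]
    refine continuous_generateFrom_iff.2 ?_
    rintro U ⟨d, F, hF, rfl⟩
    refine ⟨nonvanishing (MvPolynomial.bind₁ l F),
      TopologicalSpace.isOpen_generateFrom_of_mem
        ⟨d, _, isHomogeneous_bind₁_linear hF l hl, rfl⟩, ?_⟩
    ext y
    obtain ⟨a, ha, hy⟩ := hφ y
    simp only [nonvanishing, Set.mem_preimage, Set.mem_ofPred_eq, Function.comp_apply]
    rw [eval_smul_linear hF l a y.1.rep _ hy]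
    simp [ha]
  refine ⟨hcont, fun U hU f hf p hp => ?_⟩
  obtain ⟨V, hV, hpV, hVU, d, F, G, hF, hG, hFG⟩ := hf (φ p) hp
  refine ⟨φ ⁻¹' V, @IsOpen.preimage _ _ (zariskiOn Y) (zariskiOn Z) _ hcont _ hV, hpV, Set.preimage_mono hVU, d,
    MvPolynomial.bind₁ l F, MvPolynomial.bind₁ l G, isHomogeneous_bind₁_linear hF l hl,
    isHomogeneous_bind₁_linear hG l hl, fun q hq => ?_⟩
  obtain ⟨h1, h2⟩ := hFG (φ q) hq
  obtain ⟨a, ha, hy⟩ := hφ q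
  rw [eval_smul_linear hG l a q.1.rep _ hy] at h1 h2
  rw [eval_smul_linear hF l a q.1.rep _ hy] at h2
  refine ⟨right_ne_zero_of_mul h1, ?_⟩
  rw [Function.comp_apply, h2, mul_div_mul_left _ _ (pow_ne_zero d ha)]

/-- `Y` consists of the points whose homogeneous coordinates vanish outside the range of `τ` and
have their other coordinates in `C`. -/
def IsCoordCone {T : Type*} (Y : Set (Space ι)) (τ : T → ι) (C : Set (T → ℂ)) : Prop :=
  Function.Injective τ ∧ (∀ q ∈ C, ∀ a : ℂ, a ≠ 0 → a • q ∈ C) ∧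
    ∀ p : Space ι, p ∈ Y ↔ (∀ i, i ∉ Set.range τ → p.rep i = 0) ∧ p.rep ∘ τ ∈ C

open Classical in
/-- The linear forms that transport the coordinates along `T' → T`. -/
noncomputable def coordForm {T T' : Type*} (τ : T → ι) (τ' : T' → κ) (e : T' → T) (k : κ) :
    MvPolynomial ι ℂ :=
  if h : ∃ t, τ' t = k then MvPolynomial.X (τ (e h.choose)) else 0

theorem coordForm_homogeneous {T T' : Type*} (τ : T → ι) (τ' : T' → κ) (e : T' → T) (k : κ) :
    (coordForm τ τ' e k).IsHomogeneous 1 := by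
  unfold coordForm
  split_ifs
  · exact MvPolynomial.isHomogeneous_X _ _
  · exact MvPolynomial.isHomogeneous_zero _ _ _

theorem eval_coordForm {T T' : Type*} (τ : T → ι) {τ' : T' → κ} (hτ' : Function.Injective τ')
    (e : T' → T) (v : ι → ℂ) (t : T') :
    MvPolynomial.eval v (coordForm τ τ' e (τ' t)) = v (τ (e t)) := by
  have h : ∃ t', τ' t' = τ' t := ⟨t, rfl⟩
  rw [coordForm, dif_pos h, MvPolynomial.eval_X, hτ' h.choose_spec]

theorem eval_coordForm_of_notMem {T T' : Type*} (τ : T → ι) {τ' : T' → κ}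
    (e : T' → T) (v : ι → ℂ) {k : κ} (hk : k ∉ Set.range τ') :
    MvPolynomial.eval v (coordForm τ τ' e k) = 0 := by
  have hk' : ¬ ∃ t, τ' t = k := hk
  rw [coordForm, dif_neg hk', map_zero]

/-- A point of `Y` has all its nonzero coordinates on the range of `τ`, so the transported
coordinates cannot all vanish and define a point; invariance of the cone under scaling puts that
point in `Z`. -/
theorem exists_coord_map {T T' : Type*} {τ : T → ι} {C : Set (T → ℂ)} {τ' : T' → κ}
    {C' : Set (T' → ℂ)} (hY : IsCoordCone Y τ C) (hZ : IsCoordCone Z τ' C') (e : T' ≃ T)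
    (he : ∀ q ∈ C, q ∘ e ∈ C') :
    ∃ φ : Y → Z, ∀ y, ∃ a : ℂ, a ≠ 0 ∧
      (φ y).1.rep = a • fun k => MvPolynomial.eval y.1.rep (coordForm τ τ' e k) := by
  have key : ∀ y : Y, ∃ z : Z, ∃ a : ℂ, a ≠ 0 ∧
      z.1.rep = a • fun k => MvPolynomial.eval y.1.rep (coordForm τ τ' e k) := by
    intro y
    obtain ⟨hy0, hyC⟩ := (hY.2.2 y.1).1 y.2
    set w : κ → ℂ := fun k => MvPolynomial.eval y.1.rep (coordForm τ τ' e k) with hw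
    have hwt : w ∘ τ' = (y.1.rep ∘ τ) ∘ e := by
      funext t
      exact eval_coordForm τ hZ.1 e _ t
    have hne : w ≠ 0 := by
      intro h
      apply y.1.rep_nonzero
      funext i
      by_cases hi : i ∈ Set.range τ
      · obtain ⟨t, rfl⟩ := hi
        have := congrFun hwt (e.symm t)
        simp [h] at this
        exact this.symm
      · exact hy0 i hi
    obtain ⟨a, ha⟩ := Projectivization.exists_smul_eq_mk_rep ℂ w hne
    have ha' : (Projectivization.mk ℂ w hne).rep = (a : ℂ) • w := ha.symm
    refine ⟨⟨Projectivization.mk ℂ w hne, (hZ.2.2 _).2 ⟨fun k hk => ?_, ?_⟩⟩, a, a.ne_zero, ha'⟩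
    · rw [ha', Pi.smul_apply, hw]
      simp only
      rw [eval_coordForm_of_notMem τ e _ hk, smul_zero]
    · have : (Projectivization.mk ℂ w hne).rep ∘ τ' = (a : ℂ) • ((y.1.rep ∘ τ) ∘ e) := by
        rw [ha', ← hwt]
        rfl
      rw [this]
      exact hZ.2.1 _ (he _ hyC) _ a.ne_zero
  choose φ hφ using key
  exact ⟨φ, hφ⟩

theorem coord_map_leftInverse {T T' : Type*} {τ : T → ι} {C : Set (T → ℂ)} {τ' : T' → κ}
    {C' : Set (T' → ℂ)} (hY : IsCoordCone Y τ C) (hZ : IsCoordCone Z τ' C') (e : T' ≃ T)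
    {φ : Y → Z} {ψ : Z → Y}
    (hφ : ∀ y, ∃ a : ℂ, a ≠ 0 ∧
      (φ y).1.rep = a • fun k => MvPolynomial.eval y.1.rep (coordForm τ τ' e k))
    (hψ : ∀ z, ∃ a : ℂ, a ≠ 0 ∧
      (ψ z).1.rep = a • fun k => MvPolynomial.eval z.1.rep (coordForm τ' τ e.symm k)) :
    Function.LeftInverse ψ φ := by
  intro y
  obtain ⟨a, ha, hy⟩ := hφ y
  obtain ⟨b, hb, hz⟩ := hψ (φ y)
  have hy0 := ((hY.2.2 y.1).1 y.2).1
  have hmul : (ψ (φ y)).1.rep = (b * a) • y.1.rep := by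
    rw [hz]
    funext i
    simp only [Pi.smul_apply, smul_eq_mul]
    by_cases hi : i ∈ Set.range τ
    · obtain ⟨t, rfl⟩ := hi
      rw [eval_coordForm τ' hY.1 e.symm _ t, hy, Pi.smul_apply, smul_eq_mul,
        eval_coordForm τ hZ.1 e, e.apply_symm_apply]
      ring
    · rw [eval_coordForm_of_notMem τ' e.symm _ hi, hy0 i hi]
      simp
  apply Subtype.ext
  rw [← Projectivization.mk_rep (ψ (φ y)).1, ← Projectivization.mk_rep y.1,
    Projectivization.mk_eq_mk_iff']
  exact ⟨b * a, hmul.symm⟩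

/-- Subsets of projective spaces with equivalent coordinate cones are isomorphic. -/
theorem isomorphic_of_coneEquiv {T T' : Type*} {τ : T → ι} {C : Set (T → ℂ)} {τ' : T' → κ}
    {C' : Set (T' → ℂ)} (hY : IsCoordCone Y τ C) (hZ : IsCoordCone Z τ' C')
    (h : ConeEquiv C C') : Isomorphic Y Z := by
  obtain ⟨e, he⟩ := h
  obtain ⟨φ, hφ⟩ := exists_coord_map hY hZ e.symm fun q hq => by
    rw [he]
    simpa [Function.comp_assoc] using hq
  obtain ⟨ψ, hψ⟩ := exists_coord_map hZ hY e fun q hq => (he q).1 hq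
  refine ⟨⟨φ, ψ, coord_map_leftInverse hY hZ e.symm hφ hψ,
    coord_map_leftInverse hZ hY e hψ hφ⟩, ?_, ?_⟩
  · exact isMorphism_of_linear _ (coordForm_homogeneous _ _ _) _ hφ
  · exact isMorphism_of_linear _ (coordForm_homogeneous _ _ _) _ hψ

end ProjectiveVariety

/-! ### Finite sets of natural numbers: enumeration and rank function -/

namespace PosSet

/-- The number of elements of `J` below `t`. -/
def rk (J : Finset ℕ) (t : ℕ) : ℕ := Nat.count (· ∈ J) t

/-- The elements of `J` in increasing order. -/
noncomputable def nth (J : Finset ℕ) (x : ℕ) : ℕ := Nat.nth (· ∈ J) x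

variable {J K : Finset ℕ}

theorem finite_mem (J : Finset ℕ) : (Set.ofPred (· ∈ J)).Finite := J.finite_toSet

theorem card_finite_mem (hf : (Set.ofPred (· ∈ J)).Finite) : hf.toFinset.card = J.card := by
  congr 1
  ext x
  simp

theorem rk_eq_card (J : Finset ℕ) (t : ℕ) : rk J t = (J.filter (· < t)).card := by
  rw [rk, Nat.count_eq_card_filter_range]
  congr 1
  ext x
  simp [and_comm]

theorem rk_zero (J : Finset ℕ) : rk J 0 = 0 := Nat.count_zero _

theorem rk_succ (J : Finset ℕ) (t : ℕ) : rk J (t + 1) = rk J t + if t ∈ J then 1 else 0 :=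
  Nat.count_succ _ _

theorem rk_mono (J : Finset ℕ) : Monotone (rk J) := Nat.count_monotone _

theorem rk_le_card (J : Finset ℕ) (t : ℕ) : rk J t ≤ J.card := by
  rw [rk_eq_card]
  exact Finset.card_filter_le _ _

theorem rk_of_subset {t : ℕ} (h : ∀ x ∈ J, x < t) : rk J t = J.card := by
  rw [rk_eq_card, Finset.filter_true_of_mem h]

theorem mem_iff_rk {t : ℕ} : t ∈ J ↔ rk J (t + 1) = rk J t + 1 := by
  rw [rk_succ]
  split_ifs with h <;> simp [h]

theorem rk_step (J : Finset ℕ) (t : ℕ) : rk J (t + 1) = rk J t ∨ rk J (t + 1) = rk J t + 1 := by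
  rw [rk_succ]
  split_ifs <;> simp

theorem ext_rk (h : ∀ t, rk J t = rk K t) : J = K := by
  ext t
  rw [mem_iff_rk, mem_iff_rk, h, h]

theorem nth_mem {x : ℕ} (hx : x < J.card) : nth J x ∈ J :=
  Nat.nth_mem_of_lt_card (p := (· ∈ J)) (finite_mem J) (by rwa [card_finite_mem])

theorem rk_nth {x : ℕ} (hx : x < J.card) : rk J (nth J x) = x :=
  Nat.count_nth_of_lt_card_finite (p := (· ∈ J)) (finite_mem J) (by rwa [card_finite_mem])

theorem nth_rk {e : ℕ} (he : e ∈ J) : nth J (rk J e) = e :=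
  Nat.nth_count (p := (· ∈ J)) he

theorem rk_lt_card {e : ℕ} (he : e ∈ J) : rk J e < J.card := by
  have := Nat.count_lt_card (p := (· ∈ J)) (finite_mem J) he
  rwa [card_finite_mem] at this

theorem nth_lt_nth {x y : ℕ} (h : x < y) (hy : y < J.card) : nth J x < nth J y :=
  Nat.nth_lt_nth_of_lt_card (p := (· ∈ J)) (finite_mem J) h (by rwa [card_finite_mem])

/-- Enumeration and rank function form a Galois connection; it converts statements about the ordered
elements into inequalities of ranks. -/
theorem nth_lt_iff {x s : ℕ} (hx : x < J.card) : nth J x < s ↔ x < rk J s := by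
  constructor
  · intro h
    have := rk_mono J (Nat.succ_le_of_lt h)
    rw [Nat.succ_eq_add_one, mem_iff_rk.1 (nth_mem hx), rk_nth hx] at this
    omega
  · exact fun h => Nat.nth_lt_of_lt_count h

theorem le_nth_iff {x s : ℕ} (hx : x < J.card) : s ≤ nth J x ↔ rk J s ≤ x := by
  rw [← not_lt, nth_lt_iff hx, not_lt]

theorem nth_inj {x y : ℕ} (hx : x < J.card) (hy : y < J.card) : nth J x = nth J y ↔ x = y := by
  constructor
  · intro h
    rw [← rk_nth hx, ← rk_nth hy, h]
  · rintro rfl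
    rfl

theorem exists_nth {e : ℕ} (he : e ∈ J) : ∃ x < J.card, nth J x = e :=
  ⟨rk J e, rk_lt_card he, nth_rk he⟩

theorem nth_unique {r : ℕ} (h : J.card = r) {f : Fin r → ℕ} (hf : ∀ x, f x ∈ J)
    (hmono : StrictMono f) (x : Fin r) : f x = nth J x := by
  have h1 := Finset.orderEmbOfFin_unique h hf hmono
  have h2 : (fun x : Fin r => nth J x) = J.orderEmbOfFin h :=
    Finset.orderEmbOfFin_unique h (fun x => nth_mem (h.symm ▸ x.2))
      fun x y hxy => nth_lt_nth hxy (h.symm ▸ y.2)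
  rw [h1, ← h2]

/-- Elements whose label is `s` are ranked by the number of elements with a smaller label and
their rank among the elements with label `s`. -/
theorem rk_label {b : ℕ → ℕ} (hb : Monotone b) (J : Finset ℕ) (e : ℕ) :
    rk J e = (J.filter (b · < b e)).card + rk (J.filter (b · = b e)) e := by
  rw [rk_eq_card, rk_eq_card, ← Finset.card_union_of_disjoint]
  · congr 1
    ext x
    simp only [Finset.mem_filter, Finset.mem_union]
    constructor
    · rintro ⟨h1, h2⟩
      rcases (hb h2.le).lt_or_eq with h | h
      · exact Or.inl ⟨h1, h⟩
      · exact Or.inr ⟨⟨h1, h⟩, h2⟩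
    · rintro (⟨h1, h2⟩ | ⟨⟨h1, -⟩, h2⟩)
      · exact ⟨h1, hb.reflect_lt h2⟩
      · exact ⟨h1, h2⟩
  · rw [Finset.disjoint_left]
    intro x hx hx'
    simp only [Finset.mem_filter] at hx hx'
    omega

/-- For a monotone label, the elements with one label occupy consecutive places in the enumeration,
right after all elements with smaller labels. -/
theorem nth_label {b : ℕ → ℕ} (hb : Monotone b) {s y : ℕ}
    (hy : y < (J.filter (b · = s)).card) :
    (J.filter (b · < s)).card + y < J.card ∧
      nth J ((J.filter (b · < s)).card + y) = nth (J.filter (b · = s)) y := by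
  have hmem := nth_mem hy
  rw [Finset.mem_filter] at hmem
  have h := rk_label hb J (nth (J.filter (b · = s)) y)
  rw [hmem.2, rk_nth hy] at h
  rw [← h]
  exact ⟨rk_lt_card hmem.1, nth_rk hmem.1⟩

/-! ### Minors -/

/-- The determinant of the columns `σ` of the first rows of `A`. -/
noncomputable def tupleMinor (A : ℕ → ℕ → ℂ) {r : ℕ} (σ : Fin r → ℕ) : ℂ :=
  (Matrix.of fun i j : Fin r => A i (σ j)).det

/-- The maximal minor of the first rows of `A` with columns in `J`. -/
noncomputable def minor (A : ℕ → ℕ → ℂ) (J : Finset ℕ) : ℂ :=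
  tupleMinor A fun x : Fin J.card => nth J x

theorem minor_eq (A : ℕ → ℕ → ℂ) {r : ℕ} (h : J.card = r) :
    minor A J = (Matrix.of fun i j : Fin r => A i (nth J j)).det := by
  subst h
  rfl

theorem minor_congr {A B : ℕ → ℕ → ℂ} (h : ∀ x < J.card, ∀ e ∈ J, A x e = B x e) :
    minor A J = minor B J := by
  rw [minor_eq A rfl, minor_eq B rfl]
  congr 1
  ext i j
  exact h i i.2 _ (nth_mem j.2)

theorem minor_eq_zero_of_col {A : ℕ → ℕ → ℂ} {e : ℕ} (he : e ∈ J)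
    (h : ∀ x < J.card, A x e = 0) : minor A J = 0 := by
  rw [minor_eq A rfl]
  refine Matrix.det_eq_zero_of_column_eq_zero ⟨rk J e, rk_lt_card he⟩ fun i => ?_
  simp [nth_rk he, h]

/-- Reordering the columns changes a minor by a sign. -/
theorem tupleMinor_ne_zero_iff (A : ℕ → ℕ → ℂ) {r : ℕ} {σ : Fin r → ℕ}
    (hσ : Function.Injective σ) (hJ : Finset.univ.image σ = J) :
    tupleMinor A σ ≠ 0 ↔ minor A J ≠ 0 := by
  have hr : J.card = r := by
    rw [← hJ, Finset.card_image_of_injective _ hσ, Finset.card_univ, Fintype.card_fin]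
  have hmem : ∀ x, σ x ∈ J := fun x => hJ ▸ Finset.mem_image_of_mem _ (Finset.mem_univ x)
  let π : Fin r → Fin r := fun x => ⟨rk J (σ x), hr ▸ rk_lt_card (hmem x)⟩
  have hπ : Function.Injective π := by
    intro x y hxy
    apply hσ
    rw [← nth_rk (hmem x), ← nth_rk (hmem y), Fin.mk.inj_iff.1 hxy]
  let p : Equiv.Perm (Fin r) := Equiv.ofBijective π (Finite.injective_iff_bijective.1 hπ)
  have : (Matrix.of fun i j : Fin r => A i (σ j))
      = (Matrix.of fun i j : Fin r => A i (nth J j)).submatrix id p := by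
    ext i j
    change A i (σ j) = A i (nth J (rk J (σ j)))
    rw [nth_rk (hmem j)]
  rw [tupleMinor, minor_eq A hr, this, Matrix.det_permute']
  rcases Int.units_eq_one_or (Equiv.Perm.sign p) with h | h <;> simp [h]

/-- `A` restricts to the identity matrix on the columns in `J`. -/
def IsNormalized (A : ℕ → ℕ → ℂ) (J : Finset ℕ) : Prop :=
  ∀ x < J.card, ∀ y < J.card, A x (nth J y) = if x = y then 1 else 0

theorem IsNormalized.minor_eq_one {A : ℕ → ℕ → ℂ} (h : IsNormalized A J) : minor A J = 1 := by
  rw [minor_eq A rfl, ← Matrix.det_one (n := Fin J.card)]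
  congr 1
  ext i j
  simp [h i i.2 j j.2, Matrix.one_apply, Fin.ext_iff]

theorem card_exchange {x e : ℕ} (hx : x < J.card) (he : e ∉ J) :
    (insert e (J.erase (nth J x))).card = J.card := by
  rw [Finset.card_insert_of_notMem (fun h => he (Finset.mem_of_mem_erase h)),
    Finset.card_erase_of_mem (nth_mem hx)]
  omega

/-- Replacing column `x` of the identity matrix by column `e` of `A` gives the determinant `A x e`.
Thus single entries of a normalized matrix are detected by minors of exchanged sets. -/
theorem IsNormalized.minor_exchange_ne_zero {A : ℕ → ℕ → ℂ} (h : IsNormalized A J) {x e : ℕ}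
    (hx : x < J.card) (he : e ∉ J) (hA : A x e ≠ 0) :
    minor A (insert e (J.erase (nth J x))) ≠ 0 := by
  let x' : Fin J.card := ⟨x, hx⟩
  let σ : Fin J.card → ℕ := Function.update (fun y => nth J y) x' e
  have hσ : Function.Injective σ := by
    intro y z hyz
    by_cases hy : y = x' <;> by_cases hz : z = x'
    · rw [hy, hz]
    · simp only [σ, hy, Function.update_self, Function.update_of_ne hz] at hyz
      exact absurd (hyz ▸ nth_mem z.2) he
    · simp only [σ, hz, Function.update_self, Function.update_of_ne hy] at hyz
      exact absurd (hyz ▸ nth_mem y.2) he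
    · simp only [σ, Function.update_of_ne hz, Function.update_of_ne hy] at hyz
      exact Fin.ext ((nth_inj y.2 z.2).1 hyz)
  have himg : Finset.univ.image σ = insert e (J.erase (nth J x)) := by
    apply Finset.eq_of_subset_of_card_le
    · intro z hz
      obtain ⟨y, -, rfl⟩ := Finset.mem_image.1 hz
      by_cases hy : y = x'
      · simp [σ, hy]
      · simp only [σ, Function.update_of_ne hy, Finset.mem_insert, Finset.mem_erase]
        refine Or.inr ⟨fun h => hy (Fin.ext ((nth_inj y.2 hx).1 h)), nth_mem y.2⟩
    · rw [card_exchange hx he, Finset.card_image_of_injective _ hσ, Finset.card_univ,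
        Fintype.card_fin]
  rw [← tupleMinor_ne_zero_iff A hσ himg, tupleMinor]
  have : (Matrix.of fun i j : Fin J.card => A i (σ j))
      = (1 : Matrix (Fin J.card) (Fin J.card) ℂ).updateCol x' (fun i => A i e) := by
    ext i j
    by_cases hj : j = x'
    · subst hj
      simp [σ]
    · simp [σ, Function.update_of_ne hj, Matrix.updateCol_ne hj, h i i.2 j j.2,
        Matrix.one_apply, Fin.ext_iff]
  rw [this, ← Matrix.cramer_apply, Matrix.cramer_one]
  exact hA

/-- A nonvanishing minor can be normalized by row operations. -/
theorem exists_normalized {A : ℕ → ℕ → ℂ} {r : ℕ} (hr : J.card = r) (hJ : minor A J ≠ 0) :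
    ∃ (M : Matrix (Fin r) (Fin r) ℂ) (A' : ℕ → ℕ → ℂ),
      (∀ (x : Fin r) (e : ℕ), A' x e = ∑ y : Fin r, M x y * A y e) ∧ IsNormalized A' J ∧
      ∀ K : Finset ℕ, K.card = r → minor A K = minor A J * minor A' K := by
  subst hr
  let B : Matrix (Fin J.card) (Fin J.card) ℂ := Matrix.of fun i j => A i (nth J j)
  have hB : IsUnit B.det := isUnit_iff_ne_zero.2 hJ
  let A' : ℕ → ℕ → ℂ := fun x e =>
    if hx : x < J.card then ∑ y : Fin J.card, B⁻¹ ⟨x, hx⟩ y * A y e else 0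
  have hA' : ∀ (x : Fin J.card) (e : ℕ), A' x e = ∑ y : Fin J.card, B⁻¹ x y * A y e := by
    intro x e
    simp [A']
  refine ⟨B⁻¹, A', hA', ?_, ?_⟩
  · intro x hx y hy
    have := hA' ⟨x, hx⟩ (nth J y)
    have h1 : (B⁻¹ * B) ⟨x, hx⟩ ⟨y, hy⟩ = ∑ z : Fin J.card, B⁻¹ ⟨x, hx⟩ z * A z (nth J y) := rfl
    rw [Matrix.nonsing_inv_mul _ hB] at h1
    rw [this, ← h1, Matrix.one_apply]
    simp
  · intro K hK
    rw [minor_eq A hK, minor_eq A' hK]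
    change _ = B.det * _
    rw [← Matrix.det_mul]
    congr 1
    have : (Matrix.of fun i j : Fin J.card => A' i (nth K j))
        = B⁻¹ * Matrix.of fun i j : Fin J.card => A i (nth K j) := by
      ext i j
      exact hA' i _
    rw [this, Matrix.mul_nonsing_inv_cancel_left _ _ hB]

/-! ### Block matrices -/

/-- If rows and columns are labelled in increasing order and the entries with different labels
vanish, then the labels agree or the determinant is zero. -/
theorem label_eq_of_det_ne_zero {r : ℕ} {M : Matrix (Fin r) (Fin r) ℂ} {f g : Fin r → ℕ}
    (hf : Monotone f) (hg : Monotone g) (hM : ∀ x y, f x ≠ g y → M x y = 0) (hdet : M.det ≠ 0) :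
    f = g := by
  have : ∃ p : Equiv.Perm (Fin r), ∀ y, f (p y) = g y := by
    by_contra! h
    apply hdet
    rw [Matrix.det_apply]
    refine Finset.sum_eq_zero fun p _ => ?_
    obtain ⟨y, hy⟩ := h p
    rw [Finset.prod_eq_zero (f := fun i => M (p i) i) (Finset.mem_univ y) (hM _ _ hy), smul_zero]
  obtain ⟨p, hp⟩ := this
  have hpg : f ∘ p = g := funext hp
  -- A nonzero determinant has a nonzero term, which gives `p` with `f ∘ p = g`. Monotone
  -- rearrangements of one sequence coincide.
  have h1 : Monotone (f ∘ (1 : Equiv.Perm (Fin r))) := by simpa using hf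
  have h2 : Monotone (f ∘ p) := by rwa [hpg]
  have := Tuple.unique_monotone h1 h2
  rw [← hpg, ← this]
  simp

/-- A minor of a block matrix is the product of the minors of its blocks. -/
theorem minor_label {A : ℕ → ℕ → ℂ} {b : ℕ → ℕ} (hb : Monotone b) {N : ℕ}
    (hN : ∀ e ∈ J, b e < N) (hA : ∀ x < J.card, ∀ e ∈ J, b (nth J x) ≠ b e → A x e = 0) :
    minor A J = ∏ s ∈ Finset.range N,
      minor (fun y e => A ((J.filter (b · < s)).card + y) e) (J.filter (b · = s)) := by
  let β : Fin J.card → ℕ := fun x => b (nth J x)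
  have htri : (Matrix.of fun i j : Fin J.card => A i (nth J j)).BlockTriangular β := by
    intro i j hij
    exact hA i i.2 _ (nth_mem j.2) (ne_of_gt hij)
  rw [minor_eq A rfl, htri.det]
  -- Labels that do not occur contribute empty determinants, equal to 1.
  refine Finset.prod_subset_one_on_sdiff ?_ ?_ ?_
  · intro s hs
    obtain ⟨x, -, rfl⟩ := Finset.mem_image.1 hs
    exact Finset.mem_range.2 (hN _ (nth_mem x.2))
  · intro s hs
    have he : (J.filter (b · = s)).card = 0 := by
      rw [Finset.card_eq_zero, Finset.filter_eq_empty_iff]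
      intro e he h
      refine (Finset.mem_sdiff.1 hs).2
        (Finset.mem_image.2 ⟨⟨rk J e, rk_lt_card he⟩, Finset.mem_univ _, ?_⟩)
      simp only [β, nth_rk he, h]
    rw [minor_eq _ he, Matrix.det_isEmpty]
  · intro s _
    let E : Fin (J.filter (b · = s)).card → {x : Fin J.card // β x = s} := fun y =>
      ⟨⟨(J.filter (b · < s)).card + y, (nth_label hb y.2).1⟩, by
        change b (nth J ((J.filter (b · < s)).card + y)) = s
        rw [(nth_label hb y.2).2]
        exact (Finset.mem_filter.1 (nth_mem y.2)).2⟩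
    have hE : Function.Bijective E := by
      constructor
      · intro y z hyz
        have := congrArg (fun w => (w.1 : ℕ)) hyz
        simp only [E] at this
        exact Fin.ext (by omega)
      · rintro ⟨x, hx⟩
        have hmem : nth J x ∈ J.filter (b · = s) := Finset.mem_filter.2 ⟨nth_mem x.2, hx⟩
        refine ⟨⟨rk (J.filter (b · = s)) (nth J x), rk_lt_card hmem⟩, ?_⟩
        apply Subtype.ext
        apply Fin.ext
        have h1 := rk_label hb J (nth J x)
        have h2 : b (nth J x) = s := hx
        rw [h2, rk_nth x.2] at h1
        exact h1.symm
    rw [minor_eq _ rfl, ← Matrix.det_submatrix_equiv_self (Equiv.ofBijective E hE)]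
    congr 1
    ext y z
    change A _ (nth J _) = A _ _
    simp only [Equiv.ofBijective_apply, E]
    rw [(nth_label hb z.2).2]

end PosSet

namespace PosSet

/-! ### Cones of minors -/

/-- The rank function of `J` lies between those of `V` and `L`. -/
def Between (L V J : Finset ℕ) : Prop := ∀ t, rk V t ≤ rk J t ∧ rk J t ≤ rk L t

theorem exists_bound (J : Finset ℕ) : ∃ N, ∀ x ∈ J, x < N :=
  ⟨J.sup id + 1, fun _ hx => Nat.lt_succ_of_le (Finset.le_sup (f := id) hx)⟩

/-- Beyond all elements a rank function equals the cardinality, so there the upper and lower bounds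
meet. -/
theorem Between.card_eq {L V J : Finset ℕ} (h : Between L V J) (hc : L.card = V.card) :
    J.card = V.card := by
  obtain ⟨N, hN⟩ := exists_bound (L ∪ V ∪ J)
  have h1 := h N
  rw [rk_of_subset fun x hx => hN x (by simp [hx]), rk_of_subset fun x hx => hN x (by simp [hx]),
    rk_of_subset fun x hx => hN x (by simp [hx])] at h1
  omega

theorem Between.subset {L V J : Finset ℕ} (h : Between L V J) (hc : L.card = V.card) {t : ℕ}
    (hV : ∀ x ∈ V, x < t) : ∀ x ∈ J, x < t := by
  have h1 := (h t).1
  rw [rk_of_subset hV, ← h.card_eq hc] at h1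
  intro x hx
  have := rk_lt_card hx
  by_contra! hlt
  have := rk_mono J hlt
  omega

/-- The nonzero functions on the sets between `V` and `L` that are given by maximal minors of a
matrix whose other maximal minors vanish. -/
def cone (L V : Finset ℕ) : Set ({J : Finset ℕ // Between L V J} → ℂ) :=
  {p | p ≠ 0 ∧ ∃ (A : ℕ → ℕ → ℂ) (c : ℂ),
    (∀ J, J.card = V.card → ¬ Between L V J → minor A J = 0) ∧ ∀ J, p J = c * minor A J.1}

theorem cone_smul {L V : Finset ℕ} {p : {J : Finset ℕ // Between L V J} → ℂ} (hp : p ∈ cone L V)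
    {a : ℂ} (ha : a ≠ 0) : a • p ∈ cone L V := by
  obtain ⟨h0, A, c, hA, hc⟩ := hp
  refine ⟨smul_ne_zero ha h0, A, a * c, hA, fun J => ?_⟩
  rw [Pi.smul_apply, hc, smul_eq_mul, mul_assoc]

end PosSet

/-! ### Intersections with coordinate subspaces and nonvanishing minors -/

namespace Grass

open PosSet

variable {m n : ℕ}

/-- A matrix extended by zero. -/
def extendMatrix (v : Fin m → Fin n → ℂ) (x e : ℕ) : ℂ :=
  if h : x < m ∧ e < n then v ⟨x, h.1⟩ ⟨e, h.2⟩ else 0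

theorem extendMatrix_apply (v : Fin m → Fin n → ℂ) (x : Fin m) (e : Fin n) :
    extendMatrix v x e = v x e := by
  simp [extendMatrix]

/-- The set of values of an increasing sequence. -/
def valueSet (I : Fin m ↪o Fin n) : Finset ℕ := Finset.univ.image fun x => (I x : ℕ)

theorem card_valueSet (I : Fin m ↪o Fin n) : (valueSet I).card = m := by
  rw [valueSet, Finset.card_image_of_injective, Finset.card_univ, Fintype.card_fin]
  exact Fin.val_injective.comp I.injective

theorem lt_of_mem_valueSet {I : Fin m ↪o Fin n} {e : ℕ} (he : e ∈ valueSet I) : e < n := by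
  obtain ⟨x, -, rfl⟩ := Finset.mem_image.1 he
  exact (I x).2

theorem nth_valueSet (I : Fin m ↪o Fin n) (x : Fin m) : nth (valueSet I) x = I x :=
  (nth_unique (card_valueSet I) (f := fun x => (I x : ℕ))
    (fun x => Finset.mem_image_of_mem _ (Finset.mem_univ x)) (fun _ _ h => I.strictMono h) x).symm

/-- The increasing sequence that enumerates a set. -/
noncomputable def enum (J : Finset ℕ) (hc : J.card = m) (hn : ∀ x ∈ J, x < n) : Fin m ↪o Fin n :=
  OrderEmbedding.ofStrictMono (fun x => ⟨nth J x, hn _ (nth_mem (hc.symm ▸ x.2))⟩)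
    fun _ y hxy => nth_lt_nth (J := J) hxy (hc.symm ▸ y.2)

theorem valueSet_enum (J : Finset ℕ) (hc : J.card = m) (hn : ∀ x ∈ J, x < n) :
    valueSet (enum J hc hn) = J := by
  apply Finset.eq_of_subset_of_card_le
  · intro e he
    obtain ⟨x, -, rfl⟩ := Finset.mem_image.1 he
    exact nth_mem (hc.symm ▸ x.2)
  · rw [card_valueSet, hc]

theorem valueSet_injective : Function.Injective (valueSet : (Fin m ↪o Fin n) → Finset ℕ) := by
  intro I I' h
  ext x
  rw [← nth_valueSet, ← nth_valueSet, h]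

theorem pluckerVec_eq_minor {v : Fin m → Fin n → ℂ} {A : ℕ → ℕ → ℂ}
    (hA : ∀ (x : Fin m) (e : Fin n), A x e = v x e) (I : Fin m ↪o Fin n) :
    pluckerVec v I = minor A (valueSet I) := by
  rw [pluckerVec, minor_eq _ (card_valueSet I)]
  congr 1
  ext i j
  simp only [Matrix.of_apply]
  rw [nth_valueSet, hA]

theorem linearIndependent_of_pluckerVec_ne_zero {v : Fin m → Fin n → ℂ} {I : Fin m ↪o Fin n}
    (h : pluckerVec v I ≠ 0) : LinearIndependent ℂ v := by
  have h1 := Matrix.linearIndependent_rows_of_det_ne_zero h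
  exact LinearIndependent.of_comp (LinearMap.funLeft ℂ ℂ I) h1

theorem mem_coordSpan {S : Set (Fin n)} {w : Fin n → ℂ} :
    w ∈ coordSpan S ↔ ∀ j ∉ S, w j = 0 := by
  constructor
  · intro hw j hj
    induction hw using Submodule.span_induction with
    | mem x hx =>
      obtain ⟨i, hi, rfl⟩ := hx
      change (Pi.single i 1 : Fin n → ℂ) j = 0
      rw [Pi.single_eq_of_ne]
      rintro rfl
      exact hj hi
    | zero => rfl
    | add x y _ _ hx hy => simp [hx, hy]
    | smul a x _ hx => simp [hx]
  · intro h
    have : w = ∑ j, w j • (Pi.single j 1 : Fin n → ℂ) := by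
      rw [← pi_eq_sum_univ' w]
    rw [this]
    refine Submodule.sum_mem _ fun j _ => ?_
    by_cases hj : j ∈ S
    · exact Submodule.smul_mem _ _ (Submodule.subset_span ⟨j, hj, rfl⟩)
    · rw [h j hj, zero_smul]
      exact Submodule.zero_mem _

theorem card_subtype_nth (P : ℕ → Prop) [DecidablePred P] {J : Finset ℕ} (hJ : J.card = m) :
    Fintype.card {x : Fin m // P (nth J x)} = (J.filter P).card := by
  subst hJ
  rw [Fintype.card_subtype]
  refine Finset.card_bij (fun x _ => nth J x) (fun x hx => ?_) (fun x _ y _ hxy => ?_)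
    fun e he => ?_
  · exact Finset.mem_filter.2 ⟨nth_mem x.2, (Finset.mem_filter.1 hx).2⟩
  · exact Fin.ext ((nth_inj x.2 y.2).1 hxy)
  · obtain ⟨h1, h2⟩ := Finset.mem_filter.1 he
    refine ⟨⟨rk J e, rk_lt_card h1⟩, ?_, nth_rk h1⟩
    simp [nth_rk h1, h2]

-- Since the minor at `J` does not vanish, a vector of the row space is determined by its
-- coordinates in `J`. On the intersection only those in columns satisfying `P` can be nonzero.
open Classical in
theorem finrank_inf_coordSpan_le {v : Fin m → Fin n → ℂ} {P : ℕ → Prop} {J : Finset ℕ}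
    (hJ : J.card = m) (hJn : ∀ e ∈ J, e < n) (h : minor (extendMatrix v) J ≠ 0) :
    Module.finrank ℂ (Submodule.span ℂ (Set.range v) ⊓ coordSpan {j : Fin n | P j} :
      Submodule ℂ (Fin n → ℂ)) ≤ (J.filter P).card := by
  have hlt : ∀ x : Fin m, nth J x < n := fun x => hJn _ (nth_mem (hJ.symm ▸ x.2))
  let f : (Submodule.span ℂ (Set.range v) ⊓ coordSpan {j : Fin n | P j} :
      Submodule ℂ (Fin n → ℂ)) →ₗ[ℂ] ({x : Fin m // P (nth J x)} → ℂ) :=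
    (LinearMap.funLeft ℂ ℂ fun x : {x : Fin m // P (nth J x)} =>
      (⟨nth J x.1, hlt x.1⟩ : Fin n)).comp (Submodule.subtype _)
  have hf : Function.Injective f := by
    rw [← LinearMap.ker_eq_bot, LinearMap.ker_eq_bot']
    rintro ⟨w, hw1, hw2⟩ hw
    obtain ⟨a, rfl⟩ := (Submodule.mem_span_range_iff_exists_fun ℂ).1 hw1
    rw [SetLike.mem_coe, mem_coordSpan] at hw2
    have hz : ∀ x : Fin m, (∑ i, a i • v i) ⟨nth J x, hlt x⟩ = 0 := by
      intro x
      by_cases hx : P (nth J x)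
      · exact congrFun hw ⟨x, hx⟩
      · exact hw2 _ (fun h' => hx h')
    rw [minor_eq _ hJ] at h
    have ha : a = 0 := by
      apply Matrix.eq_zero_of_vecMul_eq_zero h
      funext x
      have := hz x
      rw [Finset.sum_apply] at this
      rw [Pi.zero_apply, ← this, Matrix.vecMul, dotProduct]
      refine Finset.sum_congr rfl fun i _ => ?_
      rw [Pi.smul_apply, smul_eq_mul, Matrix.of_apply,
        ← extendMatrix_apply v i ⟨nth J x, hlt x⟩]
    apply Subtype.ext
    simp [ha]
  have := LinearMap.finrank_le_finrank_of_injective hf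
  rwa [Module.finrank_fintype_fun_eq_card, card_subtype_nth P hJ] at this

-- Take a nonvanishing minor with the fewest columns in `P` and normalize at it. A row with pivot in
-- `P` has no nonzero entry outside `P`, since exchanging that column for the pivot would lower the
-- count; so these rows are independent vectors of the intersection.
open Classical in
theorem exists_le_finrank_inf_coordSpan {v : Fin m → Fin n → ℂ} (hv : LinearIndependent ℂ v)
    (P : ℕ → Prop) :
    ∃ J : Finset ℕ, J.card = m ∧ (∀ e ∈ J, e < n) ∧ minor (extendMatrix v) J ≠ 0 ∧
      (J.filter P).card ≤
        Module.finrank ℂ (Submodule.span ℂ (Set.range v) ⊓ coordSpan {j : Fin n | P j} :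
          Submodule ℂ (Fin n → ℂ)) := by
  let F : Finset (Finset ℕ) :=
    ((Finset.range n).powersetCard m).filter fun J => minor (extendMatrix v) J ≠ 0
  have hF : ∀ J, J ∈ F ↔ J.card = m ∧ (∀ e ∈ J, e < n) ∧ minor (extendMatrix v) J ≠ 0 := by
    intro J
    simp only [F, Finset.mem_filter, Finset.mem_powersetCard, Finset.subset_iff,
      Finset.mem_range]
    tauto
  have hne : F.Nonempty := by
    obtain ⟨I, hI⟩ := Function.ne_iff.1 (pluckerVec_ne_zero hv)
    rw [pluckerVec_eq_minor (extendMatrix_apply v)] at hI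
    exact ⟨valueSet I, (hF _).2 ⟨card_valueSet I, fun e => lt_of_mem_valueSet, hI⟩⟩
  obtain ⟨J, hJF, hmin⟩ := F.exists_min_image (fun J => (J.filter P).card) hne
  obtain ⟨hJ, hJn, hJ0⟩ := (hF J).1 hJF
  refine ⟨J, hJ, hJn, hJ0, ?_⟩
  obtain ⟨M, A, hA, hnorm, hminor⟩ := exists_normalized hJ hJ0
  let w : Fin m → Fin n → ℂ := fun x e => A x e
  have hw : ∀ x, w x = ∑ y, M x y • v y := by
    intro x
    funext e
    simp only [w, hA, Finset.sum_apply, Pi.smul_apply, smul_eq_mul, extendMatrix_apply]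
  have hmem : ∀ x : {x : Fin m // P (nth J x)},
      w x.1 ∈ (Submodule.span ℂ (Set.range v) ⊓ coordSpan {j : Fin n | P j} :
        Submodule ℂ (Fin n → ℂ)) := by
    rintro ⟨x, hx⟩
    refine ⟨?_, mem_coordSpan.2 fun e he => ?_⟩
    · rw [hw]
      exact Submodule.sum_mem _ fun y _ =>
        Submodule.smul_mem _ _ (Submodule.subset_span ⟨y, rfl⟩)
    · have he' : ¬ P e := he
      have hxJ : (x : ℕ) < J.card := hJ.symm ▸ x.2
      by_contra hne
      by_cases heJ : (e : ℕ) ∈ J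
      · obtain ⟨y, hy, hye⟩ := exists_nth heJ
        change A x e ≠ 0 at hne
        rw [← hye, hnorm x hxJ y hy] at hne
        have hxy : (x : ℕ) = y := by
          by_contra h
          simp [h] at hne
        exact he' (by rwa [← hye, ← hxy])
      · have h1 := hnorm.minor_exchange_ne_zero hxJ heJ hne
        have hc : (insert (e : ℕ) (J.erase (nth J x))).card = m := by
          rw [card_exchange hxJ heJ, hJ]
        have h2 : insert (e : ℕ) (J.erase (nth J x)) ∈ F := by
          refine (hF _).2 ⟨hc, fun z hz => ?_, ?_⟩
          · rcases Finset.mem_insert.1 hz with rfl | hz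
            · exact e.2
            · exact hJn z (Finset.mem_of_mem_erase hz)
          · rw [hminor _ hc]
            exact mul_ne_zero hJ0 h1
        have h3 := hmin _ h2
        rw [Finset.filter_insert, if_neg he', Finset.filter_erase,
          Finset.card_erase_of_mem (Finset.mem_filter.2 ⟨nth_mem hxJ, hx⟩)] at h3
        have : 0 < (J.filter P).card :=
          Finset.card_pos.2 ⟨_, Finset.mem_filter.2 ⟨nth_mem hxJ, hx⟩⟩
        omega
  have hli : LinearIndependent ℂ fun x : {x : Fin m // P (nth J x)} =>
      (⟨w x.1, hmem x⟩ : (Submodule.span ℂ (Set.range v) ⊓ coordSpan {j : Fin n | P j} :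
        Submodule ℂ (Fin n → ℂ))) := by
    apply LinearIndependent.of_comp (Submodule.subtype _)
    -- The normalized rows have a minor equal to 1, hence are independent.
    have hwli : LinearIndependent ℂ w := by
      apply linearIndependent_of_pluckerVec_ne_zero (I := enum J hJ hJn)
      rw [pluckerVec_eq_minor (A := A) (fun _ _ => rfl), valueSet_enum, hnorm.minor_eq_one]
      exact one_ne_zero
    exact hwli.comp _ Subtype.val_injective
  have := hli.fintype_card_le_finrank
  rwa [card_subtype_nth P hJ] at this

/-- The dimension of the intersection with a coordinate subspace is determined by the
nonvanishing maximal minors. -/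
theorem le_finrank_inf_coordSpan_iff {v : Fin m → Fin n → ℂ} (hv : LinearIndependent ℂ v)
    (P : ℕ → Prop) [DecidablePred P] (d : ℕ) :
    d ≤ Module.finrank ℂ (Submodule.span ℂ (Set.range v) ⊓ coordSpan {j : Fin n | P j} :
      Submodule ℂ (Fin n → ℂ)) ↔
    ∀ J : Finset ℕ, J.card = m → (∀ e ∈ J, e < n) → minor (extendMatrix v) J ≠ 0 →
      d ≤ (J.filter P).card := by
  constructor
  · intro h J hJ hJn hJ0
    refine h.trans ((finrank_inf_coordSpan_le hJ hJn hJ0).trans_eq ?_)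
    congr!
  · intro h
    obtain ⟨J, hJ, hJn, hJ0, hle⟩ := exists_le_finrank_inf_coordSpan hv P
    refine le_trans (h J hJ hJn hJ0) (le_trans (le_of_eq ?_) hle)
    congr!

end Grass

/-! ### Richardson varieties as cones of minors -/

namespace Grass

open PosSet

variable {m k : ℕ}

/-- The set of vertical steps of the boundary path of a Young diagram with at most `m` rows. -/
def stepSet (m : ℕ) (μ : YoungDiagram) : Finset ℕ :=
  (Finset.range m).image fun i => μ.rowLen i + (m - 1 - i)

theorem stepSet_strictAnti (m : ℕ) (μ : YoungDiagram) {i j : ℕ} (hij : i < j) (hj : j < m) :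
    μ.rowLen j + (m - 1 - j) < μ.rowLen i + (m - 1 - i) := by
  have := μ.rowLen_anti i j hij.le
  omega

theorem stepSet_injOn (m : ℕ) (μ : YoungDiagram) :
    Set.InjOn (fun i => μ.rowLen i + (m - 1 - i)) (Finset.range m : Set ℕ) := by
  intro i hi j hj hij
  simp only [Finset.coe_range, Set.mem_Iio] at hi hj
  rcases lt_trichotomy i j with h | h | h
  · have := stepSet_strictAnti m μ h hj
    simp only at hij
    omega
  · exact h
  · have := stepSet_strictAnti m μ h hi
    simp only at hij
    omega

theorem card_stepSet (m : ℕ) (μ : YoungDiagram) : (stepSet m μ).card = m := by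
  rw [stepSet, Finset.card_image_of_injOn (stepSet_injOn m μ), Finset.card_range]

theorem rk_stepSet_eq (m : ℕ) (μ : YoungDiagram) (t : ℕ) :
    rk (stepSet m μ) t = ((Finset.range m).filter fun i => μ.rowLen i + (m - 1 - i) < t).card := by
  rw [rk_eq_card, stepSet, Finset.filter_image, Finset.card_image_of_injOn]
  exact (stepSet_injOn m μ).mono fun i hi => (Finset.mem_filter.1 hi).1

/-- The steps decrease strictly in `i`, so exactly `m - 1 - i` of them lie below the step of row
`i`. -/
theorem rk_stepSet_le_iff (μ : YoungDiagram) {i : ℕ} (hi : i < m) (t : ℕ) :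
    rk (stepSet m μ) t ≤ m - 1 - i ↔ t ≤ μ.rowLen i + (m - 1 - i) := by
  rw [rk_stepSet_eq]
  constructor
  · intro h
    by_contra! hlt
    have hsub : Finset.Ico i m ⊆
        (Finset.range m).filter fun i => μ.rowLen i + (m - 1 - i) < t := by
      intro j hj
      rw [Finset.mem_Ico] at hj
      rw [Finset.mem_filter, Finset.mem_range]
      refine ⟨hj.2, ?_⟩
      rcases hj.1.lt_or_eq with h' | h'
      · exact (stepSet_strictAnti m μ h' hj.2).trans hlt
      · rwa [← h']
    have := Finset.card_le_card hsub
    rw [Nat.card_Ico] at this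
    omega
  · intro h
    have hsub : (Finset.range m).filter (fun i => μ.rowLen i + (m - 1 - i) < t) ⊆
        Finset.Ico (i + 1) m := by
      intro j hj
      rw [Finset.mem_filter, Finset.mem_range] at hj
      rw [Finset.mem_Ico]
      refine ⟨?_, hj.1⟩
      by_contra! hji
      rcases (Nat.le_of_lt_succ hji).lt_or_eq with h' | h'
      · have := stepSet_strictAnti m μ h' hi
        omega
      · rw [h'] at hj
        omega
    have := Finset.card_le_card hsub
    rw [Nat.card_Ico] at this
    omega

/-- The rank function of the step set jumps only just past a step, and those are the positions
tested by the Schubert conditions; between jumps monotonicity of `rk J` suffices. -/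
theorem schubert_iff_rk (ν : YoungDiagram) {J : Finset ℕ} :
    (∀ i < m, m - i ≤ (J.filter (· < ν.rowLen i + (m - i))).card) ↔
      ∀ t, rk (stepSet m ν) t ≤ rk J t := by
  simp only [← rk_eq_card]
  constructor
  · intro h t
    have hle := rk_le_card (stepSet m ν) t
    rw [card_stepSet] at hle
    by_contra! hlt
    obtain ⟨i, hi⟩ : ∃ i, i + rk (stepSet m ν) t = m := ⟨m - rk (stepSet m ν) t, by omega⟩
    have h1 := rk_stepSet_le_iff (m := m) ν (i := i) (by omega) t
    have h2 := h i (by omega)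
    have h3 : ν.rowLen i + (m - i) ≤ t := by
      by_contra! h4
      have := h1.2 (by omega)
      omega
    have := rk_mono J h3
    omega
  · intro h i hi
    have h1 := rk_stepSet_le_iff ν hi (ν.rowLen i + (m - i))
    have h2 := h (ν.rowLen i + (m - i))
    by_contra! hlt
    have := h1.1 (by omega)
    omega

/-- The elements of `J` counted by the condition for `i` are complementary to those below the step
of row `i`, so a lower bound on their number is an upper bound on a rank. Positions strictly between
steps again follow by monotonicity. -/
theorem oppSchubert_iff_rk (μ : YoungDiagram) {J : Finset ℕ} (hJ : J.card = m) :
    (∀ i < m, i + 1 ≤ (J.filter (fun j => μ.rowLen i + (m - i) ≤ j + 1)).card) ↔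
      ∀ t, rk J t ≤ rk (stepSet m μ) t := by
  have hcard : ∀ i < m, (J.filter (fun j => μ.rowLen i + (m - i) ≤ j + 1)).card
      + rk J (μ.rowLen i + (m - 1 - i)) = m := by
    intro i hi
    have h := Finset.card_filter_add_card_filter_not (s := J) (· < μ.rowLen i + (m - 1 - i))
    have h' : J.filter (fun j => μ.rowLen i + (m - i) ≤ j + 1)
        = J.filter (fun j => ¬ j < μ.rowLen i + (m - 1 - i)) := by
      ext j
      simp only [Finset.mem_filter]
      exact and_congr_right fun _ => by omega
    rw [hJ, add_comm, ← rk_eq_card] at h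
    rw [h', h]
  constructor
  · intro h t
    have hle := rk_le_card J t
    by_contra! hlt
    obtain ⟨i, hi⟩ : ∃ i, i + 1 + rk (stepSet m μ) t = m :=
      ⟨m - 1 - rk (stepSet m μ) t, by omega⟩
    have h1 := (rk_stepSet_le_iff (m := m) μ (i := i) (by omega) t).1 (by omega)
    have h2 := h i (by omega)
    have h3 := hcard i (by omega)
    have := rk_mono J h1
    omega
  · intro h i hi
    have h1 := (rk_stepSet_le_iff μ hi (μ.rowLen i + (m - 1 - i))).2 le_rfl
    have h2 := h (μ.rowLen i + (m - 1 - i))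
    have h3 := hcard i hi
    omega

theorem lt_of_mem_stepSet (θ : SkewDiagram m k) {x : ℕ} (hx : x ∈ stepSet m θ.outer) :
    x < m + k := by
  obtain ⟨i, hi, rfl⟩ := Finset.mem_image.1 hx
  rw [Finset.mem_range] at hi
  have hle : θ.outer.rowLen i ≤ k := by
    by_contra! h
    have h1 := θ.outer_le_rectangle ((YoungDiagram.mem_cells _).2 (YoungDiagram.mem_iff_lt_rowLen.2 h))
    simp at h1
  omega

/-- The subspaces in a Richardson variety are characterized by their nonvanishing maximal
minors. -/
theorem span_mem_richardson_iff (θ : SkewDiagram m k) {v : Fin m → Fin (m + k) → ℂ}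
    (hv : LinearIndependent ℂ v) :
    Submodule.span ℂ (Set.range v) ∈ richardson θ ↔
      ∀ I, pluckerVec v I ≠ 0 →
        Between (stepSet m θ.inner) (stepSet m θ.outer) (valueSet I) := by
  have hrank : Submodule.span ℂ (Set.range v) ∈ Gr m (m + k) := by
    change Module.finrank ℂ _ = m
    rw [finrank_span_eq_card hv, Fintype.card_fin]
  have h1 : Submodule.span ℂ (Set.range v) ∈ richardson θ ↔
      ∀ J : Finset ℕ, J.card = m → (∀ e ∈ J, e < m + k) → minor (extendMatrix v) J ≠ 0 →
        Between (stepSet m θ.inner) (stepSet m θ.outer) J := by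
    rw [richardson, Set.mem_inter_iff]
    constructor
    · rintro ⟨⟨-, hs⟩, ⟨-, ho⟩⟩ J hJ hJn hJ0 t
      refine ⟨(schubert_iff_rk θ.outer).1 (fun i hi => ?_) t,
        (oppSchubert_iff_rk θ.inner hJ).1 (fun i hi => ?_) t⟩
      · exact (le_finrank_inf_coordSpan_iff hv (· < θ.outer.rowLen i + (m - i)) _).1 (hs i hi)
          J hJ hJn hJ0
      · exact (le_finrank_inf_coordSpan_iff hv
          (fun j => θ.inner.rowLen i + (m - i) ≤ j + 1) _).1 (ho i hi) J hJ hJn hJ0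
    · intro h
      refine ⟨⟨hrank, fun i hi => ?_⟩, ⟨hrank, fun i hi => ?_⟩⟩
      · refine (le_finrank_inf_coordSpan_iff hv (· < θ.outer.rowLen i + (m - i)) _).2 ?_
        intro J hJ hJn hJ0
        exact (schubert_iff_rk θ.outer).2 (fun t => (h J hJ hJn hJ0 t).1) i hi
      · refine (le_finrank_inf_coordSpan_iff hv
          (fun j => θ.inner.rowLen i + (m - i) ≤ j + 1) _).2 ?_
        intro J hJ hJn hJ0
        exact (oppSchubert_iff_rk θ.inner hJ).2 (fun t => (h J hJ hJn hJ0 t).2) i hi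
  rw [h1]
  constructor
  · intro h I hI
    refine h _ (card_valueSet I) (fun e => lt_of_mem_valueSet) ?_
    rwa [← pluckerVec_eq_minor (extendMatrix_apply v)]
  · intro h J hJ hJn hJ0
    rw [← valueSet_enum J hJ hJn] at hJ0 ⊢
    rw [← pluckerVec_eq_minor (extendMatrix_apply v)] at hJ0
    exact h _ hJ0

/-- The Plücker coordinates that do not vanish identically on a Richardson variety. -/
noncomputable def coordIndex (θ : SkewDiagram m k)
    (J : {J : Finset ℕ // Between (stepSet m θ.inner) (stepSet m θ.outer) J}) :
    Fin m ↪o Fin (m + k) :=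
  enum J.1 (by rw [J.2.card_eq (by simp [card_stepSet]), card_stepSet])
    (J.2.subset (by simp [card_stepSet]) fun _ => lt_of_mem_stepSet θ)

theorem valueSet_coordIndex (θ : SkewDiagram m k)
    (J : {J : Finset ℕ // Between (stepSet m θ.inner) (stepSet m θ.outer) J}) :
    valueSet (coordIndex θ J) = J.1 :=
  valueSet_enum _ _ _

theorem mem_range_coordIndex (θ : SkewDiagram m k) (I : Fin m ↪o Fin (m + k)) :
    I ∈ Set.range (coordIndex θ) ↔
      Between (stepSet m θ.inner) (stepSet m θ.outer) (valueSet I) := by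
  constructor
  · rintro ⟨J, rfl⟩
    rw [valueSet_coordIndex]
    exact J.2
  · intro h
    exact ⟨⟨_, h⟩, valueSet_injective (valueSet_coordIndex θ _)⟩

/-- Minors of a basis, extended by zero, give an element of the cone. Conversely a nonzero vector of
minors forces the rows of the matrix to be independent, and their span satisfies the rank conditions
because the minors outside the range vanish. -/
theorem isCoordCone_richardsonVariety (θ : SkewDiagram m k) :
    ProjectiveVariety.IsCoordCone (richardsonVariety θ) (coordIndex θ)
      (cone (stepSet m θ.inner) (stepSet m θ.outer)) := by
  refine ⟨fun J J' h => ?_, fun q hq a ha => cone_smul hq ha, fun p => ⟨?_, ?_⟩⟩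
  · apply Subtype.ext
    rw [← valueSet_coordIndex θ J, h, valueSet_coordIndex]
  · rintro ⟨W, hW, b, rfl⟩
    set v : Fin m → Fin (m + k) → ℂ := fun i => (b i : Fin (m + k) → ℂ) with hvdef
    have hv : LinearIndependent ℂ v := linearIndependent_coe_basis b
    have hspan : Submodule.span ℂ (Set.range v) = W := by
      have h1 : Set.range v = W.subtype '' Set.range b := by
        rw [← Set.range_comp]
        rfl
      rw [h1, Submodule.span_image, b.span_eq, Submodule.map_subtype_top]
    rw [← hspan, span_mem_richardson_iff θ hv] at hW
    obtain ⟨a, ha⟩ := Projectivization.exists_smul_eq_mk_rep ℂ (pluckerVec v)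
      (pluckerVec_ne_zero hv)
    have ha' : (pluckerPoint b).rep = (a : ℂ) • pluckerVec v := ha.symm
    have h0 : ∀ I, I ∉ Set.range (coordIndex θ) → (pluckerPoint b).rep I = 0 := by
      intro I hI
      rw [mem_range_coordIndex] at hI
      rw [ha', Pi.smul_apply, not_not.1 (mt (hW I) hI), smul_zero]
    refine ⟨h0, fun hz => (pluckerPoint b).rep_nonzero ?_, extendMatrix v, a, ?_, ?_⟩
    · funext I
      by_cases hI : I ∈ Set.range (coordIndex θ)
      · obtain ⟨J, rfl⟩ := hI
        exact congrFun hz J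
      · exact h0 I hI
    · intro J hJ hB
      rw [card_stepSet] at hJ
      by_cases hJn : ∀ x ∈ J, x < m + k
      · by_contra hne
        rw [← valueSet_enum J hJ hJn, ← pluckerVec_eq_minor (extendMatrix_apply v)] at hne
        have := hW _ hne
        rw [valueSet_enum] at this
        exact hB this
      -- A column set leaving `{0, …, m + k - 1}` meets a zero column of the extended matrix.
      · push Not at hJn
        obtain ⟨x, hx, hxn⟩ := hJn
        refine minor_eq_zero_of_col hx fun y _ => ?_
        rw [extendMatrix, dif_neg]
        omega
    · intro J
      rw [Function.comp_apply, ha', Pi.smul_apply, smul_eq_mul,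
        pluckerVec_eq_minor (extendMatrix_apply v), valueSet_coordIndex]
  · rintro ⟨h0, hne, A, c, hA, hc⟩
    let v : Fin m → Fin (m + k) → ℂ := fun x e => A x e
    have hrep : p.rep = c • pluckerVec v := by
      funext I
      rw [Pi.smul_apply, smul_eq_mul, pluckerVec_eq_minor (A := A) fun _ _ => rfl]
      by_cases hI : I ∈ Set.range (coordIndex θ)
      · obtain ⟨J, rfl⟩ := hI
        rw [valueSet_coordIndex]
        exact hc J
      · rw [h0 I hI, hA _ (by rw [card_valueSet, card_stepSet])
          (mt (mem_range_coordIndex θ I).2 hI), mul_zero]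
    have hv0 : pluckerVec v ≠ 0 := by
      intro h
      apply p.rep_nonzero
      rw [hrep, h, smul_zero]
    have hv : LinearIndependent ℂ v := by
      obtain ⟨I, hI⟩ := Function.ne_iff.1 hv0
      exact linearIndependent_of_pluckerVec_ne_zero hI
    have hc0 : c ≠ 0 := by
      rintro rfl
      exact p.rep_nonzero (by rw [hrep, zero_smul])
    refine ⟨Submodule.span ℂ (Set.range v), (span_mem_richardson_iff θ hv).2 fun I hI => ?_,
      Module.Basis.span hv, ?_⟩
    · by_contra hB
      rw [pluckerVec_eq_minor (A := A) fun _ _ => rfl] at hI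
      exact hI (hA _ (by rw [card_valueSet, card_stepSet]) hB)
    · have hb : (fun i => ((Module.Basis.span hv) i : Fin (m + k) → ℂ)) = v := by
        funext i
        rw [Module.Basis.span_apply hv i]
      rw [← p.mk_rep, pluckerPoint, Projectivization.mk_eq_mk_iff']
      refine ⟨c, ?_⟩
      rw [hb, hrep]

end Grass

namespace PosSet

/-! ### The block decomposition of a pair of rank functions -/

/-- A position at which all sets between `V` and `L` have the same rank. -/
def Cut (L V : Finset ℕ) (t : ℕ) : Prop := rk L t = rk V t

instance (L V : Finset ℕ) : DecidablePred (Cut L V) := fun _ => Nat.decEq _ _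

/-- The last cut at or before a given position. -/
def lastCut (L V : Finset ℕ) (e : ℕ) : ℕ := Nat.findGreatest (Cut L V) e

variable {L V J K : Finset ℕ}

theorem cut_zero : Cut L V 0 := by rw [Cut, rk_zero, rk_zero]

theorem cut_lastCut (e : ℕ) : Cut L V (lastCut L V e) :=
  Nat.findGreatest_spec (Nat.zero_le e) cut_zero

theorem lastCut_le (e : ℕ) : lastCut L V e ≤ e := Nat.findGreatest_le e

theorem Cut.le_lastCut {s e : ℕ} (h : Cut L V s) (hs : s ≤ e) : s ≤ lastCut L V e :=
  Nat.le_findGreatest hs h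

theorem Cut.le_lastCut_iff {s e : ℕ} (h : Cut L V s) : s ≤ lastCut L V e ↔ s ≤ e :=
  ⟨fun h' => h'.trans (lastCut_le e), h.le_lastCut⟩

theorem Cut.lastCut_eq {s : ℕ} (h : Cut L V s) : lastCut L V s = s :=
  le_antisymm (lastCut_le s) (h.le_lastCut le_rfl)

theorem lastCut_mono : Monotone (lastCut L V) := fun _ _ h => Nat.findGreatest_mono_right _ h

/-- The cuts that are not followed by another cut. -/
def blockStarts (L V : Finset ℕ) : Finset ℕ :=
  (Finset.range ((L ∪ V).sup id + 1)).filter fun s => Cut L V s ∧ ¬ Cut L V (s + 1)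

/-- Past the largest element of `L ∪ V` every position is a cut, so the finite range in the
definition excludes nothing. -/
theorem mem_blockStarts (hc : L.card = V.card) {s : ℕ} :
    s ∈ blockStarts L V ↔ Cut L V s ∧ ¬ Cut L V (s + 1) := by
  rw [blockStarts, Finset.mem_filter, Finset.mem_range]
  refine ⟨fun h => h.2, fun h => ⟨?_, h⟩⟩
  by_contra! hs
  apply h.2
  have hb : ∀ x ∈ L ∪ V, x < s + 1 := fun x hx => by
    have : x ≤ (L ∪ V).sup id := Finset.le_sup (f := id) hx
    omega
  rw [Cut, rk_of_subset fun x hx => hb x (by simp [hx]),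
    rk_of_subset fun x hx => hb x (by simp [hx]), hc]

/-- If the last cut is not a block start, the position after it is also a cut, so `e` cannot lie
beyond it. Such `e` are the trivial positions, between two adjacent cuts. -/
theorem eq_lastCut_of_notMem (hc : L.card = V.card) {e : ℕ} (h : lastCut L V e ∉ blockStarts L V) :
    e = lastCut L V e := by
  rw [mem_blockStarts hc] at h
  have h1 : Cut L V (lastCut L V e + 1) := by
    by_contra h'
    exact h ⟨cut_lastCut e, h'⟩
  have h2 := lastCut_le (L := L) (V := V) e
  by_contra hne
  have := h1.le_lastCut (e := e) (by omega)
  omega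

/-- The elements of `J` in the block that starts at `s`. -/
def block (L V J : Finset ℕ) (s : ℕ) : Finset ℕ := J.filter (lastCut L V · = s)

theorem mem_block {s e : ℕ} : e ∈ block L V J s ↔ e ∈ J ∧ lastCut L V e = s := Finset.mem_filter

theorem rk_block_eq_zero {s t : ℕ} (h : t ≤ s) : rk (block L V J s) t = 0 := by
  rw [rk_eq_card, Finset.card_eq_zero, Finset.filter_eq_empty_iff]
  intro e he
  have := lastCut_le (L := L) (V := V) e
  rw [(mem_block.1 he).2] at this
  omega

theorem rk_block_eq_card {s t : ℕ} (h : s < lastCut L V t) :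
    rk (block L V J s) t = (block L V J s).card := by
  apply rk_of_subset
  intro e he
  apply (lastCut_mono (L := L) (V := V)).reflect_lt
  rwa [(mem_block.1 he).2]

theorem rk_lastCut_add (e : ℕ) :
    rk J e = rk J (lastCut L V e) + rk (block L V J (lastCut L V e)) e := by
  rw [rk_label lastCut_mono J e, block, rk_eq_card J (lastCut L V e)]
  congr 2
  ext x
  simp only [Finset.mem_filter, ← not_le, (cut_lastCut e).le_lastCut_iff]

/-- Variant of `rk_lastCut_add` that reaches the right end of a block: `e + 1` may itself be a cut,
and then its own last cut would give no information. -/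
theorem rk_succ_lastCut_add (e : ℕ) :
    rk J (e + 1) = rk J (lastCut L V e) + rk (block L V J (lastCut L V e)) (e + 1) := by
  rw [rk_succ, rk_succ, rk_lastCut_add (L := L) (V := V) (J := J) e, add_assoc]
  congr 2
  simp [mem_block]

theorem Between.rk_cut (h : Between L V J) {s : ℕ} (hs : Cut L V s) : rk J s = rk V s := by
  have := h s
  rw [Cut] at hs
  omega

/-- At each cut `J` and `V` have the same rank, so the same indices of their enumerations fall
before it. Hence the `x`-th elements lie in the same block. -/
theorem Between.lastCut_nth (h : Between L V J) (hc : L.card = V.card) {x : ℕ}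
    (hx : x < V.card) : lastCut L V (nth J x) = lastCut L V (nth V x) := by
  have hx' : x < J.card := by rwa [h.card_eq hc]
  apply le_antisymm
  · apply (cut_lastCut _).le_lastCut
    rw [le_nth_iff hx, ← h.rk_cut (cut_lastCut _), ← le_nth_iff hx']
    exact lastCut_le _
  · apply (cut_lastCut _).le_lastCut
    rw [le_nth_iff hx', h.rk_cut (cut_lastCut _), ← le_nth_iff hx]
    exact lastCut_le _

/-- Sets whose elements have the same labels have the same number of elements with labels
satisfying a given condition. -/
theorem card_filter_label {b : ℕ → ℕ} (hK : K.card = V.card)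
    (h : ∀ x < V.card, b (nth K x) = b (nth V x)) (Q : ℕ → Prop) [DecidablePred Q] :
    (K.filter fun e => Q (b e)).card = (V.filter fun e => Q (b e)).card := by
  rw [← Grass.card_subtype_nth (fun e => Q (b e)) hK,
    ← Grass.card_subtype_nth (fun e => Q (b e)) (rfl : V.card = V.card)]
  refine Fintype.card_congr (Equiv.subtypeEquivRight fun x => ?_)
  rw [h x x.2]

/-- Elements are enumerated label by label, so the numbers of elements per label determine the
sequence of labels. -/
theorem label_eq_of_card {b : ℕ → ℕ} (hb : Monotone b)
    (h : ∀ s, (K.filter (b · = s)).card = (V.filter (b · = s)).card) {x : ℕ} (hx : x < V.card) :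
    b (nth K x) = b (nth V x) := by
  have hlt : ∀ s, (K.filter (b · < s)).card = (V.filter (b · < s)).card := by
    intro s
    induction s with
    | zero => simp
    | succ s ih =>
      have h1 : ∀ J : Finset ℕ, (J.filter (b · < s + 1)).card
          = (J.filter (b · < s)).card + (J.filter (b · = s)).card := by
        intro J
        rw [← Finset.card_union_of_disjoint]
        · congr 1
          ext e
          simp only [Finset.mem_filter, Finset.mem_union, Nat.lt_succ_iff_lt_or_eq]
          tauto
        · rw [Finset.disjoint_left]
          intro e he he'
          simp only [Finset.mem_filter] at he he'
          omega
      rw [h1, h1, ih, h]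
  set s := b (nth V x) with hs
  have h1 := rk_label hb V (nth V x)
  rw [rk_nth hx, ← hs] at h1
  have h2 : rk (V.filter (b · = s)) (nth V x) < (V.filter (b · = s)).card :=
    rk_lt_card (Finset.mem_filter.2 ⟨nth_mem hx, rfl⟩)
  rw [← h] at h2
  have h3 := (nth_label hb h2).2
  rw [hlt, ← h1] at h3
  rw [h3]
  exact (Finset.mem_filter.1 (nth_mem h2)).2

/-- Before the block all three ranks are zero, after it they are the common cardinality, and inside
they differ from the global ranks by the common rank at the cut `s`. If `s` is not a cut, the blocks
are empty. -/
theorem Between.block (h : Between L V J) (hc : L.card = V.card) (s : ℕ) :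
    Between (block L V L s) (block L V V s) (block L V J s) := by
  have hLV : Between L V L := fun t => ⟨(h t).1.trans (h t).2, le_rfl⟩
  intro t
  rcases lt_trichotomy (lastCut L V t) s with hs | hs | hs
  · by_cases hcs : Cut L V s
    · have hts : t ≤ s := by
        by_contra! hlt
        exact absurd (hcs.le_lastCut hlt.le) (not_le.2 hs)
      simp [rk_block_eq_zero hts]
    · have hempty : ∀ J : Finset ℕ, PosSet.block L V J s = ∅ := by
        intro J
        rw [Finset.eq_empty_iff_forall_notMem]
        intro e he
        exact hcs ((mem_block.1 he).2 ▸ cut_lastCut e)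
      simp [hempty]
  · have h1 := rk_lastCut_add (L := L) (V := V) (J := J) t
    have h2 := rk_lastCut_add (L := L) (V := V) (J := L) t
    have h3 := rk_lastCut_add (L := L) (V := V) (J := V) t
    have h4 := h.rk_cut (cut_lastCut t)
    have h5 : rk L _ = rk V _ := cut_lastCut (L := L) (V := V) t
    have h6 := h t
    rw [hs] at h1 h2 h3 h4 h5
    omega
  · rw [rk_block_eq_card hs, rk_block_eq_card hs, rk_block_eq_card hs]
    have h1 := card_filter_label (h.card_eq hc) (fun x hx => h.lastCut_nth hc hx) (· = s)
    have h2 := card_filter_label hc (fun x hx => hLV.lastCut_nth hc hx) (· = s)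
    exact ⟨h1.ge, (h1.trans h2.symm).le⟩

theorem Between.mem_iff_of_notMem (h : Between L V J) (hc : L.card = V.card) {e : ℕ}
    (he : lastCut L V e ∉ blockStarts L V) : e ∈ J ↔ e ∈ V := by
  have h1 := eq_lastCut_of_notMem hc he
  have hcut := cut_lastCut (L := L) (V := V) e
  rw [mem_blockStarts hc, ← h1] at he
  rw [← h1] at hcut
  have hcut' : Cut L V (e + 1) := by
    by_contra h'
    exact he ⟨hcut, h'⟩
  rw [mem_iff_rk, mem_iff_rk, h.rk_cut hcut, h.rk_cut hcut']

/-- Strong induction from `u + 1` back to the last cut at or before `u`, where both bounds agree;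
the part after that cut is either a block or a single forced position. -/
theorem between_of_blocks (hc : L.card = V.card)
    (hS : ∀ s ∈ blockStarts L V, Between (block L V L s) (block L V V s) (block L V J s))
    (hT : ∀ e, lastCut L V e ∉ blockStarts L V → (e ∈ J ↔ e ∈ V)) : Between L V J := by
  intro t
  induction t using Nat.strong_induction_on with
  | _ t ih =>
    rcases Nat.eq_zero_or_pos t with rfl | ht
    · simp [rk_zero]
    obtain ⟨u, rfl⟩ : ∃ u, t = u + 1 := ⟨t - 1, by omega⟩
    have hle := lastCut_le (L := L) (V := V) u
    have h1 := ih (lastCut L V u) (by omega)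
    have h2 : rk L _ = rk V _ := cut_lastCut (L := L) (V := V) u
    have h3 := rk_succ_lastCut_add (L := L) (V := V) (J := J) u
    have h4 := rk_succ_lastCut_add (L := L) (V := V) (J := L) u
    have h5 := rk_succ_lastCut_add (L := L) (V := V) (J := V) u
    by_cases hs : lastCut L V u ∈ blockStarts L V
    · have := hS _ hs (u + 1)
      omega
    · have hu := eq_lastCut_of_notMem hc hs
      have hmem := hT u hs
      rw [mem_blockStarts hc, ← hu] at hs
      have hcut' : rk L (u + 1) = rk V (u + 1) := by
        by_contra h'
        exact hs ⟨hu ▸ cut_lastCut u, h'⟩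
      rw [← hu] at h1 h2
      have h6 : rk J (u + 1) = rk V (u + 1) := by
        rw [rk_succ, rk_succ]
        simp only [hmem]
        omega
      omega

/-- Outside the block both bounding rank functions are constant and equal, so the rank of `K` cannot
jump there. -/
theorem Between.lastCut_of_mem (hc : L.card = V.card) (hLV : ∀ t, rk V t ≤ rk L t) {s : ℕ}
    (hs : Cut L V s) (h : Between (PosSet.block L V L s) (PosSet.block L V V s) K) {e : ℕ}
    (he : e ∈ K) : lastCut L V e = s := by
  have hL : Between L V L := fun t => ⟨hLV t, le_rfl⟩
  have hcard : (PosSet.block L V L s).card = (PosSet.block L V V s).card :=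
    card_filter_label hc (fun x hx => hL.lastCut_nth hc hx) (· = s)
  have h1 := mem_iff_rk.1 he
  have h2 := h e
  have h3 := h (e + 1)
  rcases lt_trichotomy (lastCut L V e) s with hlt | heq | hgt
  · have hes : e + 1 ≤ s := by
      by_contra! h'
      exact absurd (hs.le_lastCut (e := e) (by omega)) (not_le.2 hlt)
    rw [rk_block_eq_zero hes, rk_block_eq_zero hes] at h3
    omega
  · exact heq
  · have hgt' : s < lastCut L V (e + 1) := hgt.trans_le (lastCut_mono (Nat.le_succ e))
    rw [rk_block_eq_card hgt, rk_block_eq_card hgt] at h2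
    rw [rk_block_eq_card hgt', rk_block_eq_card hgt'] at h3
    omega

/-- A set between `V` and `L` amounts to a family of such sets in the blocks. -/
noncomputable def blockEquiv (hc : L.card = V.card) (hLV : ∀ t, rk V t ≤ rk L t) :
    {J // Between L V J} ≃
      ∀ s : blockStarts L V, {J // Between (block L V L s) (block L V V s) J} :=
  Equiv.ofBijective (fun J s => ⟨block L V J.1 s, J.2.block hc s⟩) <| by
    constructor
    · intro J J' h
      apply Subtype.ext
      ext e
      by_cases he : lastCut L V e ∈ blockStarts L V
      · have h1 := congrArg Subtype.val (congrFun h ⟨_, he⟩)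
        have h2 : e ∈ block L V J.1 (lastCut L V e) ↔ e ∈ block L V J'.1 (lastCut L V e) := by
          rw [show block L V J.1 (lastCut L V e) = block L V J'.1 (lastCut L V e) from h1]
        simpa [mem_block] using h2
      · rw [J.2.mem_iff_of_notMem hc he, J'.2.mem_iff_of_notMem hc he]
    · intro F
      have hF : ∀ (s : blockStarts L V) (e : ℕ), e ∈ (F s).1 → lastCut L V e = s := fun s e he =>
        Between.lastCut_of_mem hc hLV ((mem_blockStarts hc).1 s.2).1 (F s).2 he
      -- Glue the given sets and add the elements of `V` at trivial positions, which belong to every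
      -- admissible set.
      let J : Finset ℕ := (Finset.univ.biUnion fun s => (F s).1) ∪
        V.filter (lastCut L V · ∉ blockStarts L V)
      have hblock : ∀ s : blockStarts L V, block L V J s = (F s).1 := by
        intro s
        ext e
        simp only [mem_block, J, Finset.mem_union, Finset.mem_biUnion, Finset.mem_univ, true_and,
          Finset.mem_filter]
        constructor
        · rintro ⟨⟨s', hs'⟩ | ⟨-, h⟩, h'⟩
          · have := hF s' e hs'
            have : s' = s := Subtype.ext (this.symm.trans h')
            rwa [← this]
          · exact absurd (h' ▸ s.2) h
        · intro he
          exact ⟨Or.inl ⟨s, he⟩, hF s e he⟩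
      have hJ : Between L V J := by
        refine between_of_blocks hc (fun s hs => ?_) fun e he => ?_
        · rw [hblock ⟨s, hs⟩]
          exact (F ⟨s, hs⟩).2
        · simp only [J, Finset.mem_union, Finset.mem_biUnion, Finset.mem_univ, true_and,
            Finset.mem_filter]
          constructor
          · rintro (⟨s, hs⟩ | ⟨h, -⟩)
            · exact absurd (hF s e hs ▸ s.2) he
            · exact h
          · exact fun h => Or.inr ⟨h, he⟩
      exact ⟨⟨J, hJ⟩, funext fun s => Subtype.ext (hblock s)⟩

end PosSet

/-! ### Products of cones -/

/-- The nonzero multiples of the products of elements of cones. -/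
def piCone {I : Type*} [Fintype I] {T : I → Type*} (C : ∀ i, Set (T i → ℂ)) :
    Set ((∀ i, T i) → ℂ) :=
  {p | p ≠ 0 ∧ ∃ (q : ∀ i, T i → ℂ) (c : ℂ), (∀ i, q i ∈ C i) ∧ ∀ t, p t = c * ∏ i, q i (t i)}

theorem ConeEquiv.pi {I I' : Type*} [Fintype I] [Fintype I'] {T : I → Type*} {T' : I' → Type*}
    {C : ∀ i, Set (T i → ℂ)} {C' : ∀ i, Set (T' i → ℂ)} (f : I ≃ I')
    (h : ∀ i, ConeEquiv (C i) (C' (f i))) : ConeEquiv (piCone C) (piCone C') := by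
  choose e he using h
  let E : (∀ i, T i) ≃ (∀ i, T' i) := Equiv.piCongr f e
  have hE : ∀ t i, E t (f i) = e i (t i) := fun t i => Equiv.piCongr_apply_apply f e t i
  have hprod : ∀ (q : ∀ i, T' i → ℂ) t,
      ∏ i, q i (E t i) = ∏ i, q (f i) (e i (t i)) := by
    intro q t
    rw [← f.prod_comp]
    simp only [hE]
  refine ⟨E, fun p => and_congr ?_ ⟨?_, ?_⟩⟩
  · rw [not_iff_not]
    constructor
    · rintro rfl
      rfl
    · intro h0
      funext t
      have := congrFun h0 (E.symm t)
      simpa using this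
  · rintro ⟨q, c, hq, hp⟩
    refine ⟨fun i => q (f i) ∘ e i, c, fun i => (he i _).1 (hq _), fun t => ?_⟩
    rw [Function.comp_apply, hp, hprod]
    rfl
  · rintro ⟨q, c, hq, hp⟩
    -- The family over `I'` needs a cast along `f (f.symm i') = i'`; `hq'` removes it at indices of
    -- the form `f i`.
    let q' : ∀ i, T' i → ℂ := fun i' =>
      f.apply_symm_apply i' ▸ (q (f.symm i') ∘ (e (f.symm i')).symm)
    have hq' : ∀ i, q' (f i) = q i ∘ (e i).symm := by
      intro i
      simp only [q']
      generalize_proofs hpf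
      generalize hj : f.symm (f i) = j at hpf
      have : j = i := by rw [← hj, f.symm_apply_apply]
      subst this
      rfl
    refine ⟨q', c, fun i' => ?_, fun t => ?_⟩
    · obtain ⟨i, rfl⟩ := f.surjective i'
      rw [hq', he]
      have : (q i ∘ (e i).symm) ∘ e i = q i := by
        funext x
        simp
      rw [this]
      exact hq i
    · have h1 := hp (E.symm t)
      rw [Function.comp_apply, E.apply_symm_apply] at h1
      rw [h1]
      congr 1
      have h2 := hprod q' (E.symm t)
      rw [E.apply_symm_apply] at h2
      rw [h2]
      refine Finset.prod_congr rfl fun i _ => ?_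
      rw [hq', Function.comp_apply, Equiv.symm_apply_apply]

/-! ### Factorization of minors over the blocks -/

namespace PosSet

variable {L V J K : Finset ℕ}

/-- Exchanging elements of different blocks moves an element across a cut and so changes the rank
there, which is forced. -/
theorem exists_block_separated {J : Finset ℕ} (hJ : Between L V J) {x e : ℕ} (hx : x < J.card)
    (he : e ∉ J) (hne : lastCut L V (nth J x) ≠ lastCut L V e) :
    ¬ Between L V (insert e (J.erase (nth J x))) := by
  intro h
  have hmem := nth_mem hx
  have hne' : e ∉ J.erase (nth J x) := fun h => he (Finset.mem_of_mem_erase h)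
  rcases hne.lt_or_gt with hlt | hlt
  · have hcut := cut_lastCut (L := L) (V := V) e
    have h1 := h.rk_cut hcut
    rw [← hJ.rk_cut hcut, rk_eq_card, rk_eq_card, Finset.filter_insert,
      if_neg (not_lt.2 (lastCut_le e)), Finset.filter_erase, Finset.card_erase_of_mem] at h1
    · have : 0 < (J.filter (· < lastCut L V e)).card := by
        refine Finset.card_pos.2 ⟨nth J x, Finset.mem_filter.2 ⟨hmem, ?_⟩⟩
        by_contra! h'
        exact absurd (hcut.le_lastCut h') (not_le.2 hlt)
      omega
    · refine Finset.mem_filter.2 ⟨hmem, ?_⟩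
      by_contra! h'
      exact absurd (hcut.le_lastCut h') (not_le.2 hlt)
  · have hcut := cut_lastCut (L := L) (V := V) (nth J x)
    have h1 := h.rk_cut hcut
    have hes : e < lastCut L V (nth J x) := by
      by_contra! h'
      exact absurd (hcut.le_lastCut h') (not_le.2 hlt)
    rw [← hJ.rk_cut hcut, rk_eq_card, rk_eq_card, Finset.filter_insert, if_pos hes,
      Finset.card_insert_of_notMem (fun h' => hne' (Finset.mem_filter.1 h').1),
      Finset.filter_erase, Finset.erase_eq_of_notMem] at h1
    · omega
    · intro h'
      exact absurd (lastCut_le (nth J x)) (not_le.2 (Finset.mem_filter.1 h').2)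

/-- The matrix without its first `a` rows. -/
def dropRows (A : ℕ → ℕ → ℂ) (a : ℕ) (y e : ℕ) : ℂ := A (a + y) e

theorem minor_eq_prod_blocks {A : ℕ → ℕ → ℂ} {b : ℕ → ℕ} (hb : Monotone b)
    (hA : ∀ x < V.card, ∀ e, b (nth V x) ≠ b e → A x e = 0) {N : ℕ} (hN : ∀ e ∈ V, b e < N)
    (hK : K.card = V.card) (h : ∀ x < V.card, b (nth K x) = b (nth V x)) :
    minor A K = ∏ s ∈ Finset.range N,
      minor (dropRows A (V.filter (b · < s)).card) (K.filter (b · = s)) := by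
  rw [minor_label (N := N) hb]
  · refine Finset.prod_congr rfl fun s _ => ?_
    rw [card_filter_label hK h (· < s)]
    rfl
  · intro e he
    obtain ⟨x, hx, rfl⟩ := exists_nth he
    rw [hK] at hx
    rw [h x hx]
    exact hN _ (nth_mem hx)
  · intro x hx e _ hne
    rw [hK] at hx
    rw [h x hx] at hne
    exact hA x hx e hne

/-- A block diagonal matrix has a nonzero minor only if each block receives as many columns as rows.
-/
theorem label_eq_of_minor_ne_zero {A : ℕ → ℕ → ℂ} {b : ℕ → ℕ} (hb : Monotone b)
    (hA : ∀ x < V.card, ∀ e, b (nth V x) ≠ b e → A x e = 0)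
    (hK : K.card = V.card) (h : minor A K ≠ 0) {x : ℕ} (hx : x < V.card) :
    b (nth K x) = b (nth V x) := by
  rw [minor_eq A hK] at h
  have hmono : ∀ J : Finset ℕ, J.card = V.card →
      Monotone fun x : Fin V.card => b (nth J x) := by
    intro J hJ x y hxy
    apply hb
    rcases hxy.lt_or_eq with h' | h'
    · exact (nth_lt_nth h' (hJ.symm ▸ y.2)).le
    · rw [h']
  have := label_eq_of_det_ne_zero (hmono V rfl) (hmono K hK) (fun x y hxy => hA x x.2 _ hxy) h
  exact (congrFun this ⟨x, hx⟩).symm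

/-- The elements of the cone of a pair of rank functions are products over the blocks. -/
theorem exists_blocks_of_mem_cone (hc : L.card = V.card)
    {p : {J // Between L V J} → ℂ} (hp : p ∈ cone L V) :
    ∃ (q : ∀ s : blockStarts L V, {J // Between (block L V L s) (block L V V s) J} → ℂ) (c : ℂ),
      (∀ s : blockStarts L V, q s ∈ cone (block L V L s) (block L V V s)) ∧
      ∀ J, p J = c * ∏ s : blockStarts L V, q s ⟨block L V J.1 s, J.2.block hc s⟩ := by
  obtain ⟨hp0, A, c, hvanish, hpA⟩ := hp
  obtain ⟨⟨I, hI⟩, hpI⟩ := Function.ne_iff.1 hp0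
  rw [hpA] at hpI
  have hIA : minor A I ≠ 0 := right_ne_zero_of_mul hpI
  have hIc : I.card = V.card := hI.card_eq hc
  obtain ⟨-, B, -, hnorm, hminor⟩ := exists_normalized hIc hIA
  -- Normalization makes the matrix block diagonal: an entry joining different blocks would be an
  -- exchange minor at a set excluded by `exists_block_separated`.
  have hB : ∀ x < V.card, ∀ e, lastCut L V (nth V x) ≠ lastCut L V e → B x e = 0 := by
    intro x hx e hne
    rw [← hI.lastCut_nth hc hx] at hne
    rw [← hIc] at hx
    by_cases he : e ∈ I
    · obtain ⟨y, hy, rfl⟩ := exists_nth he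
      rw [hnorm x hx y hy, if_neg]
      rintro rfl
      exact hne rfl
    · by_contra hBe
      have h1 := hnorm.minor_exchange_ne_zero hx he hBe
      have h2 : (insert e (I.erase (nth I x))).card = V.card := by
        rw [card_exchange hx he, hIc]
      have h3 := hvanish _ h2 (exists_block_separated hI hx he hne)
      rw [hminor _ h2] at h3
      exact mul_ne_zero hIA h1 h3
  let N := V.sup (lastCut L V) + (L ∪ V).sup id + 2
  have hN : ∀ e ∈ V, lastCut L V e < N := fun e he => by
    have : lastCut L V e ≤ V.sup (lastCut L V) := Finset.le_sup he
    omega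
  have hSN : blockStarts L V ⊆ Finset.range N := by
    intro s hs
    have := Finset.mem_range.1 (Finset.mem_filter.1 hs).1
    rw [Finset.mem_range]
    omega
  let a : ℕ → ℕ := fun s => (V.filter (lastCut L V · < s)).card
  have hprod : ∀ K : Finset ℕ, K.card = V.card →
      (∀ x < V.card, lastCut L V (nth K x) = lastCut L V (nth V x)) →
      minor B K = ∏ s ∈ Finset.range N, minor (dropRows B (a s)) (block L V K s) :=
    fun K hK h => minor_eq_prod_blocks lastCut_mono hB hN hK h
  have hI1 : ∀ s ∈ Finset.range N, minor (dropRows B (a s)) (block L V I s) ≠ 0 := by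
    have h1 := hprod I hIc fun x hx => hI.lastCut_nth hc hx
    rw [hnorm.minor_eq_one] at h1
    exact Finset.prod_ne_zero_iff.1 (h1 ▸ one_ne_zero)
  refine ⟨fun s K => minor (dropRows B (a s)) K.1,
    c * minor A I * ∏ s ∈ Finset.range N \ blockStarts L V,
      minor (dropRows B (a s)) (block L V V s), fun s => ⟨?_, dropRows B (a s), 1, ?_, ?_⟩, ?_⟩
  · refine Function.ne_iff.2 ⟨⟨block L V I s, hI.block hc s⟩, ?_⟩
    exact hI1 s (hSN s.2)
  · intro K hK hKB
    by_cases hKs : ∀ e ∈ K, lastCut L V e = s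
    -- Replace only the block `s` of `I` by `K`. The minor at the resulting inadmissible set
    -- vanishes, while its factors at the other blocks are those of `I` and do not vanish; so the
    -- factor at `K` does.
    · let I' : Finset ℕ := I.filter (lastCut L V · ≠ s) ∪ K
      have hblock : ∀ s', block L V I' s' = if s' = s then K else block L V I s' := by
        intro s'
        ext e
        simp only [mem_block, I', Finset.mem_union, Finset.mem_filter]
        split_ifs with h
        · subst h
          constructor
          · rintro ⟨⟨-, h1⟩ | h1, h2⟩
            · exact absurd h2 h1
            · exact h1
          · exact fun h1 => ⟨Or.inr h1, hKs e h1⟩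
        · rw [mem_block]
          constructor
          · rintro ⟨⟨h1, -⟩ | h1, h2⟩
            · exact ⟨h1, h2⟩
            · exact absurd (h2.symm.trans (hKs e h1)) h
          · rintro ⟨h1, h2⟩
            exact ⟨Or.inl ⟨h1, fun h3 => h (h2.symm.trans h3)⟩, h2⟩
      have hcards : ∀ s', (block L V I' s').card = (block L V V s').card := by
        intro s'
        rw [hblock]
        split_ifs with h
        · rw [hK, h]
        · exact card_filter_label hIc (fun x hx => hI.lastCut_nth hc hx) (· = s')
      have hI'c : I'.card = V.card := by
        have h1 : I'.card = (I.filter (lastCut L V · ≠ s)).card + K.card := by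
          apply Finset.card_union_of_disjoint
          rw [Finset.disjoint_left]
          intro e he he'
          exact (Finset.mem_filter.1 he).2 (hKs e he')
        have h2 := Finset.card_filter_add_card_filter_not (s := I) (lastCut L V · = s)
        have h3 : (I.filter (lastCut L V · = s)).card = (block L V V s).card :=
          card_filter_label hIc (fun x hx => hI.lastCut_nth hc hx) (· = (s : ℕ))
        rw [h1, hK, ← h3, ← hIc, ← h2, add_comm]
      have hI'B : ¬ Between L V I' := by
        intro h
        have h1 := h.block hc s
        rw [hblock, if_pos rfl] at h1
        exact hKB h1
      have h1 := hvanish I' hI'c hI'B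
      rw [hminor _ hI'c, mul_eq_zero, or_iff_right hIA,
        hprod I' hI'c fun x hx => label_eq_of_card lastCut_mono hcards hx,
        Finset.prod_eq_zero_iff] at h1
      obtain ⟨s', hs', h2⟩ := h1
      rw [hblock] at h2
      split_ifs at h2 with h
      · rwa [h] at h2
      · exact absurd h2 (hI1 s' hs')
    · push Not at hKs
      -- A column of another block is zero in the rows of block `s`.
      obtain ⟨e, he, hes⟩ := hKs
      refine minor_eq_zero_of_col he fun y hy => ?_
      rw [hK] at hy
      obtain ⟨h1, h2⟩ := nth_label lastCut_mono hy
      refine hB _ h1 e ?_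
      rw [h2, (Finset.mem_filter.1 (nth_mem hy)).2]
      exact hes.symm
  · intro K
    rw [one_mul]
  · rintro ⟨J, hJ⟩
    rw [hpA, hminor _ (hJ.card_eq hc), hprod J (hJ.card_eq hc) fun x hx => hJ.lastCut_nth hc hx,
      ← Finset.prod_sdiff hSN, ← Finset.prod_coe_sort (blockStarts L V)]
    have : ∀ s ∈ Finset.range N \ blockStarts L V, block L V J s = block L V V s := by
      intro s hs
      ext e
      rw [mem_block, mem_block]
      refine and_congr_left fun h => ?_
      refine hJ.mem_iff_of_notMem hc ?_
      rw [h]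
      exact (Finset.mem_sdiff.1 hs).2
    rw [Finset.prod_congr rfl fun s hs => by rw [this s hs]]
    ring

theorem minor_const_one {A : ℕ → ℕ → ℂ} (hJ : J.card ≤ 1)
    (hA : ∀ x < J.card, ∀ e ∈ J, A x e = 1) : minor A J = 1 := by
  rcases Nat.le_one_iff_eq_zero_or_eq_one.1 hJ with h | h
  · rw [minor_eq A h, Matrix.det_isEmpty]
  · rw [minor_eq A h, Matrix.det_fin_one, Matrix.of_apply]
    exact hA _ (by rw [h]; exact Nat.one_pos) _ (nth_mem (by rw [h]; exact Nat.one_pos))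

/-- Products of elements of the cones of the blocks lie in the cone of the pair. -/
theorem mem_cone_of_blocks (hc : L.card = V.card)
    (q : ∀ s : blockStarts L V, {J // Between (block L V L s) (block L V V s) J} → ℂ) (c : ℂ)
    (hq : ∀ s : blockStarts L V, q s ∈ cone (block L V L s) (block L V V s)) {p : {J // Between L V J} → ℂ}
    (hp0 : p ≠ 0) (hp : ∀ J, p J = c * ∏ s : blockStarts L V, q s ⟨block L V J.1 s, J.2.block hc s⟩) :
    p ∈ cone L V := by
  choose hq0 A d hA hd using hq
  let a : ℕ → ℕ := fun s => (V.filter (lastCut L V · < s)).card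
  -- Block diagonal matrix assembled from the given ones, whose rows are shifted by the number `a s`
  -- of rows of earlier blocks. At trivial positions the entry 1 makes the minor over that position
  -- equal to 1.
  let B : ℕ → ℕ → ℂ := fun x e =>
    if lastCut L V e = lastCut L V (nth V x) then
      if h : lastCut L V e ∈ blockStarts L V then A ⟨_, h⟩ (x - a (lastCut L V e)) e else 1
    else 0
  have hB : ∀ x < V.card, ∀ e, lastCut L V (nth V x) ≠ lastCut L V e → B x e = 0 :=
    fun x _ e h => if_neg h.symm
  let N := V.sup (lastCut L V) + (L ∪ V).sup id + 2
  have hN : ∀ e ∈ V, lastCut L V e < N := fun e he => by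
    have : lastCut L V e ≤ V.sup (lastCut L V) := Finset.le_sup he
    omega
  have hSN : blockStarts L V ⊆ Finset.range N := by
    intro s hs
    have := Finset.mem_range.1 (Finset.mem_filter.1 hs).1
    rw [Finset.mem_range]
    omega
  have hprod : ∀ K : Finset ℕ, K.card = V.card →
      (∀ x < V.card, lastCut L V (nth K x) = lastCut L V (nth V x)) →
      minor B K = ∏ s : blockStarts L V, minor (A s) (block L V K s) := by
    intro K hK hlabel
    have hcard : ∀ s, (block L V K s).card = (block L V V s).card := fun s =>
      card_filter_label hK hlabel (· = s)
    have hrow : ∀ s, ∀ y < (block L V K s).card, lastCut L V (nth V (a s + y)) = s := by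
      intro s y hy
      rw [hcard] at hy
      rw [(nth_label lastCut_mono hy).2]
      exact (Finset.mem_filter.1 (nth_mem hy)).2
    rw [minor_eq_prod_blocks lastCut_mono hB hN hK hlabel, ← Finset.prod_sdiff hSN,
      Finset.prod_eq_one, one_mul, ← Finset.prod_coe_sort (blockStarts L V)]
    · refine Finset.prod_congr rfl fun s _ => minor_congr fun y hy e he => ?_
      have h1 := (mem_block.1 he).2
      have h2 := hrow s y hy
      change B (a s + y) e = A s y e
      simp only [B]
      rw [if_pos (h1.trans h2.symm), dif_pos (h1.symm ▸ s.2)]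
      have h3 : (⟨lastCut L V e, h1.symm ▸ s.2⟩ : blockStarts L V) = s := Subtype.ext h1
      rw [h3, h1, Nat.add_sub_cancel_left]
    · intro s hs
      have hs' := (Finset.mem_sdiff.1 hs).2
      apply minor_const_one
      · rw [Finset.card_le_one]
        intro e he e' he'
        rw [Finset.mem_filter] at he he'
        have h1 := eq_lastCut_of_notMem hc (e := e) (he.2.symm ▸ hs')
        have h2 := eq_lastCut_of_notMem hc (e := e') (he'.2.symm ▸ hs')
        omega
      · intro y hy e he
        have h1 := (mem_block.1 he).2
        have h2 := hrow s y hy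
        change B (a s + y) e = 1
        simp only [B]
        rw [if_pos (h1.trans h2.symm), dif_neg]
        rwa [h1]
  refine ⟨hp0, B, c * ∏ s, d s, fun K hK hKB => ?_, fun J => ?_⟩
  · by_contra hne
    have hlabel : ∀ x < V.card, lastCut L V (nth K x) = lastCut L V (nth V x) := fun x hx =>
      label_eq_of_minor_ne_zero lastCut_mono hB hK hne hx
    have hcard : ∀ s, (block L V K s).card = (block L V V s).card := fun s =>
      card_filter_label hK hlabel (· = s)
    rw [hprod K hK hlabel, ← ne_eq, Finset.prod_ne_zero_iff] at hne
    refine hKB (between_of_blocks hc (fun s hs => ?_) fun e he => ?_)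
    · by_contra h
      exact hne ⟨s, hs⟩ (Finset.mem_univ _) (hA ⟨s, hs⟩ _ (hcard s) h)
    · have h1 := eq_lastCut_of_notMem hc he
      -- A trivial label belongs to a single position, so the cardinality of its block decides
      -- membership.
      have hmem : ∀ J : Finset ℕ, e ∈ J ↔ 0 < (block L V J (lastCut L V e)).card := by
        intro J
        rw [Finset.card_pos]
        constructor
        · exact fun h => ⟨e, mem_block.2 ⟨h, rfl⟩⟩
        · rintro ⟨e', he'⟩
          have h2 := (mem_block.1 he').2
          rw [← h2] at he
          have h3 := eq_lastCut_of_notMem hc he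
          rw [h1, ← h2, ← h3]
          exact (mem_block.1 he').1
      rw [hmem, hmem, hcard]
  · rw [hp, hprod J.1 (J.2.card_eq hc) fun x hx => J.2.lastCut_nth hc hx, mul_assoc,
      ← Finset.prod_mul_distrib]
    congr 1
    exact Finset.prod_congr rfl fun s _ => hd s _

/-- This is the Segre decomposition: the variety of `L` and `V` is the product of the varieties of
the blocks. -/
theorem coneEquiv_blocks (hc : L.card = V.card) (hLV : ∀ t, rk V t ≤ rk L t) :
    ConeEquiv (cone L V)
      (piCone fun s : blockStarts L V => cone (block L V L s) (block L V V s)) := by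
  refine ConeEquiv.of_maps (blockEquiv hc hLV) (fun p hp => ⟨?_, ?_⟩) ?_
  · intro h
    apply hp.1
    funext J
    have := congrFun h (blockEquiv hc hLV J)
    simpa using this
  · obtain ⟨q, c, hq, hpq⟩ := exists_blocks_of_mem_cone hc hp
    refine ⟨q, c, hq, fun F => ?_⟩
    obtain ⟨J, rfl⟩ := (blockEquiv hc hLV).surjective F
    rw [Function.comp_apply, Equiv.symm_apply_apply, hpq]
    rfl
  · rintro p ⟨hp0, q, c, hq, hpq⟩
    refine mem_cone_of_blocks hc q c hq (fun h => hp0 ?_) fun J => ?_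
    · funext F
      have := congrFun h ((blockEquiv hc hLV).symm F)
      simpa using this
    · rw [Function.comp_apply, hpq]
      rfl

end PosSet

/-! ### Maps of index sets that carry minors to minors -/

namespace PosSet

variable {L V L' V' J K : Finset ℕ}

/-- The maximal minors of `A` vanish off the sets between `V` and `L`. -/
def Supported (L V : Finset ℕ) (A : ℕ → ℕ → ℂ) : Prop :=
  ∀ J, J.card = V.card → ¬ Between L V J → minor A J = 0

/-- The map `φ` sends sets between `V` and `L` to sets between `V'` and `L'`, and it carries
families of minors to families of minors. -/
structure Transports (L V L' V' : Finset ℕ) (φ : Finset ℕ → Finset ℕ) : Prop where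
  between : ∀ J, Between L V J → Between L' V' (φ J)
  exists_minor : ∀ A J₀, Between L V J₀ → minor A J₀ ≠ 0 → Supported L V A →
    ∃ (B : ℕ → ℕ → ℂ) (c : ℂ), c ≠ 0 ∧ Supported L' V' B ∧
      ∀ J, Between L V J → minor B (φ J) = c * minor A J

/-- The constant in `Transports` may depend on the matrix but not on the index set, so the scalar
allowed in `cone` absorbs it. A nonzero point supplies the nonvanishing minor that `exists_minor`
asks for. -/
theorem coneEquiv_of_transports {φ ψ : Finset ℕ → Finset ℕ} (hφ : Transports L V L' V' φ)
    (hψ : Transports L' V' L V ψ) (h1 : ∀ J, Between L V J → ψ (φ J) = J)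
    (h2 : ∀ J, Between L' V' J → φ (ψ J) = J) : ConeEquiv (cone L V) (cone L' V') := by
  have key : ∀ {L V L' V' : Finset ℕ} {φ ψ : Finset ℕ → Finset ℕ}
      (_ : Transports L V L' V' φ) (hψ : Transports L' V' L V ψ)
      (_ : ∀ J, Between L V J → ψ (φ J) = J)
      (_ : ∀ J, Between L' V' J → φ (ψ J) = J) (p : {J // Between L V J} → ℂ)
      (_ : p ∈ cone L V), (fun J : {J // Between L' V' J} => p ⟨ψ J.1, hψ.between _ J.2⟩) ∈
        cone L' V' := by
    intro L V L' V' φ ψ hφ hψ h1 h2 p hp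
    obtain ⟨hp0, A, a, hA, hpA⟩ := hp
    obtain ⟨⟨J₀, hJ₀⟩, hJ₀p⟩ := Function.ne_iff.1 hp0
    obtain ⟨B, c, hc, hB, hBA⟩ := hφ.exists_minor A J₀ hJ₀
      (fun h => hJ₀p (by rw [hpA, h, mul_zero, Pi.zero_apply])) hA
    refine ⟨Function.ne_iff.2 ⟨⟨φ J₀, hφ.between _ hJ₀⟩, ?_⟩, B, a * c⁻¹, hB, fun J => ?_⟩
    · simp only [h1 J₀ hJ₀]
      exact hJ₀p
    · have := hBA _ (hψ.between _ J.2)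
      rw [h2 _ J.2] at this
      change p _ = _
      rw [hpA, this]
      field_simp
  let e : {J // Between L V J} ≃ {J // Between L' V' J} :=
    { toFun := fun J => ⟨φ J.1, hφ.between _ J.2⟩
      invFun := fun J => ⟨ψ J.1, hψ.between _ J.2⟩
      left_inv := fun J => Subtype.ext (h1 _ J.2)
      right_inv := fun J => Subtype.ext (h2 _ J.2) }
  exact ConeEquiv.of_maps e (key hφ hψ h1 h2) (key hψ hφ h2 h1)

/-! ### Translation -/

/-- The translate of a set by `d`. -/
def shift (d : ℕ) (J : Finset ℕ) : Finset ℕ := J.image (d + ·)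

/-- The part of a set that starts at `d`, moved to start at `0`. -/
def unshift (d : ℕ) (J : Finset ℕ) : Finset ℕ := (J.filter (d ≤ ·)).image (· - d)

theorem mem_unshift {d e : ℕ} : e ∈ unshift d J ↔ d + e ∈ J := by
  simp only [unshift, Finset.mem_image, Finset.mem_filter]
  constructor
  · rintro ⟨x, ⟨h1, h2⟩, rfl⟩
    rwa [Nat.add_sub_cancel' h2]
  · intro h
    exact ⟨d + e, ⟨h, by omega⟩, by omega⟩

theorem mem_shift {d e : ℕ} : e ∈ shift d J ↔ d ≤ e ∧ e - d ∈ J := by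
  simp only [shift, Finset.mem_image]
  constructor
  · rintro ⟨x, h, rfl⟩
    exact ⟨by omega, by rwa [Nat.add_sub_cancel_left]⟩
  · rintro ⟨h1, h2⟩
    exact ⟨_, h2, by omega⟩

theorem unshift_shift (d : ℕ) (J : Finset ℕ) : unshift d (shift d J) = J := by
  ext e
  rw [mem_unshift, mem_shift, Nat.add_sub_cancel_left]
  simp

theorem shift_unshift {d : ℕ} (h : ∀ x ∈ J, d ≤ x) : shift d (unshift d J) = J := by
  ext e
  rw [mem_shift, mem_unshift]
  constructor
  · rintro ⟨h1, h2⟩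
    rwa [Nat.add_sub_cancel' h1] at h2
  · exact fun he => ⟨h e he, by rwa [Nat.add_sub_cancel' (h e he)]⟩

theorem card_shift (d : ℕ) (J : Finset ℕ) : (shift d J).card = J.card :=
  Finset.card_image_of_injective _ (add_right_injective d)

theorem rk_shift (d : ℕ) (J : Finset ℕ) (t : ℕ) : rk (shift d J) t = rk J (t - d) := by
  rw [rk_eq_card, rk_eq_card, shift, Finset.filter_image,
    Finset.card_image_of_injective _ (add_right_injective d)]
  congr 1
  ext x
  simp only [Finset.mem_filter]
  exact and_congr_right fun _ => by omega

theorem nth_shift {d x : ℕ} (hx : x < J.card) : nth (shift d J) x = d + nth J x :=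
  (nth_unique (card_shift d J) (f := fun y : Fin J.card => d + nth J y)
    (fun y => Finset.mem_image_of_mem _ (nth_mem y.2))
    (fun _ z h => Nat.add_lt_add_left (nth_lt_nth h z.2) d) ⟨x, hx⟩).symm

theorem between_shift {d : ℕ} : Between (shift d L) (shift d V) (shift d J) ↔ Between L V J := by
  constructor
  · intro h t
    have := h (t + d)
    rwa [rk_shift, rk_shift, rk_shift, Nat.add_sub_cancel] at this
  · intro h t
    rw [rk_shift, rk_shift, rk_shift]
    exact h _

theorem Between.le_of_shift {d : ℕ} (h : Between (shift d L) (shift d V) J) :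
    ∀ x ∈ J, d ≤ x := by
  intro x hx
  by_contra! hlt
  have h1 := (h (x + 1)).2
  rw [rk_shift, Nat.sub_eq_zero_of_le hlt, rk_zero, mem_iff_rk.1 hx] at h1
  omega

theorem minor_shift {d : ℕ} {A B : ℕ → ℕ → ℂ} (h : ∀ x e, B x (d + e) = A x e) :
    minor B (shift d J) = minor A J := by
  rw [minor_eq B (card_shift d J), minor_eq A rfl]
  congr 1
  ext i j
  simp only [Matrix.of_apply]
  rw [nth_shift j.2, h]

theorem coneEquiv_shift (d : ℕ) (L V : Finset ℕ) :
    ConeEquiv (cone L V) (cone (shift d L) (shift d V)) := by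
  refine coneEquiv_of_transports (φ := shift d) (ψ := unshift d)
    ⟨fun J h => between_shift.2 h, fun A J₀ _ _ hA => ?_⟩ ⟨fun J h => ?_, fun A J₀ _ _ hA => ?_⟩
    (fun J _ => unshift_shift d J) fun J h => shift_unshift h.le_of_shift
  -- Zero columns below `d` kill the minors of all sets that are not translates by `d`.
  · let B : ℕ → ℕ → ℂ := fun x e => if d ≤ e then A x (e - d) else 0
    have hB : ∀ x e, B x (d + e) = A x e := by
      intro x e
      simp [B]
    refine ⟨B, 1, one_ne_zero, fun J hJ hJB => ?_, fun J _ => ?_⟩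
    · by_cases hd : ∀ x ∈ J, d ≤ x
      · rw [← shift_unshift hd] at hJ hJB ⊢
        rw [card_shift, card_shift] at hJ
        rw [between_shift] at hJB
        rw [minor_shift hB, hA _ hJ hJB]
      · push Not at hd
        obtain ⟨e, he, hlt⟩ := hd
        exact minor_eq_zero_of_col he fun x _ => if_neg (not_le.2 hlt)
    · rw [minor_shift hB, one_mul]
  · rwa [← between_shift (d := d), shift_unshift h.le_of_shift]
  · have hB : ∀ x e, A x (d + e) = (fun x e => A x (d + e)) x e := fun _ _ => rfl
    refine ⟨fun x e => A x (d + e), 1, one_ne_zero, fun J hJ hJB => ?_, fun J hJ => ?_⟩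
    · rw [← minor_shift hB]
      exact hA _ (by rw [card_shift, card_shift, hJ]) (mt between_shift.1 hJB)
    · rw [← minor_shift hB, shift_unshift hJ.le_of_shift, one_mul]

/-! ### Reflection -/

/-- The reflection of a subset of `{0, …, n - 1}`. -/
def reflect (n : ℕ) (J : Finset ℕ) : Finset ℕ := (Finset.range n).filter (n - 1 - · ∈ J)

theorem mem_reflect {n e : ℕ} : e ∈ reflect n J ↔ e < n ∧ n - 1 - e ∈ J := by
  rw [reflect, Finset.mem_filter, Finset.mem_range]

theorem reflect_subset (n : ℕ) (J : Finset ℕ) : ∀ x ∈ reflect n J, x < n :=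
  fun _ h => (mem_reflect.1 h).1

theorem reflect_reflect {n : ℕ} (h : ∀ x ∈ J, x < n) : reflect n (reflect n J) = J := by
  ext e
  rw [mem_reflect, mem_reflect]
  constructor
  · rintro ⟨h1, -, h3⟩
    rwa [show n - 1 - (n - 1 - e) = e by omega] at h3
  · intro he
    have := h e he
    exact ⟨this, by omega, by rwa [show n - 1 - (n - 1 - e) = e by omega]⟩

theorem card_reflect {n : ℕ} (h : ∀ x ∈ J, x < n) : (reflect n J).card = J.card := by
  refine Finset.card_bij (fun x _ => n - 1 - x) (fun x hx => (mem_reflect.1 hx).2)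
    (fun x hx y hy hxy => ?_) fun y hy => ⟨n - 1 - y, mem_reflect.2 ?_, ?_⟩
  · have := (mem_reflect.1 hx).1
    have := (mem_reflect.1 hy).1
    omega
  · have := h y hy
    exact ⟨by omega, by rwa [show n - 1 - (n - 1 - y) = y by omega]⟩
  · have := h y hy
    omega

theorem rk_reflect_add {n t : ℕ} (h : ∀ x ∈ J, x < n) (ht : t ≤ n) :
    rk (reflect n J) t + rk J (n - t) = J.card := by
  induction t with
  | zero => rw [rk_zero, Nat.sub_zero, rk_of_subset h, zero_add]
  | succ t ih =>
    have h1 := ih (by omega)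
    have h2 := rk_succ J (n - (t + 1))
    rw [show n - (t + 1) + 1 = n - t by omega] at h2
    have h3 : t ∈ reflect n J ↔ n - (t + 1) ∈ J := by
      rw [mem_reflect, show n - 1 - t = n - (t + 1) by omega]
      exact and_iff_right (by omega)
    rw [rk_succ]
    simp only [h3]
    omega

theorem rk_of_le {n t : ℕ} (h : ∀ x ∈ J, x < n) (ht : n ≤ t) : rk J t = rk J n := by
  rw [rk_of_subset h, rk_of_subset fun x hx => (h x hx).trans_le ht]

theorem Between.of_le {n : ℕ} (hL : ∀ x ∈ L, x < n) (hV : ∀ x ∈ V, x < n) (hJ : ∀ x ∈ J, x < n)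
    (h : ∀ t ≤ n, rk V t ≤ rk J t ∧ rk J t ≤ rk L t) : Between L V J := by
  intro t
  rcases le_total t n with ht | ht
  · exact h t ht
  · rw [rk_of_le hL ht, rk_of_le hV ht, rk_of_le hJ ht]
    exact h n le_rfl

theorem Between.reflect {n : ℕ} (hc : L.card = V.card) (hL : ∀ x ∈ L, x < n)
    (hV : ∀ x ∈ V, x < n) (h : Between L V J) :
    Between (reflect n V) (reflect n L) (reflect n J) := by
  have hJ := h.subset hc hV
  refine Between.of_le (reflect_subset n V) (reflect_subset n L) (reflect_subset n J) ?_
  intro t ht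
  have h1 := rk_reflect_add hL ht
  have h2 := rk_reflect_add hV ht
  have h3 := rk_reflect_add hJ ht
  have h4 := h (n - t)
  have h5 := h.card_eq hc
  omega

theorem nth_reflect {n x : ℕ} (h : ∀ y ∈ J, y < n) (hx : x < J.card) :
    nth (PosSet.reflect n J) x = n - 1 - nth J (J.card - 1 - x) := by
  refine (nth_unique (card_reflect h) (f := fun y : Fin J.card => n - 1 - nth J (J.card - 1 - y))
    (fun y => ?_) (fun y z hyz => ?_) ⟨x, hx⟩).symm
  · have h1 : nth J (J.card - 1 - y) ∈ J := nth_mem (by omega)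
    have := h _ h1
    refine mem_reflect.2 ⟨by omega, ?_⟩
    rwa [show n - 1 - (n - 1 - nth J (J.card - 1 - y)) = nth J (J.card - 1 - y) by omega]
  · have hyz' : (y : ℕ) < z := hyz
    have h1 := z.2
    have h2 : nth J (J.card - 1 - z) < nth J (J.card - 1 - y) :=
      nth_lt_nth (by omega) (by omega)
    have := h (nth J (J.card - 1 - y)) (nth_mem (by omega))
    simp only
    omega

/-- Reversing the first `n` columns changes every minor by the sign of the reversal of its `V.card`
columns, which is the same for all sets. Ranks are counted from the other end, so the two bounds
trade places. -/
theorem transports_reflect {n : ℕ} (hc : L.card = V.card) (hL : ∀ x ∈ L, x < n)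
    (hV : ∀ x ∈ V, x < n) :
    Transports L V (reflect n V) (reflect n L) (reflect n) := by
  refine ⟨fun J h => h.reflect hc hL hV, fun A J₀ _ _ hA => ?_⟩
  let B : ℕ → ℕ → ℂ := fun x e => if e < n then A x (n - 1 - e) else 0
  have hminor : ∀ J : Finset ℕ, (∀ x ∈ J, x < n) → J.card = V.card →
      minor B (reflect n J) =
        ((Equiv.Perm.sign (Fin.revPerm (n := V.card)) : ℤ) : ℂ) * minor A J := by
    intro J hJ hJc
    rw [minor_eq B ((card_reflect hJ).trans hJc), minor_eq A hJc, ← Matrix.det_permute']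
    congr 1
    ext i j
    change B i (nth (reflect n J) j) = A i (nth J (Fin.rev j))
    rw [nth_reflect hJ (hJc.symm ▸ j.2), Fin.val_rev, hJc]
    have h1 := j.2
    have h2 := hJ (nth J (V.card - 1 - j)) (nth_mem (by omega))
    simp only [B]
    rw [if_pos (by omega)]
    congr 1
    rw [show V.card - (j + 1 : ℕ) = V.card - 1 - j by omega]
    omega
  refine ⟨B, ((Equiv.Perm.sign (Fin.revPerm (n := V.card)) : ℤ) : ℂ), ?_, fun K hK hKB => ?_,
    fun J hJ => hminor J (hJ.subset hc hV) (hJ.card_eq hc)⟩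
  · rcases Int.units_eq_one_or (Equiv.Perm.sign (Fin.revPerm (n := V.card))) with h | h <;>
      simp [h]
  · by_cases hKn : ∀ x ∈ K, x < n
    · have h1 : (reflect n K).card = V.card := by
        rw [card_reflect hKn, hK, card_reflect hL, hc]
      have h2 : ¬ Between L V (reflect n K) := by
        intro h
        apply hKB
        rw [← reflect_reflect hKn]
        exact h.reflect hc hL hV
      rw [← reflect_reflect hKn, hminor _ (reflect_subset n K) h1, hA _ h1 h2, mul_zero]
    · push Not at hKn
      obtain ⟨e, he, hlt⟩ := hKn
      exact minor_eq_zero_of_col he fun x _ => if_neg (not_lt.2 hlt)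

theorem coneEquiv_reflect {n : ℕ} (hc : L.card = V.card) (hL : ∀ x ∈ L, x < n)
    (hV : ∀ x ∈ V, x < n) :
    ConeEquiv (cone L V) (cone (reflect n V) (reflect n L)) := by
  have hc' : (reflect n V).card = (reflect n L).card := by
    rw [card_reflect hL, card_reflect hV, hc]
  have h := transports_reflect hc' (reflect_subset n V) (reflect_subset n L)
  rw [reflect_reflect hL, reflect_reflect hV] at h
  refine coneEquiv_of_transports (transports_reflect hc hL hV) h
    (fun J hJ => reflect_reflect (hJ.subset hc hV)) fun J hJ => reflect_reflect ?_
  exact hJ.subset hc' (reflect_subset n L)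

end PosSet

namespace PosSet

variable {L V J K : Finset ℕ}

/-! ### Complements -/

/-- The complement of a subset of `{0, …, n - 1}`. -/
def complement (n : ℕ) (J : Finset ℕ) : Finset ℕ := Finset.range n \ J

theorem mem_complement {n e : ℕ} : e ∈ complement n J ↔ e < n ∧ e ∉ J := by
  rw [complement, Finset.mem_sdiff, Finset.mem_range]

theorem complement_subset (n : ℕ) (J : Finset ℕ) : ∀ x ∈ complement n J, x < n :=
  fun _ h => (mem_complement.1 h).1

theorem complement_complement {n : ℕ} (h : ∀ x ∈ J, x < n) :
    complement n (complement n J) = J := by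
  ext e
  rw [mem_complement, mem_complement]
  constructor
  · rintro ⟨h1, h2⟩
    by_contra h3
    exact h2 ⟨h1, h3⟩
  · exact fun he => ⟨h e he, fun h' => h'.2 he⟩

theorem card_add_card_complement {n : ℕ} (h : ∀ x ∈ J, x < n) :
    J.card + (complement n J).card = n := by
  have hsub : J ⊆ Finset.range n := fun x hx => Finset.mem_range.2 (h x hx)
  have := Finset.card_sdiff_add_card_eq_card hsub
  rw [Finset.card_range] at this
  rw [complement]
  omega

theorem rk_add_rk_complement {n t : ℕ} (ht : t ≤ n) : rk J t + rk (complement n J) t = t := by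
  induction t with
  | zero => rw [rk_zero, rk_zero]
  | succ t ih =>
    have h1 := ih (by omega)
    have h2 : t ∈ complement n J ↔ t ∉ J := by
      rw [mem_complement]
      exact and_iff_right (by omega)
    rw [rk_succ, rk_succ]
    by_cases h : t ∈ J <;> simp only [h2, h, not_true, not_false_iff, if_true, if_false] <;> omega

/-- Complementation replaces each rank at `t` by `t` minus that rank, so the bounds trade places. -/
theorem Between.complement {n : ℕ} (h : Between L V J) :
    Between (complement n V) (complement n L) (complement n J) := by
  refine Between.of_le (complement_subset n V) (complement_subset n L) (complement_subset n J) ?_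
  intro t ht
  have h1 := rk_add_rk_complement (J := L) ht
  have h2 := rk_add_rk_complement (J := V) ht
  have h3 := rk_add_rk_complement (J := J) ht
  have h4 := h t
  omega

/-- The enumeration of `{0, …, m + k - 1}` that lists first a set with `m` elements and then its
complement. -/
noncomputable def shuffle {m k : ℕ} (J : Finset ℕ) (hJ : J.card = m)
    (hJn : ∀ x ∈ J, x < m + k) : Fin m ⊕ Fin k ≃ Fin (m + k) :=
  Equiv.ofBijective
    (Sum.elim (fun x => ⟨nth J x, hJn _ (nth_mem (hJ.symm ▸ x.2))⟩)
      fun y => ⟨nth (PosSet.complement (m + k) J) y, complement_subset _ _ _ (nth_mem (by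
        have := card_add_card_complement hJn
        omega))⟩) <| by
    have hk : (PosSet.complement (m + k) J).card = k := by
      have := card_add_card_complement hJn
      omega
    rw [Fintype.bijective_iff_injective_and_card]
    refine ⟨?_, by simp⟩
    rintro (x | x) (y | y) h
    · have := (nth_inj (hJ.symm ▸ x.2) (hJ.symm ▸ y.2)).1 (Fin.mk.inj_iff.1 h)
      rw [Fin.ext this]
    · have h1 : nth J x = nth (PosSet.complement (m + k) J) y := Fin.mk.inj_iff.1 h
      have h2 : nth J x ∈ J := nth_mem (hJ.symm ▸ x.2)
      rw [h1] at h2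
      exact absurd h2 (mem_complement.1 (nth_mem (hk.symm ▸ y.2))).2
    · have h1 : nth (PosSet.complement (m + k) J) x = nth J y := Fin.mk.inj_iff.1 h
      have h2 : nth J y ∈ J := nth_mem (hJ.symm ▸ y.2)
      rw [← h1] at h2
      exact absurd h2 (mem_complement.1 (nth_mem (hk.symm ▸ x.2))).2
    · have := (nth_inj (hk.symm ▸ x.2) (hk.symm ▸ y.2)).1 (Fin.mk.inj_iff.1 h)
      rw [Fin.ext this]

theorem shuffle_inl {m k : ℕ} (hJ : J.card = m) (hJn : ∀ x ∈ J, x < m + k) (x : Fin m) :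
    (shuffle J hJ hJn (Sum.inl x) : ℕ) = nth J x := rfl

theorem shuffle_inr {m k : ℕ} (hJ : J.card = m) (hJn : ∀ x ∈ J, x < m + k) (y : Fin k) :
    (shuffle J hJ hJn (Sum.inr y) : ℕ) = nth (complement (m + k) J) y := rfl

/-- The elements of `J` below the `y`-th element of the complement. -/
theorem rk_nth_complement {n y : ℕ} (hy : y < (complement n J).card) :
    rk J (nth (complement n J) y) + y = nth (complement n J) y := by
  have h := rk_add_rk_complement (J := J) (complement_subset n J _ (nth_mem hy)).le
  rwa [rk_nth hy] at h

/-- Inversions occur only between `J` and its complement. The element `c` at index `y` of the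
complement has `c - y` elements of `J` below it, hence `m - (c - y)` above it, which has the parity
of `m + y + c`. The part depending on `J` is thus a product of signs attached to single columns. -/
theorem sign_shuffle {m k : ℕ} (hJ : J.card = m) (hJn : ∀ x ∈ J, x < m + k) :
    (Equiv.Perm.sign (finSumFinEquiv.symm.trans (shuffle J hJ hJn)) : ℤ) =
      ∏ y : Fin k, (-1) ^ (m + y + nth (complement (m + k) J) y) := by
  have hk : (complement (m + k) J).card = k := by
    have := card_add_card_complement hJn
    omega
  set π : Equiv.Perm (Fin (m + k)) := finSumFinEquiv.symm.trans (shuffle J hJ hJn) with hπ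
  have hl : ∀ x : Fin m, (π (Fin.castAdd k x) : ℕ) = nth J x := by
    intro x
    rw [hπ, Equiv.trans_apply, finSumFinEquiv_symm_apply_castAdd, shuffle_inl]
  have hr : ∀ y : Fin k, (π (Fin.natAdd m y) : ℕ) = nth (complement (m + k) J) y := by
    intro y
    rw [hπ, Equiv.trans_apply, finSumFinEquiv_symm_apply_natAdd, shuffle_inr]
  rw [Equiv.Perm.sign_eq_prod_prod_Iio, Fin.prod_univ_add, Finset.prod_eq_one, one_mul,
    Units.coe_prod]
  · refine Finset.prod_congr rfl fun y _ => ?_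
    have h1 : Finset.Iio (Fin.natAdd m y)
        = Finset.univ.filter (· < Fin.natAdd m y) := by
      ext i
      simp
    rw [h1, Finset.prod_filter, Fin.prod_univ_add]
    have h2 : ∀ z : Fin k, (if Fin.natAdd m z < Fin.natAdd m y then
        (if π (Fin.natAdd m z) < π (Fin.natAdd m y) then (1 : ℤˣ) else -1) else 1) = 1 := by
      intro z
      split_ifs with h3 h4
      · rfl
      · exfalso
        apply h4
        rw [Fin.lt_def, hr, hr]
        exact nth_lt_nth (by simpa using h3) (hk.symm ▸ y.2)
      · rfl
    rw [Finset.prod_congr rfl fun z _ => h2 z, Finset.prod_const_one, mul_one]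
    have h3 : ∀ x : Fin m, (if Fin.castAdd k x < Fin.natAdd m y then
        (if π (Fin.castAdd k x) < π (Fin.natAdd m y) then (1 : ℤˣ) else -1) else 1)
        = if nth J x < nth (complement (m + k) J) y then 1 else -1 := by
      intro x
      rw [if_pos (by rw [Fin.lt_def, Fin.val_castAdd, Fin.val_natAdd]; omega)]
      simp only [Fin.lt_def, hl, hr]
    rw [Finset.prod_congr rfl fun x _ => h3 x, Finset.prod_ite, Finset.prod_const_one, one_mul,
      Finset.prod_const]
    have h4 : (Finset.univ.filter fun x : Fin m =>
        nth J x < nth (complement (m + k) J) y).card + y = nth (complement (m + k) J) y := by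
      have h5 := Grass.card_subtype_nth (· < nth (complement (m + k) J) y) hJ
      rw [Fintype.card_subtype, ← rk_eq_card] at h5
      rw [h5]
      exact rk_nth_complement (hk.symm ▸ y.2)
    have h6 := Finset.card_filter_add_card_filter_not (s := (Finset.univ : Finset (Fin m)))
      (fun x : Fin m => nth J x < nth (complement (m + k) J) y)
    rw [Finset.card_univ, Fintype.card_fin] at h6
    have h7 : m + y + nth (complement (m + k) J) y =
        (Finset.univ.filter fun x : Fin m => ¬ nth J x < nth (complement (m + k) J) y).card
          + 2 * nth (complement (m + k) J) y := by
      omega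
    rw [h7, pow_add, pow_mul]
    simp
  · intro x _
    refine Finset.prod_eq_one fun i hi => if_pos ?_
    rw [Finset.mem_Iio, Fin.lt_def, Fin.val_castAdd] at hi
    obtain ⟨z, rfl⟩ : ∃ z : Fin m, i = Fin.castAdd k z := ⟨⟨i, by omega⟩, rfl⟩
    rw [Fin.lt_def, hl, hl]
    exact nth_lt_nth hi (hJ.symm ▸ x.2)

/-- Complementary minors of inverse matrices. -/
theorem det_submatrix_of_mul_eq_one {m k : ℕ} {M : Matrix (Fin m ⊕ Fin k) (Fin (m + k)) ℂ}
    {N : Matrix (Fin (m + k)) (Fin m ⊕ Fin k) ℂ} (h : M * N = 1)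
    (σ : Fin m ⊕ Fin k ≃ Fin (m + k)) :
    (M.submatrix id σ).det * (N.submatrix (σ ∘ Sum.inr) Sum.inr).det =
      (M.submatrix Sum.inl (σ ∘ Sum.inl)).det := by
  have h1 : M.submatrix id σ * N.submatrix σ id = 1 := by
    rw [Matrix.submatrix_mul_equiv, h, Matrix.submatrix_id_id]
  set P := M.submatrix id σ with hP
  set Q := N.submatrix σ id with hQ
  have h2 := h1
  rw [← Matrix.fromBlocks_toBlocks P, ← Matrix.fromBlocks_toBlocks Q,
    Matrix.fromBlocks_multiply, ← Matrix.fromBlocks_one, Matrix.fromBlocks_inj] at h2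
  -- Jacobi's identity: replacing the first block column of `Q` by that of the identity, the product
  -- with `P` is block triangular, and determinants can be compared.
  have h3 : P * Matrix.fromBlocks 1 Q.toBlocks₁₂ 0 Q.toBlocks₂₂ =
      Matrix.fromBlocks P.toBlocks₁₁ 0 P.toBlocks₂₁ 1 := by
    conv_lhs => rw [← Matrix.fromBlocks_toBlocks P]
    rw [Matrix.fromBlocks_multiply, h2.2.1, h2.2.2.2]
    simp
  have h4 := congrArg Matrix.det h3
  rw [Matrix.det_mul, Matrix.det_fromBlocks_zero₂₁, Matrix.det_fromBlocks_zero₁₂, Matrix.det_one,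
    Matrix.det_one, one_mul, mul_one] at h4
  exact h4

/-- The maximal minors of a matrix are up to sign the complementary maximal minors of a matrix
whose rows span the annihilator. -/
theorem exists_complement_minor {m k : ℕ} {A : ℕ → ℕ → ℂ} {I : Finset ℕ} (hI : I.card = m)
    (hIn : ∀ x ∈ I, x < m + k) (hA : minor A I ≠ 0) :
    ∃ (B : ℕ → ℕ → ℂ) (c : ℂ), c ≠ 0 ∧ (∀ x e, m + k ≤ e → B x e = 0) ∧
      ∀ J : Finset ℕ, J.card = m → (∀ x ∈ J, x < m + k) →
        minor B (complement (m + k) J) = c * minor A J := by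
  let σ₀ := shuffle I hI hIn
  -- Complete the rows of `A` to an invertible matrix by the coordinate rows at the complement of
  -- `I`. The last `k` columns of its inverse `N` are annihilated by the rows of `A`.
  let M : Matrix (Fin m ⊕ Fin k) (Fin (m + k)) ℂ := Matrix.of fun r e =>
    Sum.elim (fun x : Fin m => A x e) (fun y => if e = σ₀ (Sum.inr y) then 1 else 0) r
  have hM₀ : (M.submatrix id σ₀).det = minor A I := by
    rw [← Matrix.fromBlocks_toBlocks (M.submatrix id σ₀)]
    have h21 : (M.submatrix id σ₀).toBlocks₂₁ = 0 := by
      ext i j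
      simp [Matrix.toBlocks₂₁, M]
    have h22 : (M.submatrix id σ₀).toBlocks₂₂ = 1 := by
      ext i j
      simp [Matrix.toBlocks₂₂, M, Matrix.one_apply, eq_comm]
    rw [h21, h22, Matrix.det_fromBlocks_zero₂₁, Matrix.det_one, mul_one, minor_eq A hI]
    rfl
  have hunit : IsUnit (M.submatrix id σ₀).det := by
    rw [hM₀]
    exact isUnit_iff_ne_zero.2 hA
  let N : Matrix (Fin (m + k)) (Fin m ⊕ Fin k) ℂ := (M.submatrix id σ₀)⁻¹.submatrix σ₀.symm id
  have hMN : M * N = 1 := by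
    have h1 : M = (M.submatrix id σ₀).submatrix id σ₀.symm := by
      rw [Matrix.submatrix_submatrix]
      simp
    rw [h1]
    simp only [N]
    rw [Matrix.submatrix_mul_equiv, Matrix.mul_nonsing_inv _ hunit, Matrix.submatrix_id_id]
  let D : ℂ := (M.submatrix finSumFinEquiv.symm id).det
  have hsign : ∀ (J : Finset ℕ) (hJ : J.card = m) (hJn : ∀ x ∈ J, x < m + k),
      (M.submatrix id (shuffle J hJ hJn)).det =
        (∏ y : Fin k, (-1) ^ (m + y + nth (complement (m + k) J) y)) * D := by
    intro J hJ hJn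
    rw [← Matrix.det_submatrix_equiv_self finSumFinEquiv.symm, Matrix.submatrix_submatrix]
    have h1 : M.submatrix (id ∘ finSumFinEquiv.symm)
        (shuffle J hJ hJn ∘ finSumFinEquiv.symm) = (M.submatrix finSumFinEquiv.symm id).submatrix
          id (finSumFinEquiv.symm.trans (shuffle J hJ hJn)) := rfl
    rw [h1, Matrix.det_permute', sign_shuffle hJ hJn]
    push_cast
    rfl
  have hD : D ≠ 0 := by
    intro h
    have := hsign I hI hIn
    rw [h, mul_zero] at this
    exact hA (hM₀ ▸ this)
  -- The factor `(-1) ^ e` cancels the part of the sign in `sign_shuffle` that depends on `J`; the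
  -- remaining factors go into the constant.
  let B : ℕ → ℕ → ℂ := fun y e =>
    if h : e < m + k ∧ y < k then (-1) ^ e * N ⟨e, h.1⟩ (Sum.inr ⟨y, h.2⟩) else 0
  refine ⟨B, (∏ y : Fin k, (-1) ^ (m + y : ℕ)) * D⁻¹, ?_, fun x e he => ?_, fun J hJ hJn => ?_⟩
  · refine mul_ne_zero (Finset.prod_ne_zero_iff.2 fun y _ => ?_) (inv_ne_zero hD)
    exact pow_ne_zero _ (neg_ne_zero.2 one_ne_zero)
  · exact dif_neg fun h => absurd h.1 (not_lt.2 he)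
  · have hk : (complement (m + k) J).card = k := by
      have := card_add_card_complement hJn
      omega
    set σ := shuffle J hJ hJn with hσ
    have h1 := det_submatrix_of_mul_eq_one hMN σ
    rw [hsign J hJ hJn] at h1
    have h2 : (M.submatrix Sum.inl (σ ∘ Sum.inl)).det = minor A J := by
      rw [minor_eq A hJ]
      rfl
    rw [h2] at h1
    have h3 : minor B (complement (m + k) J) =
        (∏ y : Fin k, (-1) ^ nth (complement (m + k) J) y) *
          (N.submatrix (σ ∘ Sum.inr) Sum.inr).det := by
      rw [minor_eq B hk, ← Matrix.det_transpose (N.submatrix _ _), ← Matrix.det_mul_row]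
      congr 1
      ext i j
      change B i (nth (complement (m + k) J) j) = _ * N (σ (Sum.inr j)) (Sum.inr i)
      simp only [B]
      rw [dif_pos ⟨complement_subset _ _ _ (nth_mem (hk.symm ▸ j.2)), i.2⟩]
      rfl
    rw [h3, ← h1]
    simp only [pow_add, Finset.prod_mul_distrib]
    have h4 : ∀ f : Fin k → ℕ, (∏ y, (-1 : ℂ) ^ f y) * ∏ y, (-1 : ℂ) ^ f y = 1 := by
      intro f
      rw [← Finset.prod_mul_distrib]
      refine Finset.prod_eq_one fun y _ => ?_
      rw [← mul_pow]
      simp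
    have h5 := h4 fun _ => m
    have h6 := h4 fun y => y
    field_simp
    -- Only squares of signs are left, and these are 1 by `h5` and `h6`.
    linear_combination
      -((∏ y : Fin k, (-1 : ℂ) ^ nth (complement (m + k) J) y) *
          (N.submatrix (σ ∘ Sum.inr) Sum.inr).det) *
        ((∏ y : Fin k, (-1 : ℂ) ^ (y : ℕ)) * (∏ y : Fin k, (-1 : ℂ) ^ (y : ℕ)) * h5 + h6)

/-- This is the duality that sends a subspace to its annihilator; the nonvanishing minor guarantees
full rank. -/
theorem transports_complement {n : ℕ} (hc : L.card = V.card) (hL : ∀ x ∈ L, x < n)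
    (hV : ∀ x ∈ V, x < n) :
    Transports L V (complement n V) (complement n L) (complement n) := by
  refine ⟨fun J h => h.complement, fun A I hI hA0 hA => ?_⟩
  have hkn := card_add_card_complement hV
  obtain ⟨B, c, hc0, hB, hBA⟩ := exists_complement_minor (k := (complement n V).card)
    (hI.card_eq hc) (by rw [hkn]; exact hI.subset hc hV) hA0
  rw [hkn] at hB hBA
  refine ⟨B, c, hc0, fun K hK hKB => ?_, fun J hJ => hBA J (hJ.card_eq hc) (hJ.subset hc hV)⟩
  by_cases hKn : ∀ x ∈ K, x < n
  · have h1 : (complement n K).card = V.card := by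
      have h2 := card_add_card_complement hKn
      have h3 := card_add_card_complement hL
      omega
    have h2 : ¬ Between L V (complement n K) := by
      intro h
      apply hKB
      rw [← complement_complement hKn]
      exact h.complement
    rw [← complement_complement hKn, hBA _ h1 (complement_subset n K), hA _ h1 h2, mul_zero]
  · push Not at hKn
    obtain ⟨e, he, hlt⟩ := hKn
    exact minor_eq_zero_of_col he fun x _ => hB x e hlt

theorem coneEquiv_complement {n : ℕ} (hc : L.card = V.card) (hL : ∀ x ∈ L, x < n)
    (hV : ∀ x ∈ V, x < n) :
    ConeEquiv (cone L V) (cone (complement n V) (complement n L)) := by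
  have hc' : (complement n V).card = (complement n L).card := by
    have h2 := card_add_card_complement hV
    have h3 := card_add_card_complement hL
    omega
  have h := transports_complement hc' (complement_subset n V) (complement_subset n L)
  rw [complement_complement hL, complement_complement hV] at h
  refine coneEquiv_of_transports (transports_complement hc hL hV) h
    (fun J hJ => complement_complement (hJ.subset hc hV)) fun J hJ => complement_complement ?_
  exact hJ.subset hc' (complement_subset n L)

end PosSet

/-! ### Rigidity of convex connected sets of boxes -/

namespace PlanarPoset

/-- A convex embedding of a poset into the plane with the product order. -/
structure IsConvexEmbedding {X : Type*} [PartialOrder X] (ι : X → ℤ × ℤ) : Prop where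
  le_iff : ∀ x y, x ≤ y ↔ ι x ≤ ι y
  convex : ∀ x y z, ι x ≤ z → z ≤ ι y → ∃ w, ι w = z

variable {X Y : Type*} [PartialOrder X] [PartialOrder Y] {ι : X → ℤ × ℤ} {κ : Y → ℤ × ℤ}

theorem IsConvexEmbedding.injective (hι : IsConvexEmbedding ι) : Function.Injective ι :=
  fun x y h => le_antisymm ((hι.le_iff x y).2 h.le) ((hι.le_iff y x).2 h.ge)

/-- The point reflection turns the opposite order into the product order again, so opposite
components fall under the same rigidity theorem. -/
theorem IsConvexEmbedding.neg (hι : IsConvexEmbedding ι) :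
    IsConvexEmbedding fun x : Xᵒᵈ => -ι (OrderDual.ofDual x) where
  le_iff x y := by
    rw [neg_le_neg_iff, ← hι.le_iff]
    exact OrderDual.ofDual_le_ofDual.symm
  convex x y z h1 h2 := by
    obtain ⟨w, hw⟩ := hι.convex (OrderDual.ofDual y) (OrderDual.ofDual x) (-z)
      (by rw [le_neg]; exact h2) (by rw [neg_le]; exact h1)
    exact ⟨OrderDual.toDual w, by simp [hw]⟩

/-- The unit steps to the right and down. -/
def IsStep (e : ℤ × ℤ) : Prop := e = (0, 1) ∨ e = (1, 0)

theorem IsStep.eq_swap {e f : ℤ × ℤ} (he : IsStep e) (hf : IsStep f) (h : f ≠ e) :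
    f = e.swap := by
  rcases he with rfl | rfl <;> rcases hf with rfl | rfl <;> simp_all

theorem IsStep.swap_ne {e : ℤ × ℤ} (he : IsStep e) : e.swap ≠ e := by
  rcases he with rfl | rfl <;> simp

theorem IsStep.nonneg {e : ℤ × ℤ} (he : IsStep e) : 0 ≤ e := by
  rcases he with rfl | rfl <;> simp [Prod.le_def]

theorem IsStep.ne_zero {e : ℤ × ℤ} (he : IsStep e) : e ≠ 0 := by
  rcases he with rfl | rfl <;> simp [Prod.ext_iff]

theorem IsStep.eq_or_eq {e a z : ℤ × ℤ} (he : IsStep e) (h1 : a ≤ z) (h2 : z ≤ a + e) :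
    z = a ∨ z = a + e := by
  obtain ⟨a1, a2⟩ := a
  obtain ⟨z1, z2⟩ := z
  simp only [Prod.le_def, Prod.fst_add, Prod.snd_add] at h1 h2
  rcases he with rfl | rfl <;> simp only [Prod.mk_add_mk, Prod.mk.injEq] <;> simp at h1 h2 <;>
    omega

theorem IsStep.eq_or_eq_or_eq {e a z : ℤ × ℤ} (he : IsStep e) (h1 : a ≤ z) (h2 : z ≤ a + e + e) :
    z = a ∨ z = a + e ∨ z = a + e + e := by
  obtain ⟨a1, a2⟩ := a
  obtain ⟨z1, z2⟩ := z
  simp only [Prod.le_def, Prod.fst_add, Prod.snd_add] at h1 h2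
  rcases he with rfl | rfl <;> simp only [Prod.mk_add_mk, Prod.mk.injEq] <;> simp at h1 h2 <;>
    omega

theorem exists_step {a b : ℤ × ℤ} (h : a ≤ b) (hne : a ≠ b) :
    ∃ e, IsStep e ∧ a + e ≤ b := by
  obtain ⟨a1, a2⟩ := a
  obtain ⟨b1, b2⟩ := b
  simp only [Prod.mk_le_mk] at h
  by_cases h1 : a1 = b1
  · refine ⟨(0, 1), Or.inl rfl, ?_⟩
    have h2 : a2 ≠ b2 := fun h2 => hne (by rw [h1, h2])
    simp only [Prod.mk_add_mk, Prod.mk_le_mk]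
    omega
  · refine ⟨(1, 0), Or.inr rfl, ?_⟩
    simp only [Prod.mk_add_mk, Prod.mk_le_mk]
    omega

/-- An equivalence relation that contains all pairs of adjacent elements of a connected poset is
the full relation. -/
theorem IsConvexEmbedding.connected (hι : IsConvexEmbedding ι)
    (hconn : ∀ x y : X, Relation.EqvGen (· ≤ ·) x y) {R : X → X → Prop} (hR : Equivalence R)
    (hstep : ∀ x y e, IsStep e → ι y = ι x + e → R x y) (x y : X) : R x y := by
  -- Induction on the ℓ¹ distance of comparable elements; convexity supplies the intermediate boxes
  -- of a lattice path.
  have hle : ∀ n : ℕ, ∀ x y : X, x ≤ y →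
      ((ι y).1 - (ι x).1 + ((ι y).2 - (ι x).2)).toNat = n → R x y := by
    intro n
    induction n with
    | zero =>
      intro x y hxy hn
      have h1 := (hι.le_iff x y).1 hxy
      rw [Prod.le_def] at h1
      have : ι x = ι y := Prod.ext (by omega) (by omega)
      rw [hι.injective this]
      exact hR.refl y
    | succ n ih =>
      intro x y hxy hn
      have h1 := (hι.le_iff x y).1 hxy
      have hne : ι x ≠ ι y := by
        intro h
        rw [h] at hn
        simp at hn
      obtain ⟨e, he, hey⟩ := exists_step h1 hne
      obtain ⟨w, hw⟩ := hι.convex x y (ι x + e) (le_add_of_nonneg_right he.nonneg) hey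
      refine hR.trans (hstep x w e he hw) (ih w y ((hι.le_iff w y).2 (hw ▸ hey)) ?_)
      rw [hw]
      rcases he with rfl | rfl <;> simp only [Prod.fst_add, Prod.snd_add] <;> omega
  have := hconn x y
  induction this with
  | rel x y h => exact hle _ x y h rfl
  | refl x => exact hR.refl x
  | symm x y _ ih => exact hR.symm ih
  | trans x y z _ _ ih1 ih2 => exact hR.trans ih1 ih2

/-- The interval spanned by a unit step has only two elements. A unit step from `κ (g x)` towards `κ
(g y)` lands, by convexity, on the image of an element of that interval, which must be `y`. -/
theorem exists_step_map (hι : IsConvexEmbedding ι) (hκ : IsConvexEmbedding κ) (g : X ≃o Y)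
    {x y : X} {e : ℤ × ℤ} (he : IsStep e) (hy : ι y = ι x + e) :
    ∃ f, IsStep f ∧ κ (g y) = κ (g x) + f := by
  have hxy : x ≤ y := by
    rw [hι.le_iff, hy]
    exact le_add_of_nonneg_right he.nonneg
  have hne : κ (g x) ≠ κ (g y) := by
    intro h
    have := g.injective (hκ.injective h)
    subst this
    exact he.ne_zero (by simpa using hy)
  have hle : κ (g x) ≤ κ (g y) := (hκ.le_iff _ _).1 (g.le_iff_le.2 hxy)
  obtain ⟨f, hf, hfy⟩ := exists_step hle hne
  obtain ⟨w, hw⟩ := hκ.convex (g x) (g y) (κ (g x) + f) (le_add_of_nonneg_right hf.nonneg) hfy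
  obtain ⟨z, rfl⟩ := g.surjective w
  refine ⟨f, hf, ?_⟩
  have h1 : ι x ≤ ι z := by
    rw [← hι.le_iff, ← g.le_iff_le, hκ.le_iff, hw]
    exact le_add_of_nonneg_right hf.nonneg
  have h2 : ι z ≤ ι x + e := by
    rw [← hy, ← hι.le_iff, ← g.le_iff_le, hκ.le_iff, hw]
    exact hfy
  rcases he.eq_or_eq h1 h2 with h | h
  · rw [hι.injective h] at hw
    exact absurd (by simpa using hw) hf.ne_zero
  · rw [← hy] at h
    rw [← hι.injective h, hw]

/-- Two equal steps span an interval that is a chain of three elements. If the images turned,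
convexity would put the fourth corner of the square into the image interval. -/
theorem step_eq_of_eq (hι : IsConvexEmbedding ι) (hκ : IsConvexEmbedding κ) (g : X ≃o Y)
    {w x y : X} {e f f' : ℤ × ℤ} (he : IsStep e) (hf : IsStep f) (hf' : IsStep f')
    (hx : ι x = ι w + e) (hy : ι y = ι x + e)
    (hgx : κ (g x) = κ (g w) + f) (hgy : κ (g y) = κ (g x) + f') : f = f' := by
  by_contra hne
  have hgy' : κ (g y) = κ (g w) + f' + f := by rw [hgy, hgx, add_right_comm]
  obtain ⟨c, hc⟩ := hκ.convex (g w) (g y) (κ (g w) + f') (le_add_of_nonneg_right hf'.nonneg)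
    (by rw [hgy']; exact le_add_of_nonneg_right hf.nonneg)
  obtain ⟨z, rfl⟩ := g.surjective c
  have h1 : ι w ≤ ι z := by
    rw [← hι.le_iff, ← g.le_iff_le, hκ.le_iff, hc]
    exact le_add_of_nonneg_right hf'.nonneg
  have h2 : ι z ≤ ι w + e + e := by
    rw [← hx, ← hy, ← hι.le_iff, ← g.le_iff_le, hκ.le_iff, hc, hgy']
    exact le_add_of_nonneg_right hf.nonneg
  rcases he.eq_or_eq_or_eq h1 h2 with h | h | h
  · rw [hι.injective h] at hc
    exact hf'.ne_zero (by simpa using hc)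
  · rw [← hx] at h
    rw [hι.injective h, hgx] at hc
    exact hne (add_left_cancel hc)
  · rw [← hx, ← hy] at h
    rw [hι.injective h, hgy'] at hc
    exact hf.ne_zero (by simpa using hc)

/-- The edge between `x` and `y`, which goes in the direction `e`, is mapped to an edge in the
direction `f`. -/
def EdgeMap (ι : X → ℤ × ℤ) (κ : Y → ℤ × ℤ) (g : X ≃o Y) (x y : X) (e f : ℤ × ℤ) : Prop :=
  IsStep e ∧ IsStep f ∧ ((ι y = ι x + e ∧ κ (g y) = κ (g x) + f) ∨
    (ι x = ι y + e ∧ κ (g x) = κ (g y) + f))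

theorem EdgeMap.symm {g : X ≃o Y} {x y : X} {e f : ℤ × ℤ} (h : EdgeMap ι κ g x y e f) :
    EdgeMap ι κ g y x e f :=
  ⟨h.1, h.2.1, h.2.2.symm⟩

theorem two_step_iff (hι : IsConvexEmbedding ι) (hκ : IsConvexEmbedding κ) {g : X ≃o Y}
    {w x y : X} {e e' f f' : ℤ × ℤ} (he : IsStep e) (he' : IsStep e') (hf : IsStep f)
    (hf' : IsStep f') (hx : ι x = ι w + e) (hy : ι y = ι x + e')
    (hgx : κ (g x) = κ (g w) + f) (hgy : κ (g y) = κ (g x) + f') : e = e' ↔ f = f' := by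
  constructor
  · rintro rfl
    exact step_eq_of_eq hι hκ g he hf hf' hx hy hgx hgy
  · rintro rfl
    exact step_eq_of_eq hκ hι g.symm (w := g w) (x := g x) (y := g y) hf he he' hgx hgy
      (by simpa using hx) (by simpa using hy)

/-- Two edges both leaving or both entering `x` have the same direction iff they are the same edge.
One entering and one leaving edge form a path of length two, and `two_step_iff` decides whether it
is straight. -/
theorem EdgeMap.eq_iff (hι : IsConvexEmbedding ι) (hκ : IsConvexEmbedding κ) {g : X ≃o Y}
    {x y z : X} {e f e' f' : ℤ × ℤ} (h : EdgeMap ι κ g x y e f) (h' : EdgeMap ι κ g x z e' f') :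
    e = e' ↔ f = f' := by
  obtain ⟨he, hf, h⟩ := h
  obtain ⟨he', hf', h'⟩ := h'
  rcases h with ⟨h1, h2⟩ | ⟨h1, h2⟩ <;> rcases h' with ⟨h3, h4⟩ | ⟨h3, h4⟩
  · constructor
    · rintro rfl
      have := hι.injective (h1.trans h3.symm)
      subst this
      exact add_left_cancel (h2.symm.trans h4)
    · rintro rfl
      have := g.injective (hκ.injective (h2.trans h4.symm))
      subst this
      exact add_left_cancel (h1.symm.trans h3)
  · rw [eq_comm, two_step_iff hι hκ he' he hf' hf h3 h1 h4 h2, eq_comm]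
  · exact two_step_iff hι hκ he he' hf hf' h1 h3 h2 h4
  · constructor
    · rintro rfl
      have := hι.injective (add_right_cancel (h1.symm.trans h3))
      subst this
      exact add_left_cancel (h2.symm.trans h4)
    · rintro rfl
      have := g.injective (hκ.injective (add_right_cancel (h2.symm.trans h4)))
      subst this
      exact add_left_cancel (h1.symm.trans h3)

/-- All edges at `x` are mapped by the linear map `T`. -/
def LocallyMaps (ι : X → ℤ × ℤ) (κ : Y → ℤ × ℤ) (g : X ≃o Y) (T : ℤ × ℤ → ℤ × ℤ) (x : X) : Prop :=
  ∀ y e f, EdgeMap ι κ g x y e f → f = T e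

/-- There are only two directions, and equality of directions is preserved at `x`. So one edge whose
direction is swapped forces all edges at `x` to be swapped. -/
theorem locallyMaps_id_or_swap (hι : IsConvexEmbedding ι) (hκ : IsConvexEmbedding κ) (g : X ≃o Y)
    (x : X) : LocallyMaps ι κ g id x ∨ LocallyMaps ι κ g Prod.swap x := by
  by_cases h : LocallyMaps ι κ g id x
  · exact Or.inl h
  · right
    simp only [LocallyMaps, not_forall] at h
    obtain ⟨y, e, f, hy, hne⟩ := h
    have hf := hy.1.eq_swap hy.2.1 hne
    intro z e' f' hz
    have hiff := hy.eq_iff hι hκ hz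
    by_cases hee : e = e'
    · rw [← hiff.1 hee, ← hee, hf]
    · have h1 := hy.1.eq_swap hz.1 (Ne.symm hee)
      have h2 := hy.2.1.eq_swap hz.2.1 (Ne.symm (mt hiff.2 hee))
      rw [h2, h1, hf]

/-- An isomorphism of connected posets that are convex in the plane is a translation, possibly
composed with the transposition. -/
theorem exists_affine (hι : IsConvexEmbedding ι) (hκ : IsConvexEmbedding κ) (g : X ≃o Y)
    (hconn : ∀ x y : X, Relation.EqvGen (· ≤ ·) x y) :
    ∃ T : ℤ × ℤ → ℤ × ℤ, (T = id ∨ T = Prod.swap) ∧ ∃ c, ∀ x, κ (g x) = T (ι x) + c := by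
  rcases isEmpty_or_nonempty X with hX | ⟨⟨x₀⟩⟩
  · exact ⟨id, Or.inl rfl, 0, fun x => hX.elim x⟩
  have hT : ∃ T : ℤ × ℤ → ℤ × ℤ, (T = id ∨ T = Prod.swap) ∧ LocallyMaps ι κ g T x₀ := by
    rcases locallyMaps_id_or_swap hι hκ g x₀ with h | h
    · exact ⟨_, Or.inl rfl, h⟩
    · exact ⟨_, Or.inr rfl, h⟩
  obtain ⟨T, hT, hx₀⟩ := hT
  -- Two neighbours share an edge, which tells the identity from the swap, so both have the same
  -- type.
  have hprop : ∀ x y e f, EdgeMap ι κ g x y e f → LocallyMaps ι κ g T x →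
      LocallyMaps ι κ g T y := by
    intro x y e f hxy hx
    have h1 := hx y e f hxy
    have h2 := hxy.1.swap_ne
    rcases locallyMaps_id_or_swap hι hκ g y with h | h <;> have h3 := h x e f hxy.symm <;>
      rcases hT with rfl | rfl
    · exact h
    · exact absurd (h1.symm.trans h3) h2
    · exact absurd (h3.symm.trans h1) h2
    · exact h
  have hall : ∀ x, LocallyMaps ι κ g T x := by
    intro x
    refine (hι.connected hconn (R := fun x y => LocallyMaps ι κ g T x ↔ LocallyMaps ι κ g T y)
      ⟨fun _ => Iff.rfl, fun h => h.symm, fun h h' => h.trans h'⟩ ?_ x₀ x).1 hx₀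
    intro x y e he hy
    obtain ⟨f, hf, hgy⟩ := exists_step_map hι hκ g he hy
    have hxy : EdgeMap ι κ g x y e f := ⟨he, hf, Or.inl ⟨hy, hgy⟩⟩
    exact ⟨hprop x y e f hxy, hprop y x e f hxy.symm⟩
  have hadd : ∀ a b, T (a + b) = T a + T b := by
    rcases hT with rfl | rfl
    · exact fun _ _ => rfl
    · exact fun _ _ => rfl
  refine ⟨T, hT, κ (g x₀) - T (ι x₀), fun x => ?_⟩
  have h1 := hι.connected hconn (R := fun x y => κ (g x) - T (ι x) = κ (g y) - T (ι y))
    ⟨fun _ => rfl, fun h => h.symm, fun h h' => h.trans h'⟩ ?_ x₀ x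
  · rw [h1]
    abel
  · intro x y e he hy
    obtain ⟨f, hf, hgy⟩ := exists_step_map hι hκ g he hy
    have h2 := hall x y e f ⟨he, hf, Or.inl ⟨hy, hgy⟩⟩
    rw [hy, hgy, hadd, h2]
    abel

end PlanarPoset

namespace PosSet

variable {L V L' V' J K : Finset ℕ} {n n' : ℕ}

/-! ### Comparison of blocks -/

/-- The sets `V` and `L` in `{0, …, n - 1}` have the same rank only at `0` and from `n` on. -/
structure IsBlock (n : ℕ) (L V : Finset ℕ) : Prop where
  two_le : 2 ≤ n
  lt_left : ∀ x ∈ L, x < n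
  lt_right : ∀ x ∈ V, x < n
  card_eq : L.card = V.card
  rk_lt : ∀ u, 0 < u → u < n → rk V u < rk L u

/-- Ranks grow by at most one per step, and the strict inequality at the first and last interior
positions leaves no freedom. These values fix the unknown offset when two blocks are compared. -/
theorem IsBlock.endpoints (h : IsBlock n L V) :
    rk V 1 = 0 ∧ rk L 1 = 1 ∧ rk V (n - 1) + 1 = V.card ∧ rk L (n - 1) = V.card := by
  have h2 := h.two_le
  have h3 := h.rk_lt 1 one_pos (by omega)
  have h4 := h.rk_lt (n - 1) (by omega) (by omega)
  have h5 := rk_step L 0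
  have h6 := rk_step V (n - 1)
  have h7 := rk_step L (n - 1)
  have h8 := rk_zero L
  have h9 := rk_of_subset h.lt_left
  have h10 := rk_of_subset h.lt_right
  have h11 := h.card_eq
  rw [zero_add] at h5
  rw [show n - 1 + 1 = n by omega] at h6 h7
  omega

theorem ext_rk_of_lt (hJ : ∀ x ∈ J, x < n) (hK : ∀ x ∈ K, x < n) (hc : J.card = K.card)
    (h : ∀ u, 0 < u → u < n → rk J u = rk K u) : J = K := by
  apply ext_rk
  intro t
  rcases Nat.eq_zero_or_pos t with rfl | ht
  · rw [rk_zero, rk_zero]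
  · rcases lt_or_ge t n with htn | htn
    · exact h t ht htn
    · rw [rk_of_le hJ htn, rk_of_le hK htn, rk_of_subset hJ, rk_of_subset hK, hc]

/-- The lattice points between the graphs of the rank functions. -/
def IsPoint (n : ℕ) (L V : Finset ℕ) (u h : ℤ) : Prop :=
  0 < u ∧ u < n ∧ (rk V u.toNat : ℤ) ≤ h ∧ h < rk L u.toNat

theorem IsBlock.point_right (hB : IsBlock n L V) {w : ℕ} (h0 : 0 < w) (hw : w < n) :
    IsPoint n L V w (rk V w) := by
  have := hB.rk_lt w h0 hw
  refine ⟨by omega, by omega, ?_, ?_⟩ <;> rw [Int.toNat_natCast]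
  omega

theorem IsBlock.point_left (hB : IsBlock n L V) {w : ℕ} (h0 : 0 < w) (hw : w < n) :
    IsPoint n L V w (rk L w - 1) := by
  have := hB.rk_lt w h0 hw
  refine ⟨by omega, by omega, ?_, ?_⟩ <;> rw [Int.toNat_natCast] <;> omega

/-- Each position strictly between `0` and `n` carries a point, so the two ranges force `δ = 0` and
`n' = n`. The lowest and highest points then match the rank functions up to `η`, and the endpoint
values give `η = 0`; the blocks are equal. -/
theorem coneEquiv_of_translation (hB : IsBlock n L V) (hB' : IsBlock n' L' V') {δ η : ℤ}
    (h : ∀ u h, IsPoint n L V u h → IsPoint n' L' V' (u + δ) (h + η))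
    (h' : ∀ u' h', IsPoint n' L' V' u' h' → ∃ u h, IsPoint n L V u h ∧ u' = u + δ ∧ h' = h + η) :
    ConeEquiv (cone L V) (cone L' V') := by
  have hn := hB.two_le
  have hn' := hB'.two_le
  obtain ⟨a1, -⟩ := h _ _ (hB.point_right one_pos hn)
  obtain ⟨-, a2, -⟩ := h _ _ (hB.point_right (w := n - 1) (by omega) (by omega))
  obtain ⟨u1, -, ⟨b1, b1', -⟩, c1, -⟩ := h' _ _ (hB'.point_right one_pos hn')
  obtain ⟨u2, -, ⟨b2, b2', -⟩, c2, -⟩ :=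
    h' _ _ (hB'.point_right (w := n' - 1) (by omega) (by omega))
  obtain rfl : δ = 0 := by omega
  obtain rfl : n' = n := by omega
  have key : ∀ w, 0 < w → w < n' →
      (rk V' w : ℤ) = rk V w + η ∧ (rk L' w : ℤ) = rk L w + η := by
    intro w h0 hw
    obtain ⟨-, -, d1, -⟩ := h _ _ (hB.point_right h0 hw)
    obtain ⟨-, -, -, d2⟩ := h _ _ (hB.point_left h0 hw)
    obtain ⟨u1, k1, ⟨-, -, e1, -⟩, e1', e1''⟩ := h' _ _ (hB'.point_right h0 hw)
    obtain ⟨u2, k2, ⟨-, -, -, e2⟩, e2', e2''⟩ := h' _ _ (hB'.point_left h0 hw)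
    obtain rfl : u1 = w := by omega
    obtain rfl : u2 = w := by omega
    rw [add_zero] at d1 d2
    rw [Int.toNat_natCast] at d1 d2 e1 e2
    omega
  have p := hB.endpoints
  have p' := hB'.endpoints
  have k1 := key 1 one_pos hn
  have k2 := key (n' - 1) (by omega) (by omega)
  have c := hB.card_eq
  have c' := hB'.card_eq
  have hV : V = V' := ext_rk_of_lt hB.lt_right hB'.lt_right (by omega) fun u h0 hu => by
    have := key u h0 hu
    omega
  have hL : L = L' := ext_rk_of_lt hB.lt_left hB'.lt_left (by omega) fun u h0 hu => by
    have := key u h0 hu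
    omega
  rw [hV, hL]
  exact ConeEquiv.refl _

/-- The map `h ↦ u - h + η` exchanges lowest and highest points, so `rk V' u = u - rk L u` once the
endpoints fix `η = -1`. This is the rank function of the complement of `L`. -/
theorem coneEquiv_of_antitransposition (hB : IsBlock n L V) (hB' : IsBlock n' L' V') {δ η : ℤ}
    (h : ∀ u h, IsPoint n L V u h → IsPoint n' L' V' (u + δ) (u - h + η))
    (h' : ∀ u' h', IsPoint n' L' V' u' h' →
      ∃ u h, IsPoint n L V u h ∧ u' = u + δ ∧ h' = u - h + η) :
    ConeEquiv (cone L V) (cone L' V') := by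
  have hn := hB.two_le
  have hn' := hB'.two_le
  obtain ⟨a1, -⟩ := h _ _ (hB.point_right one_pos hn)
  obtain ⟨-, a2, -⟩ := h _ _ (hB.point_right (w := n - 1) (by omega) (by omega))
  obtain ⟨u1, -, ⟨b1, b1', -⟩, c1, -⟩ := h' _ _ (hB'.point_right one_pos hn')
  obtain ⟨u2, -, ⟨b2, b2', -⟩, c2, -⟩ :=
    h' _ _ (hB'.point_right (w := n' - 1) (by omega) (by omega))
  obtain rfl : δ = 0 := by omega
  obtain rfl : n' = n := by omega
  have key : ∀ w, 0 < w → w < n' →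
      (rk V' w : ℤ) = w + η + 1 - rk L w ∧ (rk L' w : ℤ) = w + η + 1 - rk V w := by
    intro w h0 hw
    obtain ⟨-, -, -, d1⟩ := h _ _ (hB.point_right h0 hw)
    obtain ⟨-, -, d2, -⟩ := h _ _ (hB.point_left h0 hw)
    obtain ⟨u1, k1, ⟨-, -, -, e1⟩, e1', e1''⟩ := h' _ _ (hB'.point_right h0 hw)
    obtain ⟨u2, k2, ⟨-, -, e2, -⟩, e2', e2''⟩ := h' _ _ (hB'.point_left h0 hw)
    obtain rfl : u1 = w := by omega
    obtain rfl : u2 = w := by omega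
    rw [add_zero] at d1 d2
    rw [Int.toNat_natCast] at d1 d2 e1 e2
    omega
  have p := hB.endpoints
  have p' := hB'.endpoints
  have k1 := key 1 one_pos hn
  have k2 := key (n' - 1) (by omega) (by omega)
  have c := hB.card_eq
  have c' := hB'.card_eq
  have cL := card_add_card_complement hB.lt_left
  have cV := card_add_card_complement hB.lt_right
  have hV : complement n' L = V' :=
    ext_rk_of_lt (complement_subset _ _) hB'.lt_right (by omega) fun u h0 hu => by
      have := key u h0 hu
      have := rk_add_rk_complement (J := L) hu.le
      omega
  have hL : complement n' V = L' :=
    ext_rk_of_lt (complement_subset _ _) hB'.lt_left (by omega) fun u h0 hu => by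
      have := key u h0 hu
      have := rk_add_rk_complement (J := V) hu.le
      omega
  rw [← hV, ← hL]
  exact coneEquiv_complement hB.card_eq hB.lt_left hB.lt_right

/-- Here positions are reversed, `δ = n`, and lowest and highest points are exchanged; this
identifies the second block with the reflection of the first. -/
theorem coneEquiv_of_rotation (hB : IsBlock n L V) (hB' : IsBlock n' L' V') {δ η : ℤ}
    (h : ∀ u h, IsPoint n L V u h → IsPoint n' L' V' (-u + δ) (-h + η))
    (h' : ∀ u' h', IsPoint n' L' V' u' h' →
      ∃ u h, IsPoint n L V u h ∧ u' = -u + δ ∧ h' = -h + η) :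
    ConeEquiv (cone L V) (cone L' V') := by
  have hn := hB.two_le
  have hn' := hB'.two_le
  obtain ⟨-, a1, -⟩ := h _ _ (hB.point_right one_pos hn)
  obtain ⟨a2, -⟩ := h _ _ (hB.point_right (w := n - 1) (by omega) (by omega))
  obtain ⟨u1, -, ⟨b1, b1', -⟩, c1, -⟩ := h' _ _ (hB'.point_right one_pos hn')
  obtain ⟨u2, -, ⟨b2, b2', -⟩, c2, -⟩ :=
    h' _ _ (hB'.point_right (w := n' - 1) (by omega) (by omega))
  obtain rfl : δ = n := by omega
  obtain rfl : n' = n := by omega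
  have key : ∀ w, 0 < w → w < n' →
      (rk V' (n' - w) : ℤ) = η + 1 - rk L w ∧ (rk L' (n' - w) : ℤ) = η + 1 - rk V w := by
    intro w h0 hw
    have hw' : (-(w : ℤ) + n').toNat = n' - w := by omega
    obtain ⟨-, -, -, d1⟩ := h _ _ (hB.point_right h0 hw)
    obtain ⟨-, -, d2, -⟩ := h _ _ (hB.point_left h0 hw)
    obtain ⟨u1, k1, ⟨-, -, -, e1⟩, e1', e1''⟩ :=
      h' _ _ (hB'.point_right (w := n' - w) (by omega) (by omega))
    obtain ⟨u2, k2, ⟨-, -, e2, -⟩, e2', e2''⟩ :=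
      h' _ _ (hB'.point_left (w := n' - w) (by omega) (by omega))
    obtain rfl : u1 = w := by omega
    obtain rfl : u2 = w := by omega
    rw [hw'] at d1 d2
    rw [Int.toNat_natCast] at e1 e2
    omega
  have p := hB.endpoints
  have p' := hB'.endpoints
  have k1 := key 1 one_pos hn
  have k2 := key (n' - 1) (by omega) (by omega)
  rw [show n' - (n' - 1) = 1 by omega] at k2
  have c := hB.card_eq
  have c' := hB'.card_eq
  have cL := card_reflect hB.lt_left
  have cV := card_reflect hB.lt_right
  have hV : reflect n' L = V' :=
    ext_rk_of_lt (reflect_subset _ _) hB'.lt_right (by omega) fun u h0 hu => by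
      have h1 := key (n' - u) (by omega) (by omega)
      rw [show n' - (n' - u) = u by omega] at h1
      have := rk_reflect_add hB.lt_left hu.le
      omega
  have hL : reflect n' V = L' :=
    ext_rk_of_lt (reflect_subset _ _) hB'.lt_left (by omega) fun u h0 hu => by
      have h1 := key (n' - u) (by omega) (by omega)
      rw [show n' - (n' - u) = u by omega] at h1
      have := rk_reflect_add hB.lt_right hu.le
      omega
  rw [← hV, ← hL]
  exact coneEquiv_reflect hB.card_eq hB.lt_left hB.lt_right

/-- The transposition is the rotation composed with the antitransposition, and accordingly
complement and reflection are composed. Each exchanges `L` and `V`, so together they keep the roles.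
-/
theorem coneEquiv_of_transposition (hB : IsBlock n L V) (hB' : IsBlock n' L' V') {δ η : ℤ}
    (h : ∀ u h, IsPoint n L V u h → IsPoint n' L' V' (-u + δ) (h - u + η))
    (h' : ∀ u' h', IsPoint n' L' V' u' h' →
      ∃ u h, IsPoint n L V u h ∧ u' = -u + δ ∧ h' = h - u + η) :
    ConeEquiv (cone L V) (cone L' V') := by
  have hn := hB.two_le
  have hn' := hB'.two_le
  obtain ⟨-, a1, -⟩ := h _ _ (hB.point_right one_pos hn)
  obtain ⟨a2, -⟩ := h _ _ (hB.point_right (w := n - 1) (by omega) (by omega))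
  obtain ⟨u1, -, ⟨b1, b1', -⟩, c1, -⟩ := h' _ _ (hB'.point_right one_pos hn')
  obtain ⟨u2, -, ⟨b2, b2', -⟩, c2, -⟩ :=
    h' _ _ (hB'.point_right (w := n' - 1) (by omega) (by omega))
  obtain rfl : δ = n := by omega
  obtain rfl : n' = n := by omega
  have key : ∀ w, 0 < w → w < n' →
      (rk V' (n' - w) : ℤ) = rk V w - w + η ∧ (rk L' (n' - w) : ℤ) = rk L w - w + η := by
    intro w h0 hw
    have hw' : (-(w : ℤ) + n').toNat = n' - w := by omega
    obtain ⟨-, -, d1, -⟩ := h _ _ (hB.point_right h0 hw)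
    obtain ⟨-, -, -, d2⟩ := h _ _ (hB.point_left h0 hw)
    obtain ⟨u1, k1, ⟨-, -, e1, -⟩, e1', e1''⟩ :=
      h' _ _ (hB'.point_right (w := n' - w) (by omega) (by omega))
    obtain ⟨u2, k2, ⟨-, -, -, e2⟩, e2', e2''⟩ :=
      h' _ _ (hB'.point_left (w := n' - w) (by omega) (by omega))
    obtain rfl : u1 = w := by omega
    obtain rfl : u2 = w := by omega
    rw [hw'] at d1 d2
    rw [Int.toNat_natCast] at e1 e2
    omega
  have p := hB.endpoints
  have p' := hB'.endpoints
  have k1 := key 1 one_pos hn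
  have k2 := key (n' - 1) (by omega) (by omega)
  rw [show n' - (n' - 1) = 1 by omega] at k2
  have c := hB.card_eq
  have c' := hB'.card_eq
  have cL := card_add_card_complement hB.lt_left
  have cV := card_add_card_complement hB.lt_right
  have cL' := card_reflect (complement_subset n' L)
  have cV' := card_reflect (complement_subset n' V)
  have hV : reflect n' (complement n' V) = V' :=
    ext_rk_of_lt (reflect_subset _ _) hB'.lt_right (by omega) fun u h0 hu => by
      have h1 := key (n' - u) (by omega) (by omega)
      rw [show n' - (n' - u) = u by omega] at h1
      have := rk_reflect_add (complement_subset n' V) hu.le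
      have := rk_add_rk_complement (J := V) (Nat.sub_le n' u)
      omega
  have hL : reflect n' (complement n' L) = L' :=
    ext_rk_of_lt (reflect_subset _ _) hB'.lt_left (by omega) fun u h0 hu => by
      have h1 := key (n' - u) (by omega) (by omega)
      rw [show n' - (n' - u) = u by omega] at h1
      have := rk_reflect_add (complement_subset n' L) hu.le
      have := rk_add_rk_complement (J := L) (Nat.sub_le n' u)
      omega
  rw [← hV, ← hL]
  exact (coneEquiv_complement hB.card_eq hB.lt_left hB.lt_right).trans
    (coneEquiv_reflect (by omega) (complement_subset _ _) (complement_subset _ _))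

/-! ### The blocks of a pair of rank functions -/

/-- The block that starts at `s`, moved to start at `0`. -/
def window (L V J : Finset ℕ) (s : ℕ) : Finset ℕ := unshift s (block L V J s)

theorem le_of_mem_block {s e : ℕ} (h : e ∈ block L V J s) : s ≤ e :=
  (mem_block.1 h).2 ▸ lastCut_le e

theorem coneEquiv_window (L V : Finset ℕ) (s : ℕ) :
    ConeEquiv (cone (block L V L s) (block L V V s)) (cone (window L V L s) (window L V V s)) := by
  have := coneEquiv_shift s (window L V L s) (window L V V s)
  rw [window, window, shift_unshift fun _ => le_of_mem_block,
    shift_unshift fun _ => le_of_mem_block] at this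
  exact this.symm

theorem rk_window {s u : ℕ} (h : lastCut L V (s + u) = s) :
    rk J s + rk (window L V J s) u = rk J (s + u) := by
  rw [rk_lastCut_add (L := L) (V := V) (J := J) (s + u), h]
  congr 1
  conv_rhs => rw [← shift_unshift (J := block L V J s) fun _ => le_of_mem_block]
  rw [rk_shift, Nat.add_sub_cancel_left]
  rfl

/-- The length is the distance from `s` to the next cut, which exists because all large positions
are cuts. It is at least 2 because `s + 1` is not a cut. -/
theorem exists_isBlock_window (hc : L.card = V.card) (hLV : ∀ t, rk V t ≤ rk L t) {s : ℕ}
    (hs : s ∈ blockStarts L V) :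
    ∃ n, IsBlock n (window L V L s) (window L V V s) ∧
      ∀ t, lastCut L V t = s ↔ s ≤ t ∧ t < s + n := by
  obtain ⟨hs1, hs2⟩ := (mem_blockStarts hc).1 hs
  have hex : ∃ t, s < t ∧ Cut L V t := by
    obtain ⟨N, hN⟩ := exists_bound (L ∪ V)
    refine ⟨N + s + 1, by omega, ?_⟩
    rw [Cut, rk_of_subset fun x hx => ?_, rk_of_subset fun x hx => ?_, hc]
    · have := hN x (by simp [hx])
      omega
    · have := hN x (by simp [hx])
      omega
  classical
  obtain ⟨he1, he2⟩ := Nat.find_spec hex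
  have hmin := fun t => Nat.find_min hex (m := t)
  set e := Nat.find hex with he
  have hlast : ∀ t, lastCut L V t = s ↔ s ≤ t ∧ t < e := by
    intro t
    constructor
    · intro h
      refine ⟨h ▸ lastCut_le t, ?_⟩
      by_contra! h'
      have := he2.le_lastCut h'
      omega
    · rintro ⟨h1, h2⟩
      have h3 := hs1.le_lastCut h1
      by_contra hne
      exact hmin (lastCut L V t) ((lastCut_le t).trans_lt h2)
        ⟨lt_of_le_of_ne h3 (Ne.symm hne), cut_lastCut t⟩
  have hlt : ∀ J, ∀ x ∈ window L V J s, x < e - s := by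
    intro J x hx
    rw [window, mem_unshift, mem_block, hlast] at hx
    omega
  have hL : Between L V L := fun t => ⟨hLV t, le_rfl⟩
  have hcard : ∀ J, (window L V J s).card = (block L V J s).card := by
    intro J
    rw [← card_shift s, window, shift_unshift fun _ => le_of_mem_block]
  refine ⟨e - s, ⟨?_, hlt L, hlt V, ?_, fun u h0 hu => ?_⟩, fun t => ?_⟩
  · by_contra! h
    exact hs2 ((show e = s + 1 by omega) ▸ he2)
  · rw [hcard, hcard]
    exact card_filter_label hc (fun x hx => hL.lastCut_nth hc hx) (· = s)
  · have h1 : lastCut L V (s + u) = s := (hlast _).2 (by omega)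
    have h2 := rk_window (J := L) h1
    have h3 := rk_window (J := V) h1
    have h4 : rk L s = rk V s := hs1
    have h5 := hLV (s + u)
    have h6 : rk L (s + u) ≠ rk V (s + u) := by
      intro h
      have : Cut L V (s + u) := h
      rw [this.lastCut_eq] at h1
      omega
    omega
  · rw [hlast]
    omega

end PosSet

/-! ### Boxes, components and blocks -/

namespace SkewDiagram

open PosSet PlanarPoset PosetComponents

variable {m k : ℕ}

/-- The upper boundary path of a skew diagram. -/
abbrev innerSteps (θ : SkewDiagram m k) : Finset ℕ := Grass.stepSet m θ.inner

/-- The lower boundary path of a skew diagram. -/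
abbrev outerSteps (θ : SkewDiagram m k) : Finset ℕ := Grass.stepSet m θ.outer

variable (θ : SkewDiagram m k)

theorem card_steps : θ.innerSteps.card = θ.outerSteps.card := by
  rw [Grass.card_stepSet, Grass.card_stepSet]

theorem rk_outer_le_inner (t : ℕ) : rk θ.outerSteps t ≤ rk θ.innerSteps t := by
  rw [Grass.rk_stepSet_eq, Grass.rk_stepSet_eq]
  refine Finset.card_le_card fun i hi => ?_
  rw [Finset.mem_filter] at hi ⊢
  refine ⟨hi.1, lt_of_le_of_lt ?_ hi.2⟩
  have : θ.inner.rowLen i ≤ θ.outer.rowLen i := by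
    by_contra! h
    have h1 := θ.inner_le_outer (YoungDiagram.mem_iff_lt_rowLen.2 h)
    exact lt_irrefl _ (YoungDiagram.mem_iff_lt_rowLen.1 h1)
  omega

/-- This is the dictionary between boxes and ranks: on diagonal `t = j + m - i`, the boxes of the
skew diagram are the `h = m - 1 - i` with `rk outerSteps t ≤ h < rk innerSteps t`. -/
theorem mem_iff_rk_le (μ : YoungDiagram) {i j : ℕ} (hi : i < m) :
    (i, j) ∈ μ ↔ rk (Grass.stepSet m μ) (j + m - i) ≤ m - 1 - i := by
  rw [YoungDiagram.mem_iff_lt_rowLen, Grass.rk_stepSet_le_iff μ hi]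
  omega

variable {θ}

theorem Box.row_lt (x : θ.Box) : x.1.1 < m := by
  have := θ.outer_le_rectangle ((YoungDiagram.mem_cells _).2 x.2.1)
  rw [Finset.mem_product, Finset.mem_range] at this
  exact this.1

/-- The diagonal of a box. -/
def Box.diag (x : θ.Box) : ℕ := x.1.2 + m - x.1.1

theorem Box.rk_le (x : θ.Box) : rk θ.outerSteps x.diag ≤ m - 1 - x.1.1 :=
  (mem_iff_rk_le θ.outer x.row_lt).1 x.2.1

theorem Box.lt_rk (x : θ.Box) : m - 1 - x.1.1 < rk θ.innerSteps x.diag :=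
  not_le.1 (mt (mem_iff_rk_le θ.inner x.row_lt).2 x.2.2)

theorem Box.not_cut (x : θ.Box) : ¬ Cut θ.innerSteps θ.outerSteps x.diag := by
  have h1 := x.rk_le
  have h2 := x.lt_rk
  rw [Cut]
  omega

theorem rk_le_self (J : Finset ℕ) (t : ℕ) : rk J t ≤ t := Nat.count_le _

theorem exists_box {t h : ℕ} (h1 : rk θ.outerSteps t ≤ h) (h2 : h < rk θ.innerSteps t) :
    ∃ x : θ.Box, x.diag = t ∧ x.1.1 + 1 + h = m := by
  have h3 : rk θ.innerSteps t ≤ m := (rk_le_card _ _).trans_eq (Grass.card_stepSet _ _)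
  -- From `h < rk innerSteps t ≤ t` the column `t - (h + 1)` is a genuine difference.
  have h4 := rk_le_self θ.innerSteps t
  obtain ⟨i, hi⟩ : ∃ i, i + 1 + h = m := ⟨m - 1 - h, by omega⟩
  have him : i < m := by omega
  have hd : t - (h + 1) + m - i = t := by omega
  refine ⟨⟨(i, t - (h + 1)), ?_, ?_⟩, hd, hi⟩
  · rw [mem_iff_rk_le θ.outer him, hd]
    exact h1.trans (show h ≤ m - 1 - i by omega)
  · rw [mem_iff_rk_le θ.inner him, hd]
    exact not_le.2 (lt_of_le_of_lt (show m - 1 - i ≤ h by omega) h2)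

/-- The position of a box. -/
def Box.pos (x : θ.Box) : ℤ × ℤ := (x.1.1, x.1.2)

theorem Box.exists_between {x y : θ.Box} {i j : ℕ} (h1 : x.1.1 ≤ i) (h2 : x.1.2 ≤ j)
    (h3 : i ≤ y.1.1) (h4 : j ≤ y.1.2) : ∃ w : θ.Box, w.1 = (i, j) :=
  ⟨⟨(i, j), YoungDiagram.up_left_mem _ h3 h4 y.2.1,
    fun h => x.2.2 (YoungDiagram.up_left_mem _ h1 h2 h)⟩, rfl⟩

theorem Box.le_of_coord_le : ∀ (d : ℕ) (x y : θ.Box), x.1.1 ≤ y.1.1 → x.1.2 ≤ y.1.2 →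
    (y.1.1 - x.1.1) + (y.1.2 - x.1.2) = d → x ≤ y := by
  intro d
  induction d with
  | zero =>
    intro x y h1 h2 h3
    have : x = y := Subtype.ext (Prod.ext (by omega) (by omega))
    rw [this]
  | succ d ih =>
    intro x y h1 h2 h3
    by_cases h : x.1.1 = y.1.1
    · obtain ⟨w, hw⟩ := Box.exists_between (x := x) (y := y) (i := x.1.1) (j := x.1.2 + 1)
        le_rfl (by omega) h1 (by omega)
      have hxw : x ≤ w := Relation.ReflTransGen.single (Or.inl (by rw [hw]; exact ⟨rfl, rfl⟩))
      exact hxw.trans (ih w y (by rw [hw]; exact h1) (by rw [hw]; simp only; omega)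
        (by rw [hw]; simp only; omega))
    · obtain ⟨w, hw⟩ := Box.exists_between (x := x) (y := y) (i := x.1.1 + 1) (j := x.1.2)
        (by omega) le_rfl (by omega) h2
      have hxw : x ≤ w := Relation.ReflTransGen.single (Or.inr (by rw [hw]; exact ⟨rfl, rfl⟩))
      exact hxw.trans (ih w y (by rw [hw]; simp only; omega) (by rw [hw]; exact h2)
        (by rw [hw]; simp only; omega))

theorem Box.le_iff (x y : θ.Box) : x ≤ y ↔ x.1.1 ≤ y.1.1 ∧ x.1.2 ≤ y.1.2 :=
  ⟨fun h => Box.le_of_reflTransGen h, fun h => Box.le_of_coord_le _ x y h.1 h.2 rfl⟩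

theorem isConvexEmbedding_pos : IsConvexEmbedding (Box.pos : θ.Box → ℤ × ℤ) where
  le_iff x y := by
    rw [Box.le_iff, Box.pos, Box.pos, Prod.mk_le_mk, Nat.cast_le, Nat.cast_le]
  convex x y z h1 h2 := by
    rw [Box.pos, Prod.le_def] at h1 h2
    obtain ⟨w, hw⟩ := Box.exists_between (x := x) (y := y) (i := z.1.toNat) (j := z.2.toNat)
      (by omega) (by omega) (by omega) (by omega)
    refine ⟨w, ?_⟩
    rw [Box.pos, hw]
    exact Prod.ext (by simp only; omega) (by simp only; omega)

theorem componentOf_eq_of_le {P : Type*} [PartialOrder P] {x y : P} (h : x ≤ y) :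
    componentOf x = componentOf y :=
  Quotient.sound (s := PosetComponents.setoid P) (Relation.EqvGen.rel x y h)

/-- A box between two boxes of a component is comparable to them and so belongs to it. -/
theorem isConvexEmbedding_component (c : Component θ.Box) :
    IsConvexEmbedding fun x : Elements c => x.1.pos where
  le_iff x y := isConvexEmbedding_pos.le_iff x.1 y.1
  convex x y z h1 h2 := by
    obtain ⟨w, hw⟩ := isConvexEmbedding_pos.convex x.1 y.1 z h1 h2
    have hxw : x.1 ≤ w := (isConvexEmbedding_pos.le_iff _ _).2 (hw.symm ▸ h1)
    exact ⟨⟨w, (componentOf_eq_of_le hxw).symm.trans x.2⟩, hw⟩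

theorem component_connected {P : Type*} [PartialOrder P] (c : Component P) (x y : Elements c) :
    Relation.EqvGen (· ≤ ·) x y := by
  have key : ∀ x y : P, Relation.EqvGen (· ≤ ·) x y →
      ∀ (hx : componentOf x = c) (hy : componentOf y = c),
        Relation.EqvGen (· ≤ ·) (⟨x, hx⟩ : Elements c) ⟨y, hy⟩ := by
    intro x y h
    induction h with
    | rel x y h => exact fun hx hy => Relation.EqvGen.rel _ _ h
    | refl x => exact fun hx hy => Relation.EqvGen.refl _
    | symm x y _ ih => exact fun hx hy => Relation.EqvGen.symm _ _ (ih hy hx)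
    | trans x y z h1 _ ih1 ih2 =>
      intro hx hz
      have hy : componentOf y = c := by
        rw [← hx]
        exact (Quotient.sound (s := PosetComponents.setoid P) h1).symm
      exact Relation.EqvGen.trans _ _ _ (ih1 hx hy) (ih2 hy hz)
  exact key x.1 y.1 (Quotient.exact (s := PosetComponents.setoid P) (x.2.trans y.2.symm)) x.2 y.2

theorem eqvGen_dual {P : Type*} [PartialOrder P] {x y : P} (h : Relation.EqvGen (· ≤ ·) x y) :
    Relation.EqvGen (· ≤ ·) (OrderDual.toDual x) (OrderDual.toDual y) := by
  induction h with
  | rel x y h => exact Relation.EqvGen.symm _ _ (Relation.EqvGen.rel _ _ h)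
  | refl x => exact Relation.EqvGen.refl _
  | symm x y _ ih => exact Relation.EqvGen.symm _ _ ih
  | trans x y z _ _ ih1 ih2 => exact Relation.EqvGen.trans _ _ _ ih1 ih2

/-- The start of the block that contains the diagonal of a box. -/
def Box.start (x : θ.Box) : ℕ := lastCut θ.innerSteps θ.outerSteps x.diag

theorem Box.start_mem (x : θ.Box) : x.start ∈ blockStarts θ.innerSteps θ.outerSteps := by
  rw [mem_blockStarts θ.card_steps]
  refine ⟨cut_lastCut _, fun h => ?_⟩
  have h1 : x.start ≤ x.diag := lastCut_le _
  have h2 : x.start ≠ x.diag := fun h' => x.not_cut (h' ▸ cut_lastCut _)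
  have h3 : x.start + 1 ≤ x.start := h.le_lastCut (by omega)
  omega

theorem lastCut_succ_of_not_cut {L V : Finset ℕ} {t : ℕ} (h : ¬ Cut L V (t + 1)) :
    lastCut L V (t + 1) = lastCut L V t :=
  Nat.findGreatest_of_not h

/-- A covering relation moves to a neighbouring diagonal, and neither diagonal is a cut because both
contain a box. -/
theorem Box.start_eq_of_le {x y : θ.Box} (h : x ≤ y) : x.start = y.start := by
  induction h with
  | refl => rfl
  | @tail y z _ hc ih =>
    rw [ih]
    have h1 := y.row_lt
    have h2 := z.row_lt
    rcases hc with ⟨h3, h4⟩ | ⟨h3, h4⟩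
    · have h5 : z.diag = y.diag + 1 := by
        rw [Box.diag, Box.diag]
        omega
      have h6 := z.not_cut
      rw [Box.start, Box.start, h5]
      rw [h5] at h6
      exact (lastCut_succ_of_not_cut h6).symm
    · have h5 : y.diag = z.diag + 1 := by
        rw [Box.diag, Box.diag]
        omega
      have h6 := y.not_cut
      rw [Box.start, Box.start, h5]
      rw [h5] at h6
      exact lastCut_succ_of_not_cut h6

theorem componentOf_eq_of_diag_eq {x y : θ.Box} (h : x.diag = y.diag) :
    componentOf x = componentOf y := by
  have h1 := x.row_lt
  have h2 := y.row_lt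
  rw [Box.diag, Box.diag] at h
  rcases le_total x.1.1 y.1.1 with h3 | h3
  · exact componentOf_eq_of_le ((Box.le_iff x y).2 ⟨h3, by omega⟩)
  · exact (componentOf_eq_of_le ((Box.le_iff y x).2 ⟨h3, by omega⟩)).symm

/-- Start from the top box of diagonal `t`. If the inner path has no vertical step at `t`, its right
neighbour is in the diagram; otherwise the box above it is. -/
theorem exists_adjacent_boxes {t : ℕ} (h : ¬ Cut θ.innerSteps θ.outerSteps t)
    (h' : ¬ Cut θ.innerSteps θ.outerSteps (t + 1)) :
    ∃ x y : θ.Box, x.diag = t ∧ y.diag = t + 1 ∧ componentOf x = componentOf y := by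
  rw [Cut] at h h'
  have h1 := θ.rk_outer_le_inner t
  have h2 := θ.rk_outer_le_inner (t + 1)
  obtain ⟨x, hx, hxm⟩ := exists_box (θ := θ) (t := t) (h := rk θ.innerSteps t - 1)
    (by omega) (by omega)
  have hxr := x.row_lt
  rcases rk_step θ.innerSteps t with h3 | h3
  · obtain ⟨y, hy, hym⟩ := exists_box (θ := θ) (t := t + 1) (h := rk θ.innerSteps t - 1)
      (by omega) (by omega)
    refine ⟨x, y, hx, hy, componentOf_eq_of_le ((Box.le_iff x y).2 ?_)⟩
    rw [Box.diag] at hx hy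
    omega
  · have h4 := rk_step θ.outerSteps t
    obtain ⟨y, hy, hym⟩ := exists_box (θ := θ) (t := t + 1) (h := rk θ.innerSteps t)
      (by omega) (by omega)
    refine ⟨x, y, hx, hy, (componentOf_eq_of_le ((Box.le_iff y x).2 ?_)).symm⟩
    rw [Box.diag] at hx hy
    omega

/-- With a common last cut, all diagonals from that of `x` to that of `y` are nonempty; boxes on one
diagonal are comparable, and adjacent diagonals are linked by `exists_adjacent_boxes`. -/
theorem componentOf_eq_of_start_eq : ∀ (d : ℕ) (x y : θ.Box), x.start = y.start →
    y.diag = x.diag + d → componentOf x = componentOf y := by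
  intro d
  induction d with
  | zero => exact fun x y _ h => componentOf_eq_of_diag_eq h.symm
  | succ d ih =>
    intro x y h hd
    have h1 := y.not_cut
    have h2 : ¬ Cut θ.innerSteps θ.outerSteps (x.diag + d) := by
      intro hcut
      have h3 : x.diag + d ≤ y.start := hcut.le_lastCut (by omega)
      have h4 : x.start ≤ x.diag := lastCut_le _
      have h5 : x.start ≠ x.diag := fun h' => x.not_cut (h' ▸ cut_lastCut _)
      omega
    rw [hd, ← add_assoc] at h1
    obtain ⟨z, w, hz, hw, hzw⟩ := exists_adjacent_boxes h2 h1
    have hzs : z.start = y.start := by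
      rw [Box.start, Box.start, hz, hd, ← add_assoc, lastCut_succ_of_not_cut h1]
    rw [ih x z (h.trans hzs.symm) hz, hzw]
    exact componentOf_eq_of_diag_eq (by omega)

theorem componentOf_eq_iff (x y : θ.Box) : componentOf x = componentOf y ↔ x.start = y.start := by
  constructor
  · intro h
    have h1 : Relation.EqvGen (· ≤ ·) x y :=
      Quotient.exact (s := PosetComponents.setoid θ.Box) h
    induction h1 with
    | rel x y hxy => exact Box.start_eq_of_le hxy
    | refl x => rfl
    | symm x y _ ih => exact (ih h.symm).symm
    | trans x y z h1 _ ih1 ih2 =>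
      have h3 : componentOf x = componentOf y :=
        Quotient.sound (s := PosetComponents.setoid θ.Box) h1
      exact (ih1 h3).trans (ih2 (h3.symm.trans h))
  · intro h
    rcases le_total x.diag y.diag with h1 | h1
    · exact componentOf_eq_of_start_eq _ x y h (Nat.add_sub_cancel' h1).symm
    · exact (componentOf_eq_of_start_eq _ y x h.symm (Nat.add_sub_cancel' h1).symm).symm

theorem exists_box_start {s : ℕ} (hs : s ∈ blockStarts θ.innerSteps θ.outerSteps) :
    ∃ x : θ.Box, x.start = s := by
  obtain ⟨h1, h2⟩ := (mem_blockStarts θ.card_steps).1 hs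
  have h3 := θ.rk_outer_le_inner (s + 1)
  obtain ⟨x, hx, -⟩ := exists_box (θ := θ) (t := s + 1) (h := rk θ.outerSteps (s + 1)) le_rfl
    (lt_of_le_of_ne h3 (Ne.symm h2))
  refine ⟨x, ?_⟩
  rw [Box.start, hx, lastCut_succ_of_not_cut h2, h1.lastCut_eq]

/-- The connected components correspond to the blocks. -/
noncomputable def componentEquiv (θ : SkewDiagram m k) :
    blockStarts θ.innerSteps θ.outerSteps ≃ Component θ.Box :=
  Equiv.ofBijective (fun s => componentOf (exists_box_start s.2).choose) <| by
    constructor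
    · intro s s' h
      rw [componentOf_eq_iff, (exists_box_start s.2).choose_spec,
        (exists_box_start s'.2).choose_spec] at h
      exact Subtype.ext h
    · intro c
      obtain ⟨x, rfl⟩ := Quotient.exists_rep c
      refine ⟨⟨x.start, x.start_mem⟩, ?_⟩
      change componentOf _ = componentOf x
      rw [componentOf_eq_iff, (exists_box_start x.start_mem).choose_spec]

theorem componentOf_eq_componentEquiv (x : θ.Box) (s : blockStarts θ.innerSteps θ.outerSteps) :
    componentOf x = θ.componentEquiv s ↔ x.start = s := by
  change componentOf x = componentOf (exists_box_start s.2).choose ↔ _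
  rw [componentOf_eq_iff, (exists_box_start s.2).choose_spec]

/-- The boxes in a component are the lattice points between the rank functions of its block. -/
theorem exists_block_coordinates (s : blockStarts θ.innerSteps θ.outerSteps) :
    ∃ (n : ℕ) (a b : ℤ),
      IsBlock n (window θ.innerSteps θ.outerSteps θ.innerSteps s)
        (window θ.innerSteps θ.outerSteps θ.outerSteps s) ∧
      (∀ x : Elements (θ.componentEquiv s),
        IsPoint n (window θ.innerSteps θ.outerSteps θ.innerSteps s)
          (window θ.innerSteps θ.outerSteps θ.outerSteps s)
          (x.1.pos.2 - x.1.pos.1 + a) (b - x.1.pos.1)) ∧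
      ∀ u h, IsPoint n (window θ.innerSteps θ.outerSteps θ.innerSteps s)
          (window θ.innerSteps θ.outerSteps θ.outerSteps s) u h →
        ∃ x : Elements (θ.componentEquiv s), x.1.pos.2 - x.1.pos.1 + a = u ∧ b - x.1.pos.1 = h := by
  obtain ⟨n, hB, hn⟩ := exists_isBlock_window θ.card_steps θ.rk_outer_le_inner s.2
  have hs : rk θ.innerSteps s = rk θ.outerSteps s := ((mem_blockStarts θ.card_steps).1 s.2).1
  -- Subtracting the start `s` from the diagonal `j + m - i`, and the common rank at `s` from the
  -- height `m - 1 - i`, gives the offsets `a` and `b`.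
  refine ⟨n, m - s, m - 1 - rk θ.outerSteps s, hB, fun x => ?_, fun u h => ?_⟩
  · have hx : x.1.start = s := (componentOf_eq_componentEquiv x.1 s).1 x.2
    have h1 := (hn _).1 hx
    have h0 : x.1.diag ≠ s := fun h =>
      x.1.not_cut (h ▸ ((mem_blockStarts θ.card_steps).1 s.2).1)
    have h2 := x.1.row_lt
    have h3 := x.1.rk_le
    have h4 := x.1.lt_rk
    obtain ⟨u, hu⟩ : ∃ u, x.1.diag = s + u := ⟨x.1.diag - s, by omega⟩
    have hlast : lastCut θ.innerSteps θ.outerSteps (s + u) = s := by rw [← hu]; exact hx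
    have h5 := rk_window (J := θ.innerSteps) hlast
    have h6 := rk_window (J := θ.outerSteps) hlast
    rw [hu] at h0 h1 h3 h4
    rw [Box.diag] at hu
    have hu' : (x.1.pos.2 - x.1.pos.1 + (m - s) : ℤ) = u := by
      simp only [Box.pos]
      omega
    rw [hu', IsPoint, Int.toNat_natCast]
    simp only [Box.pos]
    omega
  · rintro ⟨h1, h2, h3, h4⟩
    obtain ⟨u, rfl⟩ := Int.eq_ofNat_of_zero_le h1.le
    rw [Int.toNat_natCast] at h3 h4
    obtain ⟨h, rfl⟩ := Int.eq_ofNat_of_zero_le ((Int.natCast_nonneg _).trans h3)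
    have h5 := hB.rk_lt u (by omega) (by omega)
    have hlast : lastCut θ.innerSteps θ.outerSteps (s + u) = s :=
      (hn _).2 (by omega)
    have h6 := rk_window (J := θ.innerSteps) hlast
    have h7 := rk_window (J := θ.outerSteps) hlast
    obtain ⟨x, hx, hxm⟩ := exists_box (θ := θ) (t := s + u) (h := rk θ.outerSteps s + h)
      (by omega) (by omega)
    have hstart : x.start = s := by rw [Box.start, hx, hlast]
    refine ⟨⟨x, (componentOf_eq_componentEquiv x s).2 hstart⟩, ?_, ?_⟩
    · rw [Box.diag] at hx
      simp only [Box.pos]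
      omega
    · simp only [Box.pos]
      omega

/-- Blocks of isomorphic or opposite components have equivalent cones. -/
theorem coneEquiv_of_components {m' k' : ℕ} {θ' : SkewDiagram m' k'}
    (s : blockStarts θ.innerSteps θ.outerSteps) (s' : blockStarts θ'.innerSteps θ'.outerSteps)
    (h : Nonempty (Elements (θ.componentEquiv s) ≃o Elements (θ'.componentEquiv s')) ∨
      Nonempty ((Elements (θ.componentEquiv s))ᵒᵈ ≃o Elements (θ'.componentEquiv s'))) :
    ConeEquiv (cone (block θ.innerSteps θ.outerSteps θ.innerSteps s)
        (block θ.innerSteps θ.outerSteps θ.outerSteps s))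
      (cone (block θ'.innerSteps θ'.outerSteps θ'.innerSteps s')
        (block θ'.innerSteps θ'.outerSteps θ'.outerSteps s')) := by
  refine (coneEquiv_window _ _ _).trans (ConeEquiv.trans ?_ (coneEquiv_window _ _ _).symm)
  obtain ⟨n, a, b, hB, hp, hq⟩ := exists_block_coordinates s
  obtain ⟨n', a', b', hB', hp', hq'⟩ := exists_block_coordinates s'
  have hι := isConvexEmbedding_component (θ.componentEquiv s)
  have hκ := isConvexEmbedding_component (θ'.componentEquiv s')
  -- In the coordinates `u = j - i + a` and `h = b - i`, transposition becomes `(-u, h - u)`,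
  -- rotation `(-u, -h)` and antitransposition `(u, u - h)`, up to constants. The values of `δ` and
  -- `η` below collect those constants.
  rcases h with ⟨⟨g⟩⟩ | ⟨⟨g⟩⟩
  · obtain ⟨T, hT, c, hg⟩ := exists_affine hι hκ g (component_connected _)
    rcases hT with rfl | rfl
    · simp only [Prod.ext_iff, id, Prod.fst_add, Prod.snd_add] at hg
      refine coneEquiv_of_translation hB hB' (δ := c.2 - c.1 + a' - a) (η := b' - b - c.1)
        (fun u h hu => ?_) fun u' h' hu => ?_
      · obtain ⟨x, hx1, hx2⟩ := hq u h hu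
        have hx3 := hg x
        convert! hp' (g x) using 1 <;> omega
      · obtain ⟨y, hy1, hy2⟩ := hq' u' h' hu
        obtain ⟨x, rfl⟩ := g.surjective y
        have hx3 := hg x
        exact ⟨_, _, hp x, by omega, by omega⟩
    · simp only [Prod.ext_iff, Prod.fst_swap, Prod.snd_swap, Prod.fst_add, Prod.snd_add] at hg
      refine coneEquiv_of_transposition hB hB' (δ := c.2 - c.1 + a' + a) (η := b' - b - c.1 + a)
        (fun u h hu => ?_) fun u' h' hu => ?_
      · obtain ⟨x, hx1, hx2⟩ := hq u h hu
        have hx3 := hg x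
        convert! hp' (g x) using 1 <;> omega
      · obtain ⟨y, hy1, hy2⟩ := hq' u' h' hu
        obtain ⟨x, rfl⟩ := g.surjective y
        have hx3 := hg x
        exact ⟨_, _, hp x, by omega, by omega⟩
  · have hconn : ∀ x y : (Elements (θ.componentEquiv s))ᵒᵈ, Relation.EqvGen (· ≤ ·) x y := by
      intro x y
      exact eqvGen_dual (component_connected _ (OrderDual.ofDual x) (OrderDual.ofDual y))
    obtain ⟨T, hT, c, hg⟩ := exists_affine hι.neg hκ g hconn
    rcases hT with rfl | rfl
    · simp only [Prod.ext_iff, id, Prod.fst_add, Prod.snd_add, Prod.fst_neg, Prod.snd_neg] at hg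
      refine coneEquiv_of_rotation hB hB' (δ := c.2 - c.1 + a' + a) (η := b' + b - c.1)
        (fun u h hu => ?_) fun u' h' hu => ?_
      · obtain ⟨x, hx1, hx2⟩ := hq u h hu
        have hx3 := hg (OrderDual.toDual x)
        rw [OrderDual.ofDual_toDual] at hx3
        convert! hp' (g (OrderDual.toDual x)) using 1 <;> omega
      · obtain ⟨y, hy1, hy2⟩ := hq' u' h' hu
        obtain ⟨x, rfl⟩ := g.surjective y
        have hx3 := hg x
        exact ⟨_, _, hp (OrderDual.ofDual x), by omega, by omega⟩
    · simp only [Prod.ext_iff, Prod.fst_swap, Prod.snd_swap, Prod.fst_add, Prod.snd_add,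
        Prod.fst_neg, Prod.snd_neg] at hg
      refine coneEquiv_of_antitransposition hB hB' (δ := c.2 - c.1 + a' - a)
        (η := b' + b - c.1 - a) (fun u h hu => ?_) fun u' h' hu => ?_
      · obtain ⟨x, hx1, hx2⟩ := hq u h hu
        have hx3 := hg (OrderDual.toDual x)
        rw [OrderDual.ofDual_toDual] at hx3
        convert! hp' (g (OrderDual.toDual x)) using 1 <;> omega
      · obtain ⟨y, hy1, hy2⟩ := hq' u' h' hu
        obtain ⟨x, rfl⟩ := g.surjective y
        have hx3 := hg x
        exact ⟨_, _, hp (OrderDual.ofDual x), by omega, by omega⟩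

theorem coneEquiv_of_semiIsomorphic {m' k' : ℕ} (θ : SkewDiagram m k) (θ' : SkewDiagram m' k')
    (h : SemiIsomorphic θ.Box θ'.Box) :
    ConeEquiv (cone θ.innerSteps θ.outerSteps) (cone θ'.innerSteps θ'.outerSteps) := by
  obtain ⟨f, hf⟩ := h
  refine (coneEquiv_blocks θ.card_steps θ.rk_outer_le_inner).trans
    (ConeEquiv.trans ?_ (coneEquiv_blocks θ'.card_steps θ'.rk_outer_le_inner).symm)
  refine ConeEquiv.pi ((θ.componentEquiv.trans f).trans θ'.componentEquiv.symm) fun s => ?_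
  apply coneEquiv_of_components
  rw [Equiv.trans_apply, Equiv.trans_apply, Equiv.apply_symm_apply]
  exact hf (θ.componentEquiv s)

end SkewDiagram

theorem proposition4p1 {m k m' k' : ℕ} (θ : SkewDiagram m k) (θ' : SkewDiagram m' k')
    (h : PosetComponents.SemiIsomorphic θ.Box θ'.Box) :
    ProjectiveVariety.Isomorphic (Grass.richardsonVariety θ) (Grass.richardsonVariety θ') :=
  ProjectiveVariety.isomorphic_of_coneEquiv (Grass.isCoordCone_richardsonVariety θ)
    (Grass.isCoordCone_richardsonVariety θ') (SkewDiagram.coneEquiv_of_semiIsomorphic θ θ' h)
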